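/- Let $G$ be a finite simple graph with $n$ vertices and $m$ edges and let $k\ge 0$ be an integer. A cluster graph is a disjoint union of cliques; its clusters are its connected components. There is an algorithm that, given $k$ and the adjacency lists of $G$, decides in time $O(2^k\cdot k^3\cdot(n+m))$ whether $V(G)$ can be partitioned into two (possibly empty) sets $A$ and $B$ such that $G[A]$ is a cluster graph with at most $k$ clusters and $G[B]$ is edgeless. Here the running time is the number of steps of a single program, which does not depend on $G$ or $k$, on a unit-cost word RAM with words of $O(\log(n+m+k+2))$ bits; the implied constants are absolute; and in the time bound the factor $k^3$ is read as $1$ when $k=0$, and the factor $n+m$ is read as $1$ when $n=0$. -/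

import Mathlib

/-! ### Monopolar partitions -/

/-- A cluster graph: a disjoint union of cliques, that is, a graph in which every connected
component is a clique. Its clusters are its connected components. -/
def IsClusterGraph {V : Type*} (G : SimpleGraph V) : Prop :=
  ∀ u v : V, G.Reachable u v → u ≠ v → G.Adj u v

/-- `(A, B)` is a monopolar partition of `G` such that `G[A]` has at most `k` clusters.
Either part may be empty. -/
structure IsMonopolarPartition {V : Type*} (G : SimpleGraph V) (k : ℕ) (A B : Set V) : Prop where
  union_eq : A ∪ B = Set.univ
  disjoint : Disjoint A B
  cluster : IsClusterGraph (G.induce A)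
  card_clusters_le : ENat.card (G.induce A).ConnectedComponent ≤ k
  edgeless : G.induce B = ⊥

/-! ### A word RAM with structured programs -/

namespace RAM

/-- A memory content: scalar variables (registers) `var x`, and arrays `arr a` whose cells
`arr a i` are addressed by computed indices. A program mentions only finitely many variables
and arrays. -/
structure State where
  var : ℕ → ℕ
  arr : ℕ → ℕ → ℕ

/-- Overwrite one variable. -/
def State.setVar (s : State) (x v : ℕ) : State :=
  { s with var := Function.update s.var x v }

/-- Overwrite one array cell. -/
def State.setArr (s : State) (a i v : ℕ) : State :=
  { s with arr := Function.update s.arr a (Function.update (s.arr a) i v) }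

/-- Expressions. `read a e` is the cell of array `a` at the computed index `e`; `sub` is
truncated subtraction; the comparisons `lt` and `eq` give `1` (true) or `0` (false). -/
inductive Expr where
  | const (c : ℕ)
  | var (x : ℕ)
  | read (a : ℕ) (e : Expr)
  | add (e₁ e₂ : Expr)
  | sub (e₁ e₂ : Expr)
  | mul (e₁ e₂ : Expr)
  | lt (e₁ e₂ : Expr)
  | eq (e₁ e₂ : Expr)

/-- The value of an expression. -/
def Expr.eval (s : State) : Expr → ℕ
  | .const c => c
  | .var x => s.var x
  | .read a e => s.arr a (e.eval s)
  | .add e₁ e₂ => e₁.eval s + e₂.eval s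
  | .sub e₁ e₂ => e₁.eval s - e₂.eval s
  | .mul e₁ e₂ => e₁.eval s * e₂.eval s
  | .lt e₁ e₂ => if e₁.eval s < e₂.eval s then 1 else 0
  | .eq e₁ e₂ => if e₁.eval s = e₂.eval s then 1 else 0

/-- The cost of evaluating an expression: one time unit per constant, variable access, array
access, arithmetic operation and comparison. -/
def Expr.cost : Expr → ℕ
  | .const _ => 1
  | .var _ => 1
  | .read _ e => e.cost + 1
  | .add e₁ e₂ => e₁.cost + e₂.cost + 1
  | .sub e₁ e₂ => e₁.cost + e₂.cost + 1
  | .mul e₁ e₂ => e₁.cost + e₂.cost + 1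
  | .lt e₁ e₂ => e₁.cost + e₂.cost + 1
  | .eq e₁ e₂ => e₁.cost + e₂.cost + 1

/-- No overflow: the value of the expression and of all its subexpressions (in particular,
every array index that is used) is below `W`, that is, fits into a machine word. -/
def Expr.Fits (W : ℕ) (s : State) : Expr → Prop
  | .const c => c < W
  | .var x => s.var x < W
  | .read a e => e.Fits W s ∧ s.arr a (e.eval s) < W
  | .add e₁ e₂ => e₁.Fits W s ∧ e₂.Fits W s ∧ e₁.eval s + e₂.eval s < W
  | .sub e₁ e₂ => e₁.Fits W s ∧ e₂.Fits W s
  | .mul e₁ e₂ => e₁.Fits W s ∧ e₂.Fits W s ∧ e₁.eval s * e₂.eval s < W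
  | .lt e₁ e₂ => e₁.Fits W s ∧ e₂.Fits W s ∧ 1 < W
  | .eq e₁ e₂ => e₁.Fits W s ∧ e₂.Fits W s ∧ 1 < W

/-- Programs. A guard of `ite` or `loop` is true when its value is nonzero. -/
inductive Prog where
  | skip
  | assign (x : ℕ) (e : Expr)
  | write (a : ℕ) (i e : Expr)
  | seq (p q : Prog)
  | ite (e : Expr) (p q : Prog)
  | loop (e : Expr) (p : Prog)

/-- `Exec W p s s' t`: started in `s`, on a machine whose words hold the numbers below `W`, the
program `p` halts in `s'` after exactly `t` time units, without any overflow. Execution is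
deterministic; there is no rule for a step that overflows, so such a run does not count as
halting. -/
inductive Exec (W : ℕ) : Prog → State → State → ℕ → Prop where
  | skip (s : State) : Exec W .skip s s 1
  | assign (s : State) (x : ℕ) (e : Expr) (he : e.Fits W s) :
      Exec W (.assign x e) s (s.setVar x (e.eval s)) (e.cost + 1)
  | write (s : State) (a : ℕ) (i e : Expr) (hi : i.Fits W s) (he : e.Fits W s) :
      Exec W (.write a i e) s (s.setArr a (i.eval s) (e.eval s)) (i.cost + e.cost + 1)
  | seq {p q : Prog} {s s' s'' : State} {t t' : ℕ}
      (hp : Exec W p s s' t) (hq : Exec W q s' s'' t') :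
      Exec W (.seq p q) s s'' (t + t')
  | ite_true {e : Expr} {p q : Prog} {s s' : State} {t : ℕ}
      (he : e.Fits W s) (h : e.eval s ≠ 0) (hp : Exec W p s s' t) :
      Exec W (.ite e p q) s s' (e.cost + 1 + t)
  | ite_false {e : Expr} {p q : Prog} {s s' : State} {t : ℕ}
      (he : e.Fits W s) (h : e.eval s = 0) (hq : Exec W q s s' t) :
      Exec W (.ite e p q) s s' (e.cost + 1 + t)
  | loop_true {e : Expr} {p : Prog} {s s' s'' : State} {t t' : ℕ}
      (he : e.Fits W s) (h : e.eval s ≠ 0) (hp : Exec W p s s' t)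
      (hl : Exec W (.loop e p) s' s'' t') :
      Exec W (.loop e p) s s'' (e.cost + 1 + t + t')
  | loop_false {e : Expr} {p : Prog} {s : State}
      (he : e.Fits W s) (h : e.eval s = 0) :
      Exec W (.loop e p) s s (e.cost + 1)

end RAM

/-! ### The input of the algorithm -/

/-- `L` is an adjacency-list representation of `G`: `L v` lists the neighbours of `v`, each
exactly once, in any order. -/
def IsAdjacencyLists {n : ℕ} (G : SimpleGraph (Fin n)) (L : Fin n → List (Fin n)) : Prop :=
  ∀ v, (L v).Nodup ∧ ∀ w, w ∈ L v ↔ G.Adj v w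

/-- The initial memory for the adjacency lists `L` of a graph on the vertices `0, …, n - 1` and
the parameter `k`. Variable `0` holds `n` and variable `1` holds `k`. Array `1` holds the
concatenation of the lists `L 0, …, L (n - 1)`, and cell `i ≤ n` of array `0` holds the total
length of the first `i` lists, so that `L v` occupies the cells from `arr 0 v` (included) to
`arr 0 (v + 1)` (excluded) of array `1`. Everything else is `0`. -/
def inputState {n : ℕ} (L : Fin n → List (Fin n)) (k : ℕ) : RAM.State where
  var x := if x = 0 then n else if x = 1 then k else 0
  arr a i :=
    if a = 0 then
      if i ≤ n then ((List.ofFn L).take i).flatten.length else 0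
    else if a = 1 then
      ((List.ofFn L).flatten.map Fin.val).getD i 0
    else 0

/-! ### A program logic with running times -/

namespace RAM

-- The algorithm is iterative compression. Vertices are inserted one at a time, in order of
-- nondecreasing degree, and a solution on the vertices inserted so far is kept as a labelling `f`.
-- Solutions restrict to subsets of vertices (`IsSol.restrict`), so if some stage has no solution,
-- neither has the whole graph. What remains is to extend `f` by a new vertex `v`, or to show that
-- this is impossible.
--
-- Let `g` be a solution on the enlarged vertex set. Two vertices of the edgeless part of `f` are
-- nonadjacent, so they cannot lie in one cluster of `g`; exchanging `f` and `g`, at most `2 * k`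
-- old vertices change sides in total (`card_flips_le`). The algorithm guesses the side of `v` in
-- `g` and, for every nonempty cluster of `f`, the side of one representative. If a representative
-- leaves its cluster, every other member is its neighbour and therefore stays. Hence each cluster
-- that is still inhabited obtains a decided vertex, its pin, adjacent to all its other members.
--
-- From then on everything is forced. If a decided `w` conflicts with an undecided old vertex `u`,
-- then `u` changes sides (`flip_of_not_ok`): had it stayed in its cluster, `g` would place it with
-- its pin, and the pin is compatible with `w`. A vertex entering the clusters joins an adjacent pin
-- or, if there is none, an empty cluster (`Cons.update_adj`, `Cons.update_fresh`). The run fails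
-- only if no solution matches the guess: two decided vertices conflict (`Cons.ok`), more than `2 *
-- k` flips would be needed (`Flips.lt_cap`), or a vertex that must enter a cluster finds none
-- (`Cons.exists_adj`). The invariant `Core.cons` expresses this by quantifying over all matching
-- `g` at once. If the queue of decided vertices runs empty without failure, no conflicting pair is
-- left. Every `g` matches some guess (`Extends.exists_match`), so the search is complete.
--
-- For the time bound, the queue holds at most `2 * k` anchors, `v` and `2 * k` flips. A decided
-- vertex is compared only with its own neighbours and with those of the pin of its cluster, because
-- a conflicting non-neighbour has the same label and so is adjacent to the pin. By the insertion
-- order both lists have length at most `deg v`, and one comparison costs `O(k)` with an adjacency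
-- matrix. A guess thus costs `O(k ^ 2 * (deg v + 1))`, there are `2 ^ (k + 2)` guesses, and the sum
-- of `deg v + 1` over all vertices is `2 * m + n`. This even gives `k ^ 2`; the third factor `k` is
-- slack. The matrix is never cleared, since memory starts at zero.
--
-- On the formal side, `Run` is a total-correctness triple with a time bound. Loops are handled by
-- an invariant and a potential (`Run.loop`), and untouched memory by the syntactic `Frame`.

infixr:60 " ;; " => Prog.seq

@[simp] theorem State.setVar_var (s : State) (x v y : ℕ) :
    (s.setVar x v).var y = if y = x then v else s.var y := by
  simp [State.setVar, Function.update_apply]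

@[simp] theorem State.setVar_arr (s : State) (x v : ℕ) : (s.setVar x v).arr = s.arr := rfl

@[simp] theorem State.setArr_var (s : State) (a i v : ℕ) : (s.setArr a i v).var = s.var := rfl

@[simp] theorem State.setArr_arr (s : State) (a i v b : ℕ) :
    (s.setArr a i v).arr b = if b = a then Function.update (s.arr a) i v else s.arr b := by
  simp [State.setArr, Function.update_apply]

theorem Expr.lt_eval_ne_zero {s : State} {e₁ e₂ : Expr} :
    (Expr.lt e₁ e₂).eval s ≠ 0 ↔ e₁.eval s < e₂.eval s := by simp [Expr.eval]

theorem Expr.lt_eval_eq_zero {s : State} {e₁ e₂ : Expr} :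
    (Expr.lt e₁ e₂).eval s = 0 ↔ e₂.eval s ≤ e₁.eval s := by simp [Expr.eval]

theorem Expr.eq_eval_ne_zero {s : State} {e₁ e₂ : Expr} :
    (Expr.eq e₁ e₂).eval s ≠ 0 ↔ e₁.eval s = e₂.eval s := by simp [Expr.eval]

theorem Expr.eq_eval_eq_zero {s : State} {e₁ e₂ : Expr} :
    (Expr.eq e₁ e₂).eval s = 0 ↔ e₁.eval s ≠ e₂.eval s := by simp [Expr.eval]

/-- The program `p`, started in `s`, halts within `T` time units in a state satisfying `Q`. -/
def Run (W : ℕ) (p : Prog) (s : State) (T : ℕ) (Q : State → Prop) : Prop :=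
  ∃ s' t, Exec W p s s' t ∧ t ≤ T ∧ Q s'

/-- The variables that a program may modify. -/
def Prog.modVars : Prog → List ℕ
  | .skip => []
  | .assign x _ => [x]
  | .write _ _ _ => []
  | .seq p q => p.modVars ++ q.modVars
  | .ite _ p q => p.modVars ++ q.modVars
  | .loop _ p => p.modVars

/-- The arrays that a program may modify. -/
def Prog.modArrs : Prog → List ℕ
  | .skip => []
  | .assign _ _ => []
  | .write a _ _ => [a]
  | .seq p q => p.modArrs ++ q.modArrs
  | .ite _ p q => p.modArrs ++ q.modArrs
  | .loop _ p => p.modArrs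

/-- The states `s` and `s'` agree on everything that `p` cannot modify. -/
structure Frame (p : Prog) (s s' : State) : Prop where
  var : ∀ x, x ∉ p.modVars → s'.var x = s.var x
  arr : ∀ a, a ∉ p.modArrs → s'.arr a = s.arr a

theorem Frame.refl (p : Prog) (s : State) : Frame p s s := ⟨fun _ _ => rfl, fun _ _ => rfl⟩

theorem Frame.trans {p : Prog} {s s' s'' : State} (h : Frame p s s') (h' : Frame p s' s'') :
    Frame p s s'' :=
  ⟨fun x hx => (h'.var x hx).trans (h.var x hx), fun a ha => (h'.arr a ha).trans (h.arr a ha)⟩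

theorem Frame.of_subset {p q : Prog} {s s' : State} (h : Frame p s s')
    (hv : p.modVars ⊆ q.modVars) (ha : p.modArrs ⊆ q.modArrs) : Frame q s s' :=
  ⟨fun x hx => h.var x fun hm => hx (hv hm), fun a hx => h.arr a fun hm => hx (ha hm)⟩

/-- A syntactic frame rule. Specifications may then mention only what changes; everything else is
recovered by deciding membership in the finite lists `modVars` and `modArrs`. -/
theorem Exec.frame {W : ℕ} {p : Prog} {s s' : State} {t : ℕ} (h : Exec W p s s' t) :
    Frame p s s' := by
  induction h with
  | skip s => exact Frame.refl _ _
  | assign s x e he =>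
    refine ⟨fun y hy => ?_, fun _ _ => rfl⟩
    have : y ≠ x := by simpa [Prog.modVars] using hy
    simp [this]
  | write s a i e hi he =>
    refine ⟨fun _ _ => rfl, fun b hb => ?_⟩
    have : b ≠ a := by simpa [Prog.modArrs] using hb
    simp [this]
  | seq _ _ ih ih' =>
    exact (ih.of_subset (by simp [Prog.modVars]) (by simp [Prog.modArrs])).trans
      (ih'.of_subset (by simp [Prog.modVars]) (by simp [Prog.modArrs]))
  | ite_true _ _ _ ih => exact ih.of_subset (by simp [Prog.modVars]) (by simp [Prog.modArrs])
  | ite_false _ _ _ ih => exact ih.of_subset (by simp [Prog.modVars]) (by simp [Prog.modArrs])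
  | loop_true _ _ _ _ ih ih' =>
    exact (ih.of_subset (by simp [Prog.modVars]) (by simp [Prog.modArrs])).trans ih'
  | loop_false _ _ => exact Frame.refl _ _

/-! ### Proof rules for the program constructs -/

namespace Run

variable {W : ℕ} {p q r : Prog} {s : State} {T : ℕ} {Q R : State → Prop}

theorem mono {T' : ℕ} (h : Run W p s T Q) (hT : T ≤ T') (hQ : ∀ s', Q s' → R s') :
    Run W p s T' R := by
  obtain ⟨s', t, he, ht, hq⟩ := h
  exact ⟨s', t, he, ht.trans hT, hQ _ hq⟩

theorem frame (h : Run W p s T Q) : Run W p s T fun s' => Q s' ∧ Frame p s s' := by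
  obtain ⟨s', t, he, ht, hq⟩ := h
  exact ⟨s', t, he, ht, hq, he.frame⟩

/-- Sequential composition. -/
theorem bind (T₁ : ℕ) (h : Run W p s T₁ R) (hT : T₁ ≤ T)
    (h' : ∀ s', R s' → Frame p s s' → Run W q s' (T - T₁) Q) : Run W (p ;; q) s T Q := by
  obtain ⟨s', t, he, ht, hq⟩ := h
  obtain ⟨s'', t', he', ht', hq'⟩ := h' s' hq he.frame
  exact ⟨s'', t + t', .seq he he', by omega, hq'⟩

theorem skip_iff : Run W .skip s T Q ↔ 1 ≤ T ∧ Q s := by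
  constructor
  · rintro ⟨_, _, ⟨⟩, ht, hq⟩; exact ⟨ht, hq⟩
  · rintro ⟨ht, hq⟩; exact ⟨_, _, .skip s, ht, hq⟩

theorem assign_iff {x : ℕ} {e : Expr} : Run W (.assign x e) s T Q ↔
    e.Fits W s ∧ e.cost + 1 ≤ T ∧ Q (s.setVar x (e.eval s)) := by
  constructor
  · rintro ⟨_, _, ⟨⟩, ht, hq⟩; exact ⟨‹_›, ht, hq⟩
  · rintro ⟨he, ht, hq⟩; exact ⟨_, _, .assign s x e he, ht, hq⟩

theorem write_iff {a : ℕ} {i e : Expr} : Run W (.write a i e) s T Q ↔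
    i.Fits W s ∧ e.Fits W s ∧ i.cost + e.cost + 1 ≤ T ∧ Q (s.setArr a (i.eval s) (e.eval s)) := by
  constructor
  · rintro ⟨_, _, ⟨⟩, ht, hq⟩; exact ⟨‹_›, ‹_›, ht, hq⟩
  · rintro ⟨hi, he, ht, hq⟩; exact ⟨_, _, .write s a i e hi he, ht, hq⟩

/-- Being an equivalence, this rewrites straight-line code by symbolic execution, the time budget
decreasing as it goes. -/
theorem assign_seq_iff {x : ℕ} {e : Expr} : Run W (.assign x e ;; q) s T Q ↔
    e.Fits W s ∧ e.cost + 1 ≤ T ∧ Run W q (s.setVar x (e.eval s)) (T - (e.cost + 1)) Q := by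
  constructor
  · rintro ⟨_, _, ⟨⟩ | ⟨⟩ | ⟨⟩ | ⟨⟨⟩, h⟩, ht, hq⟩
    exact ⟨‹_›, by omega, _, _, h, by omega, hq⟩
  · rintro ⟨he, ht, h⟩
    exact bind _ (assign_iff.2 ⟨he, le_rfl, rfl⟩) ht fun s' hs _ => hs ▸ h

theorem write_seq_iff {a : ℕ} {i e : Expr} : Run W (.write a i e ;; q) s T Q ↔
    i.Fits W s ∧ e.Fits W s ∧ i.cost + e.cost + 1 ≤ T ∧
      Run W q (s.setArr a (i.eval s) (e.eval s)) (T - (i.cost + e.cost + 1)) Q := by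
  constructor
  · rintro ⟨_, _, ⟨⟩ | ⟨⟩ | ⟨⟩ | ⟨⟨⟩, h⟩, ht, hq⟩
    exact ⟨‹_›, ‹_›, by omega, _, _, h, by omega, hq⟩
  · rintro ⟨hi, he, ht, h⟩
    exact bind _ (write_iff.2 ⟨hi, he, le_rfl, rfl⟩) ht fun s' hs _ => hs ▸ h

theorem ite_iff {e : Expr} : Run W (.ite e p q) s T Q ↔
    e.Fits W s ∧ e.cost + 1 ≤ T ∧ (e.eval s ≠ 0 → Run W p s (T - (e.cost + 1)) Q) ∧
      (e.eval s = 0 → Run W q s (T - (e.cost + 1)) Q) := by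
  constructor
  · rintro ⟨s', _, h, ht, hq⟩
    cases h with
    | ite_true he h hp =>
      exact ⟨he, by omega, fun _ => ⟨_, _, hp, by omega, hq⟩, fun h' => absurd h' h⟩
    | ite_false he h hp =>
      exact ⟨he, by omega, fun h' => absurd h h', fun _ => ⟨_, _, hp, by omega, hq⟩⟩
  · rintro ⟨he, ht, h1, h2⟩
    by_cases h : e.eval s = 0
    · obtain ⟨s', t, hx, ht', hq⟩ := h2 h
      exact ⟨s', _, .ite_false he h hx, by omega, hq⟩
    · obtain ⟨s', t, hx, ht', hq⟩ := h1 h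
      exact ⟨s', _, .ite_true he h hx, by omega, hq⟩

/-- The rule for loops: `I` is an invariant with a ghost parameter, and the potential `Φ` pays for
the iterations. -/
theorem loop {γ : Type*} {e : Expr} (I : γ → State → Prop) (Φ : γ → State → ℕ) {c₀ : γ}
    {s₀ : State} (h₀ : I c₀ s₀) (hF : ∀ c s, I c s → Frame p s₀ s → e.Fits W s)
    (hB : ∀ c s, I c s → Frame p s₀ s → e.eval s ≠ 0 → ∃ T, Run W p s T fun s' =>
      ∃ c', I c' s' ∧ e.cost + 1 + T + Φ c' s' ≤ Φ c s) :
    Run W (.loop e p) s₀ (Φ c₀ s₀ + (e.cost + 1))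
      fun s' => ∃ c, I c s' ∧ e.eval s' = 0 ∧ Frame p s₀ s' := by
  suffices H : ∀ (N : ℕ) (c : γ) (s : State), Φ c s ≤ N → I c s → Frame p s₀ s →
      Run W (.loop e p) s (Φ c s + (e.cost + 1))
        fun s' => ∃ c, I c s' ∧ e.eval s' = 0 ∧ Frame p s₀ s' from
    H _ c₀ s₀ le_rfl h₀ (Frame.refl _ _)
  intro N
  induction N with
  | zero =>
    intro c s hN hI hf
    by_cases h : e.eval s = 0
    · exact ⟨s, _, .loop_false (hF c s hI hf) h, by omega, c, hI, h, hf⟩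
    · obtain ⟨T, s', t, hx, ht, c', hI', hle⟩ := hB c s hI hf h
      -- The guard alone costs at least one unit, so potential zero leaves no room for an iteration.
      omega
  | succ N ih =>
    intro c s hN hI hf
    by_cases h : e.eval s = 0
    · exact ⟨s, _, .loop_false (hF c s hI hf) h, by omega, c, hI, h, hf⟩
    · obtain ⟨T, s', t, hx, ht, c', hI', hle⟩ := hB c s hI hf h
      obtain ⟨s'', t', hx', ht', hq⟩ := ih c' s' (by omega) hI' (hf.trans hx.frame)
      exact ⟨s'', _, .loop_true (hF c s hI hf) h hx hx', by omega, hq⟩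

end Run

/-- `for x from (its current value) while x < hi`. -/
def Prog.forUp (x : ℕ) (hi : Expr) (body : Prog) : Prog :=
  .loop (.lt (.var x) hi) (body ;; .assign x (.add (.var x) (.const 1)))

/-- The rule for counting loops with a constant bound `b`. -/
theorem Run.forUp {W x b C : ℕ} {hi : Expr} {body : Prog} (I : ℕ → State → Prop) {s₀ : State}
    (hW : 1 < W) (hbW : b < W) (h₀ : I (s₀.var x) s₀) (hle : s₀.var x ≤ b)
    (hx : x ∉ body.modVars)
    (hhi : ∀ i s, I i s → Frame (Prog.forUp x hi body) s₀ s → hi.Fits W s ∧ hi.eval s = b)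
    (hbody : ∀ i s, I i s → s₀.var x ≤ i → i < b → s.var x = i →
      Frame (Prog.forUp x hi body) s₀ s →
      Run W body s C fun s' => I (i + 1) (s'.setVar x (i + 1))) :
    Run W (Prog.forUp x hi body) s₀ ((b - s₀.var x) * (C + hi.cost + 7) + (hi.cost + 3))
      fun s' => I b s' ∧ s'.var x = b ∧ Frame (Prog.forUp x hi body) s₀ s' := by
  have key := Run.loop (W := W) (e := .lt (.var x) hi)
    (p := body ;; .assign x (.add (.var x) (.const 1))) (s₀ := s₀) (c₀ := s₀.var x)
    (fun i s => I i s ∧ s.var x = i ∧ s₀.var x ≤ i ∧ i ≤ b)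
    (fun i _ => (b - i) * (C + hi.cost + 7)) ⟨h₀, rfl, le_rfl, hle⟩
    (by
      rintro i s ⟨hI, hxi, -, hib⟩ hf
      obtain ⟨h1, h2⟩ := hhi i s hI ⟨hf.var, hf.arr⟩
      exact ⟨by simp [Expr.Fits]; omega, h1, hW⟩)
    (by
      rintro i s ⟨hI, hxi, h0i, hib⟩ hf hg
      obtain ⟨h1, h2⟩ := hhi i s hI ⟨hf.var, hf.arr⟩
      have hlt : i < b := by
        by_contra hcon
        simp [Expr.eval, h2, hxi, hcon] at hg
      -- The `4` is the increment of the counter. With `hi.cost + 3` for the guard, a round costs `C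
      -- + hi.cost + 7`.
      refine ⟨C + 4, Run.bind C (hbody i s hI h0i hlt hxi ⟨hf.var, hf.arr⟩) (by omega)
        fun s' hs' hf' => ?_⟩
      have hx' : s'.var x = i := (hf'.var x hx).trans hxi
      rw [Run.assign_iff]
      refine ⟨⟨by simp [Expr.Fits]; omega, hW, by simp [Expr.eval]; omega⟩,
        by simp [Expr.cost], i + 1, ⟨?_, by simp [Expr.eval, hx'], by omega, by omega⟩, ?_⟩
      · simpa [Expr.eval, hx'] using hs'
      · have : b - i = (b - (i + 1)) + 1 := by omega
        rw [this, Nat.add_mul]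
        simp only [Expr.cost]
        omega)
  refine key.mono (by simp [Expr.cost]; omega) ?_
  rintro s' ⟨i, ⟨hI, hxi, -, hib⟩, hg, hf⟩
  obtain ⟨h1, h2⟩ := hhi i s' hI ⟨hf.var, hf.arr⟩
  have : i = b := by
    by_contra hcon
    have : i < b := by omega
    simp [Expr.eval, h2, hxi, this] at hg
  subst this
  exact ⟨hI, hxi, hf.var, hf.arr⟩

end RAM

/-! ### Labelled partitions and their extension by one vertex -/

namespace Monopolar

/-- An instance: adjacency lists `nbr (off u), …, nbr (off (u + 1) - 1)` of a graph on the
vertices below `n`, the number `k` of clusters, and a bound `W` for the machine words. -/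
structure Inst where
  n : ℕ
  k : ℕ
  W : ℕ
  off : ℕ → ℕ
  nbr : ℕ → ℕ
  E : ℕ → ℕ → Prop
  symm : ∀ {a b}, E a b → E b a
  irrefl : ∀ a, ¬ E a a
  lt : ∀ {a b}, E a b → a < n
  off_le : ∀ u, u < n → off u ≤ off (u + 1)
  mem : ∀ u, u < n → ∀ w, E u w ↔ ∃ e, off u ≤ e ∧ e < off (u + 1) ∧ nbr e = w
  off_lt : ∀ u, u ≤ n → off u < W
  sq_lt : n * n < W
  n_lt : n + 10 < W
  k_lt : 4 * k + 10 < W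

variable (I : Inst)

/-- The degree of a vertex. -/
def Inst.deg (u : ℕ) : ℕ := I.off (u + 1) - I.off u

theorem Inst.lt' {a b : ℕ} (h : I.E a b) : b < I.n := I.lt (I.symm h)

theorem Inst.ne {a b : ℕ} (h : I.E a b) : a ≠ b := fun hab => I.irrefl a (by rwa [← hab] at h)

/-- Labels: `0` is absent, `1` is the edgeless part, larger labels are clusters. The pair `a, b` of
distinct present vertices violates no condition. -/
def Ok (E : ℕ → ℕ → Prop) (f : ℕ → ℕ) (a b : ℕ) : Prop :=
  (f a = 1 → f b = 1 → ¬ E a b) ∧ (1 < f a → 1 < f b → (E a b ↔ f a = f b))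

theorem Inst.ok_symm {f : ℕ → ℕ} {a b : ℕ} (h : Ok I.E f a b) : Ok I.E f b a :=
  ⟨fun hb ha he => h.1 ha hb (I.symm he), fun hb ha =>
    ⟨fun he => ((h.2 ha hb).1 (I.symm he)).symm, fun he => I.symm ((h.2 ha hb).2 he.symm)⟩⟩

theorem Ok.congr {E : ℕ → ℕ → Prop} {f g : ℕ → ℕ} {a b : ℕ} (h : Ok E f a b) (ha : g a = f a)
    (hb : g b = f b) : Ok E g a b := by
  unfold Ok at *
  rwa [ha, hb]

/-- The labelling `f` is a monopolar partition of the graph induced by its support. -/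
structure IsSol (f : ℕ → ℕ) : Prop where
  le : ∀ u, f u ≤ I.k + 1
  ok : ∀ a b, f a ≠ 0 → f b ≠ 0 → a ≠ b → Ok I.E f a b

/-- `f` is a solution, to be extended by the vertex `v`, the degree of which is maximum. -/
structure Ext (f : ℕ → ℕ) (v : ℕ) : Prop where
  sol : IsSol I f
  lt : ∀ u, f u ≠ 0 → u < I.n
  v_lt : v < I.n
  absent : f v = 0
  deg_le : ∀ u, f u ≠ 0 → I.deg u ≤ I.deg v

/-- The solution `g` extends the support of `f` by `v` and agrees with the guess `bit` on `v` and
on the representatives `rep` of the clusters. -/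
structure Match (f : ℕ → ℕ) (v : ℕ) (rep bit : ℕ → ℕ) (g : ℕ → ℕ) : Prop where
  sol : IsSol I g
  supp : ∀ u, g u ≠ 0 ↔ f u ≠ 0 ∨ u = v
  rep : ∀ i r, 2 ≤ i → i < I.k + 2 → rep i = r + 1 → (bit i ≠ 0 ↔ g r ≠ 1)
  new : bit 1 ≠ 0 ↔ g v ≠ 1

/-- Bookkeeping: the decided vertices `dec` are in the queue `que`, and their former labels are
saved in `old`. -/
structure Trail (f : ℕ → ℕ) (v : ℕ) (lab dec old que : ℕ → ℕ) (len : ℕ) : Prop where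
  lab_le : ∀ u, lab u ≤ I.k + 1
  keep : ∀ u, dec u = 0 → lab u = f u
  saved : ∀ u, dec u ≠ 0 → old u = f u
  present : ∀ u, dec u ≠ 0 → (f u ≠ 0 ∨ u = v) ∧ lab u ≠ 0
  dec_le : ∀ u, dec u ≤ 1
  que_dec : ∀ j, j < len → dec (que j) ≠ 0
  mem_que : ∀ u, dec u ≠ 0 → ∃ j, j < len ∧ que j = u

/-- The clusters `2, …, j - 1` that are not empty contain decided vertices, their pins. -/
def Pins (E : ℕ → ℕ → Prop) (j : ℕ) (lab dec pin : ℕ → ℕ) : Prop :=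
  ∀ i, 2 ≤ i → i < j → (pin i = 0 → ∀ u, lab u ≠ i) ∧
    ∀ p, pin i = p + 1 → dec p ≠ 0 ∧ lab p = i ∧ ∀ u, lab u = i → u = p ∨ E u p

/-- The decided vertices are labelled as in `g`, up to a permutation of the clusters. -/
def Cons (g lab dec : ℕ → ℕ) : Prop :=
  (∀ w, dec w ≠ 0 → (lab w = 1 ↔ g w = 1)) ∧
    ∀ w w', dec w ≠ 0 → dec w' ≠ 0 → 1 < lab w → 1 < lab w' → (lab w = lab w' ↔ g w = g w')

variable {I} {f g lab dec old que pin rep bit : ℕ → ℕ} {v u w len : ℕ}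

theorem Ext.lt_of (hx : Ext I f v) (h : f u ≠ 0 ∨ u = v) : u < I.n := by
  rcases h with h | rfl
  exacts [hx.lt u h, hx.v_lt]

theorem Ext.deg_le_of (hx : Ext I f v) (h : f u ≠ 0 ∨ u = v) : I.deg u ≤ I.deg v := by
  rcases h with h | rfl
  exacts [hx.deg_le u h, le_rfl]

theorem Trail.present_of (ht : Trail I f v lab dec old que len) (h : lab u ≠ 0) :
    f u ≠ 0 ∨ u = v := by
  by_cases hd : dec u = 0
  · left; rwa [← ht.keep u hd]
  · exact (ht.present u hd).1

/-- Since `u` is still undecided, the label saved in `old` is its original label `f u`. -/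
theorem Trail.push (ht : Trail I f v lab dec old que len) {l : ℕ} (hu : f u ≠ 0 ∨ u = v)
    (hd : dec u = 0) (hl : 1 ≤ l) (hl' : l ≤ I.k + 1) :
    Trail I f v (Function.update lab u l) (Function.update dec u 1)
      (Function.update old u (lab u)) (Function.update que len u) (len + 1) where
  lab_le x := by
    have := ht.lab_le x
    rw [Function.update_apply]; split_ifs <;> omega
  keep x := by
    have := ht.keep x
    simp only [Function.update_apply]; split_ifs <;> simp_all
  saved x := by
    have := ht.saved x
    simp only [Function.update_apply]; split_ifs with h
    · subst h; intro _; exact ht.keep x hd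
    · exact this
  present x := by
    have := ht.present x
    simp only [Function.update_apply]; split_ifs with h
    · subst h; intro _; exact ⟨hu, by omega⟩
    · exact this
  dec_le x := by
    have := ht.dec_le x
    rw [Function.update_apply]; split_ifs <;> omega
  que_dec j hj := by
    simp only [Function.update_apply]
    by_cases h : j = len
    · simp [h]
    · have := ht.que_dec j (by omega)
      simp only [h, if_false]; split_ifs <;> omega
  mem_que x := by
    intro hx
    by_cases h : x = u
    · exact ⟨len, by omega, by simp [h]⟩
    · rw [Function.update_of_ne h] at hx
      obtain ⟨j, hj, hq⟩ := ht.mem_que x hx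
      exact ⟨j, by omega, by rw [Function.update_of_ne (by omega), hq]⟩

/-! ### Agreement of the decided vertices with a target solution -/

section cons

/-- The conditions on a pair depend only on sides and on equality of clusters, which `lab` and `g`
share on decided vertices. So a conflict between two decided vertices refutes the guess. -/
theorem Cons.ok (hc : Cons g lab dec) (hg : IsSol I g) (hw : dec w ≠ 0) (hu : dec u ≠ 0)
    (hgw : g w ≠ 0) (hgu : g u ≠ 0) (hne : w ≠ u) :
    Ok I.E lab w u := by
  have h := hg.ok w u hgw hgu hne
  have h1 := hc.1 w hw
  have h2 := hc.1 u hu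
  refine ⟨fun a b => h.1 (h1.1 a) (h2.1 b), fun a b => ?_⟩
  rw [hc.2 w u hw hu a b]
  exact h.2 (by omega) (by omega)

/-- A vertex that is in conflict with a decided vertex has to change sides. -/
theorem flip_of_not_ok (ht : Trail I f v lab dec old que len)
    (hp : Pins I.E (I.k + 2) lab dec pin) (hc : Cons g lab dec) (hg : IsSol I g)
    (hs : ∀ u, g u ≠ 0 ↔ f u ≠ 0 ∨ u = v) (hw : dec w ≠ 0) (hu : dec u = 0) (hfu : f u ≠ 0)
    (hne : w ≠ u) (hn : ¬ Ok I.E lab w u) : f u = 1 ↔ g u ≠ 1 := by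
  have hlu : lab u = f u := ht.keep u hu
  have hgu : g u ≠ 0 := (hs u).2 (.inl hfu)
  have hgw : g w ≠ 0 := (hs w).2 (ht.present w hw).1
  have hok := hg.ok w u hgw hgu hne
  have h1 := hc.1 w hw
  constructor
  · intro h hgu1
    apply hn
    refine ⟨fun a b => hok.1 (h1.1 a) hgu1, fun a b => ?_⟩
    omega
  · intro hgu1
    by_contra hfu1
    apply hn
    refine ⟨fun a b => by omega, fun a b => ?_⟩
    -- Here `u` stays in the clusters of `g`. It is adjacent to the pin `p` of its own cluster, so
    -- `g u = g p`, and comparing `w` with `u` amounts to comparing `w` with the decided vertex `p`.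
    obtain ⟨hp0, hp1⟩ := hp (lab u) b (by have := ht.lab_le u; omega)
    rcases hpi : pin (lab u) with _ | p
    · exact absurd rfl (hp0 hpi u)
    obtain ⟨hdp, hlp, hpu⟩ := hp1 p hpi
    have hup : u ≠ p := fun h => hdp (h ▸ hu)
    have hE := (hpu u rfl).resolve_left hup
    have hgp : g p ≠ 0 := (hs p).2 (ht.present p hdp).1
    have hgp1 : g p ≠ 1 := fun h => by have := (hc.1 p hdp).2 h; omega
    have e1 : g u = g p := ((hg.ok u p hgu hgp hup).2 (by omega) (by omega)).1 hE
    rw [hok.2 (by omega) (by omega), e1, ← hlp]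
    exact (hc.2 w p hw hdp a (by omega)).symm

theorem Cons.update_one (hc : Cons g lab dec) (hg : g u = 1) :
    Cons g (Function.update lab u 1) (Function.update dec u 1) := by
  constructor
  · intro w
    have := hc.1 w
    simp only [Function.update_apply]; split_ifs with h
    · subst h; simp [hg]
    · exact this
  · intro w w'
    have := hc.2 w w'
    simp only [Function.update_apply]; split_ifs
    all_goals omega

/-- The label `t` need not be `g u`: clusters are matched only up to renaming, so it suffices that
`t` is used by exactly the decided vertices that share the cluster of `u` in `g`. -/
theorem Cons.update_of {t : ℕ} (hc : Cons g lab dec) (hg : g u ≠ 1) (ht : 1 < t)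
    (h : ∀ w, dec w ≠ 0 → 1 < lab w → (lab w = t ↔ g w = g u)) :
    Cons g (Function.update lab u t) (Function.update dec u 1) := by
  constructor
  · intro w
    have := hc.1 w
    simp only [Function.update_apply]; split_ifs with h
    · subst h; intro _; constructor <;> omega
    · exact this
  · intro w w'
    have := hc.2 w w'
    have h1 := h w
    have h2 := h w'
    simp only [Function.update_apply]; split_ifs with a b b
    · subst a b; simp
    · subst a; intro _ hw' _ hl'; rw [eq_comm, h2 hw' hl', eq_comm]
    · subst b; intro hw _ hl _; exact h1 hw hl
    · exact this

/-- Adjacent vertices outside the edgeless part of `g` share a cluster of `g`, so `u` has to go with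
the pin `p`. -/
theorem Cons.update_adj {t p : ℕ} (hc : Cons g lab dec) (hg : IsSol I g)
    (hp : Pins I.E (I.k + 2) lab dec pin) (hgu : g u ≠ 1) (hgu0 : g u ≠ 0) (hgp : g p ≠ 0)
    (ht : 2 ≤ t) (ht' : t < I.k + 2) (hpt : pin t = p + 1) (hE : I.E p u) :
    Cons g (Function.update lab u t) (Function.update dec u 1) := by
  obtain ⟨hd, hl, -⟩ := (hp t ht ht').2 p hpt
  have h1 := hc.1 p hd
  have e : g p = g u := ((hg.ok p u hgp hgu0 (I.ne hE)).2 (by omega) (by omega)).1 hE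
  refine hc.update_of hgu (by omega) fun w hw hlw => ?_
  rw [← e, ← hl]
  exact hc.2 w p hw hd hlw (by omega)

/-- If a decided `w` had `g w = g u`, the pin of the cluster of `w` would also lie in that cluster
of `g` and be adjacent to `u`. Hence the cluster of `u` in `g` has no decided vertex yet, and any
empty label may stand for it. -/
theorem Cons.update_fresh {t : ℕ} (hc : Cons g lab dec)
    (htr : Trail I f v lab dec old que len) (hg : IsSol I g)
    (hs : ∀ u, g u ≠ 0 ↔ f u ≠ 0 ∨ u = v)
    (hp : Pins I.E (I.k + 2) lab dec pin) (hgu : g u ≠ 1) (hgu0 : g u ≠ 0) (hd : dec u = 0)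
    (ht : 2 ≤ t) (ht' : t < I.k + 2) (hpt : pin t = 0)
    (hE : ∀ i p, 2 ≤ i → i < I.k + 2 → pin i = p + 1 → ¬ I.E p u) :
    Cons g (Function.update lab u t) (Function.update dec u 1) := by
  refine hc.update_of hgu (by omega) fun w hw hlw => ?_
  refine ⟨fun h => absurd h ((hp t ht ht').1 hpt w), fun h => ?_⟩
  exfalso
  obtain ⟨hp0, hp1⟩ := hp (lab w) hlw (by have := htr.lab_le w; omega)
  rcases hpi : pin (lab w) with _ | p
  · exact absurd rfl (hp0 hpi w)
  obtain ⟨hdp, hlp, -⟩ := hp1 p hpi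
  have hgp : g p ≠ 0 := (hs p).2 (htr.present p hdp).1
  have h1 := hc.1 p hdp
  have e1 : g p = g u := by rw [← h]; exact (hc.2 p w hdp hw (by omega) hlw).1 hlp
  have hne : p ≠ u := fun h => hdp (h ▸ hd)
  exact hE (lab w) p hlw (by have := htr.lab_le w; omega) hpi
    (((hg.ok p u hgp hgu0 hne).2 (by omega) (by omega)).2 e1)

/-- If all clusters have pins, then a vertex of a cluster is adjacent to a pin. -/
theorem Cons.exists_adj (hc : Cons g lab dec) (htr : Trail I f v lab dec old que len)
    (hg : IsSol I g) (hs : ∀ u, g u ≠ 0 ↔ f u ≠ 0 ∨ u = v)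
    (hp : Pins I.E (I.k + 2) lab dec pin) (hgu : g u ≠ 1) (hgu0 : g u ≠ 0) (hd : dec u = 0)
    (hfull : ∀ i, 2 ≤ i → i < I.k + 2 → pin i ≠ 0) :
    ∃ i p, 2 ≤ i ∧ i < I.k + 2 ∧ pin i = p + 1 ∧ I.E p u := by
  have hpin : ∀ i, 2 ≤ i → i < I.k + 2 → pin i = (pin i - 1) + 1 := fun i h h' => by
    have := hfull i h h'; omega
  -- Pigeonhole: pins of different clusters lie in different clusters of `g`, so sending `i` to the
  -- `g`-label of its pin is an injection of the `k` labels into themselves, hence onto; one pin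
  -- shares the cluster of `u`. Pins are stored shifted by one, whence `pin i - 1`.
  have hmaps : ∀ i ∈ Finset.Ico 2 (I.k + 2), g (pin i - 1) ∈ Finset.Ico 2 (I.k + 2) := by
    intro i hi
    rw [Finset.mem_Ico] at hi ⊢
    obtain ⟨hdp, hlp, -⟩ := (hp i hi.1 hi.2).2 _ (hpin i hi.1 hi.2)
    have h1 := hc.1 _ hdp
    have h2 := (hs _).2 (htr.present _ hdp).1
    have h3 := hg.le (pin i - 1)
    omega
  have hinj : Set.InjOn (fun i => g (pin i - 1)) (Finset.Ico 2 (I.k + 2) : Finset ℕ) := by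
    intro i hi j hj hij
    simp only [Finset.coe_Ico, Set.mem_Ico] at hi hj
    obtain ⟨hdp, hlp, -⟩ := (hp i hi.1 hi.2).2 _ (hpin i hi.1 hi.2)
    obtain ⟨hdq, hlq, -⟩ := (hp j hj.1 hj.2).2 _ (hpin j hj.1 hj.2)
    have := (hc.2 _ _ hdp hdq (by omega) (by omega)).2 hij
    omega
  have hsurj := Finset.surj_on_of_inj_on_of_card_le (s := Finset.Ico 2 (I.k + 2))
    (t := Finset.Ico 2 (I.k + 2)) (fun i _ => g (pin i - 1)) hmaps
    (fun a b ha hb hab => hinj ha hb hab) le_rfl (g u)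
    (by rw [Finset.mem_Ico]; have := hg.le u; omega)
  obtain ⟨i, hi, he⟩ := hsurj
  rw [Finset.mem_Ico] at hi
  obtain ⟨hdp, hlp, -⟩ := (hp i hi.1 hi.2).2 _ (hpin i hi.1 hi.2)
  have hne : pin i - 1 ≠ u := fun h => hdp (h ▸ hd)
  refine ⟨i, pin i - 1, hi.1, hi.2, hpin i hi.1 hi.2, ?_⟩
  exact ((hg.ok _ u ((hs _).2 (htr.present _ hdp).1) hgu0 hne).2 (by omega) (by omega)).2 he.symm

end cons

/-! ### Pins survive the relabelling of an undecided vertex -/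

section pins

variable {j : ℕ}

/-- Pins are decided, so an undecided vertex that leaves its cluster is never a pin. -/
theorem Pins.update_one (hp : Pins I.E j lab dec pin) (hd : dec u = 0) :
    Pins I.E j (Function.update lab u 1) (Function.update dec u 1) pin := by
  intro i hi hij
  obtain ⟨h0, h1⟩ := hp i hi hij
  constructor
  · intro h x
    have := h0 h x
    rw [Function.update_apply]; split_ifs <;> omega
  · intro p hpi
    obtain ⟨a, b, c⟩ := h1 p hpi
    have hne : p ≠ u := fun h => a (h ▸ hd)
    rw [Function.update_of_ne hne, Function.update_of_ne hne]
    refine ⟨a, b, fun x => ?_⟩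
    rw [Function.update_apply]; split_ifs
    · omega
    · exact c x

theorem Pins.update_adj {t p : ℕ} (hp : Pins I.E j lab dec pin) (hd : dec u = 0)
    (hpt : pin t = p + 1) (hE : I.E p u) :
    Pins I.E j (Function.update lab u t) (Function.update dec u 1) pin := by
  intro i hi hij
  obtain ⟨h0, h1⟩ := hp i hi hij
  constructor
  · intro h x
    have := h0 h x
    rw [Function.update_apply]; split_ifs
    · rintro rfl; omega
    · exact this
  · intro q hpi
    obtain ⟨a, b, c⟩ := h1 q hpi
    have hne : q ≠ u := fun h => a (h ▸ hd)
    rw [Function.update_of_ne hne, Function.update_of_ne hne]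
    refine ⟨a, b, fun x => ?_⟩
    rw [Function.update_apply]; split_ifs with hxu
    · rintro rfl
      obtain rfl : p = q := by omega
      subst hxu
      exact .inr (I.symm hE)
    · exact c x

/-- The cluster `t` was empty, so `u` is its only member and can serve as its pin. -/
theorem Pins.update_fresh {t : ℕ} (hp : Pins I.E j lab dec pin) (hd : dec u = 0)
    (hpt : pin t = 0) :
    Pins I.E j (Function.update lab u t) (Function.update dec u 1)
      (Function.update pin t (u + 1)) := by
  intro i hi hij
  obtain ⟨h0, h1⟩ := hp i hi hij
  by_cases hit : i = t
  · subst hit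
    rw [Function.update_self]
    refine ⟨by omega, fun p hpu => ?_⟩
    obtain rfl : u = p := by omega
    refine ⟨by simp, by simp, fun x => ?_⟩
    rw [Function.update_apply]; split_ifs with hxu
    · exact fun _ => .inl hxu
    · intro h; exact absurd h (h0 hpt x)
  · rw [Function.update_of_ne hit]
    constructor
    · intro h x
      have := h0 h x
      rw [Function.update_apply]; split_ifs
      · omega
      · exact this
    · intro q hpi
      obtain ⟨a, b, c⟩ := h1 q hpi
      have hne : q ≠ u := fun h => a (h ▸ hd)
      rw [Function.update_of_ne hne, Function.update_of_ne hne]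
      refine ⟨a, b, fun x => ?_⟩
      rw [Function.update_apply]; split_ifs with hxu
      · omega
      · exact c x

end pins

/-! ### The number of vertices that change sides -/

/-- Of the `len` vertices in the queue, `len - (cap - 2 * k)` have changed sides. -/
def Flips (k : ℕ) (f lab dec : ℕ → ℕ) (len cap fail : ℕ) : Prop :=
  ∃ F : Finset ℕ, F.card + cap = len + 2 * k ∧
    ∀ u ∈ F, dec u ≠ 0 ∧ f u ≠ 0 ∧ (fail = 0 → (lab u = 1 ↔ f u ≠ 1))

/-- The flag may rise from `fail` to `fail'` because a failed placement still pushes the vertex,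
with label `1` and so without a change of side; the last clause of `Flips` is then vacuous. -/
theorem Flips.push {k cap fail fail' l : ℕ} (h : Flips k f lab dec len cap fail)
    (hd : dec u = 0) (hf : f u ≠ 0) (hl : fail' = 0 → (l = 1 ↔ f u ≠ 1))
    (hfail : fail' = 0 → fail = 0) :
    Flips k f (Function.update lab u l) (Function.update dec u 1) (len + 1) cap fail' := by
  obtain ⟨F, hF, hF'⟩ := h
  have hu : u ∉ F := fun hu => (hF' u hu).1 hd
  refine ⟨insert u F, by rw [Finset.card_insert_of_notMem hu]; omega, fun x hx => ?_⟩
  rcases Finset.mem_insert.1 hx with rfl | hx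
  · simp [hf]; exact hl
  · have hne : x ≠ u := fun h => hu (h ▸ hx)
    obtain ⟨a, b, c⟩ := hF' x hx
    rw [Function.update_of_ne hne, Function.update_of_ne hne]
    exact ⟨a, b, fun h => c (hfail h)⟩

/-- At most `2 * k` vertices change sides between two solutions. -/
theorem card_flips_le (hf : IsSol I f) (hg : IsSol I g) (F : Finset ℕ)
    (hF : ∀ u ∈ F, f u ≠ 0 ∧ g u ≠ 0 ∧ (g u = 1 ↔ f u ≠ 1)) : F.card ≤ 2 * I.k := by
  -- Each cluster of the second solution receives at most one vertex from the edgeless part of the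
  -- first: two of them would be adjacent in one solution and nonadjacent in the other. This is
  -- applied in both directions.
  have key : ∀ f g : ℕ → ℕ, IsSol I f → IsSol I g → ∀ F : Finset ℕ,
      (∀ u ∈ F, f u = 1 ∧ 1 < g u) → F.card ≤ I.k := by
    intro f g hf hg F hF
    calc F.card ≤ (Finset.Ico 2 (I.k + 2)).card := by
          refine Finset.card_le_card_of_injOn g (fun u hu => ?_) fun a ha b hb hab => ?_
          · have := hF u hu
            have := hg.le u
            simp only [Finset.coe_Ico, Set.mem_Ico]; omega
          · by_contra hne
            have h1 := hF a ha
            have h2 := hF b hb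
            exact (hf.ok a b (by omega) (by omega) hne).1 h1.1 h2.1
              (((hg.ok a b (by omega) (by omega) hne).2 h1.2 h2.2).2 hab)
      _ = I.k := by simp
  have h1 := key f g hf hg (F.filter fun u => f u = 1) fun u hu => by
    rw [Finset.mem_filter] at hu
    have := hF u hu.1
    omega
  have h2 := key g f hg hf (F.filter fun u => ¬ f u = 1) fun u hu => by
    rw [Finset.mem_filter] at hu
    have := hF u hu.1
    omega
  have := Finset.card_filter_add_card_filter_not (s := F) (fun u => f u = 1)
  omega

/-- The recorded flips together with `u` are changes of side between `f` and `g`, hence at most `2 *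
k` of them. So fewer than `2 * k` are recorded, which by the bookkeeping identity means that the
queue has a free slot. -/
theorem Flips.lt_cap {cap : ℕ} (h : Flips I.k f lab dec len cap 0) (hx : Ext I f v)
    (hc : Cons g lab dec) (hg : IsSol I g) (hs : ∀ u, g u ≠ 0 ↔ f u ≠ 0 ∨ u = v)
    (hd : dec u = 0) (hfu : f u ≠ 0) (hfg : f u = 1 ↔ g u ≠ 1) : len < cap := by
  obtain ⟨F, hF, hF'⟩ := h
  have hu : u ∉ F := fun hu => (hF' u hu).1 hd
  have := card_flips_le hx.sol hg (insert u F) fun x hxF => by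
    rcases Finset.mem_insert.1 hxF with rfl | hxF
    · exact ⟨hfu, (hs x).2 (.inl hfu), by omega⟩
    · obtain ⟨a, b, c⟩ := hF' x hxF
      exact ⟨b, (hs x).2 (.inl b), by rw [← hc.1 x a]; exact c rfl⟩
  rw [Finset.card_insert_of_notMem hu] at this
  omega

end Monopolar

/-! ### The program: deciding one vertex -/

namespace Monopolar

open RAM RAM.Prog RAM.Expr

-- Names of the registers and arrays

local notation "xN" => (0 : ℕ)
local notation "xK" => (1 : ℕ)
local notation "xAns" => (2 : ℕ)
local notation "xV" => (3 : ℕ)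
local notation "xI" => (4 : ℕ)
local notation "xT" => (5 : ℕ)
local notation "xS" => (6 : ℕ)
local notation "xU" => (7 : ℕ)
local notation "xL" => (8 : ℕ)
local notation "xFail" => (9 : ℕ)
local notation "xLen" => (10 : ℕ)
local notation "xCap" => (11 : ℕ)
local notation "xQ" => (12 : ℕ)
local notation "xW" => (13 : ℕ)
local notation "xX" => (14 : ℕ)
local notation "xE" => (15 : ℕ)
local notation "xJ" => (16 : ℕ)
local notation "xDone" => (17 : ℕ)
local notation "xD" => (18 : ℕ)
local notation "xCur" => (19 : ℕ)
local notation "aOff" => (0 : ℕ)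
local notation "aNbr" => (1 : ℕ)
local notation "aAdj" => (2 : ℕ)
local notation "aHead" => (3 : ℕ)
local notation "aNext" => (4 : ℕ)
local notation "aLab" => (5 : ℕ)
local notation "aRep" => (6 : ℕ)
local notation "aPin" => (7 : ℕ)
local notation "aDec" => (8 : ℕ)
local notation "aQue" => (9 : ℕ)
local notation "aOld" => (10 : ℕ)
local notation "aBit" => (11 : ℕ)

/-- The entry of the adjacency matrix for two vertices. -/
def adjExpr (e₁ e₂ : Expr) : Expr := read aAdj (add (mul e₁ (var xN)) e₂)

/-- Decide the vertex `xU`: it gets the label `xL`. -/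
def push : Prog :=
  write aOld (var xU) (read aLab (var xU)) ;; write aLab (var xU) (var xL) ;;
  write aDec (var xU) (const 1) ;; write aQue (var xLen) (var xU) ;;
  assign xLen (add (var xLen) (const 1))

/-- Find a cluster `xT` with a pin adjacent to `xU`, and a cluster `xS` without a pin. -/
def findSlot : Prog :=
  assign xT (const 0) ;; assign xS (const 0) ;; assign xI (const 2) ;;
  forUp xI (add (var xK) (const 2))
    (ite (read aPin (var xI))
      (ite (adjExpr (sub (read aPin (var xI)) (const 1)) (var xU)) (assign xT (var xI)) skip)
      (assign xS (var xI)))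

/-- Put the vertex `xU` into a cluster. -/
def place : Prog :=
  findSlot ;;
  ite (var xT) (assign xL (var xT))
    (ite (var xS) (assign xL (var xS) ;; write aPin (var xS) (add (var xU) (const 1)))
      (assign xL (const 1) ;; assign xFail (const 1))) ;;
  push

/-! ### Read-only data and the adjacency test -/

variable {I : Inst}

/-- The read-only part of the memory. -/
structure Static (I : Inst) (s : State) : Prop where
  n : s.var xN = I.n
  k : s.var xK = I.k
  off : s.arr aOff = I.off
  nbr : s.arr aNbr = I.nbr
  adj_le : ∀ i, s.arr aAdj i ≤ 1
  adj : ∀ a b, a < I.n → b < I.n → (s.arr aAdj (a * I.n + b) ≠ 0 ↔ I.E a b)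

theorem Static.frame {p : Prog} {s s' : State} (h : Static I s) (hf : Frame p s s')
    (h0 : xN ∉ p.modVars := by decide) (h1 : xK ∉ p.modVars := by decide)
    (h2 : aOff ∉ p.modArrs := by decide) (h3 : aNbr ∉ p.modArrs := by decide)
    (h4 : aAdj ∉ p.modArrs := by decide) : Static I s' where
  n := (hf.var _ h0).trans h.n
  k := (hf.var _ h1).trans h.k
  off := (hf.arr _ h2).trans h.off
  nbr := (hf.arr _ h3).trans h.nbr
  adj_le := by rw [hf.arr _ h4]; exact h.adj_le
  adj := by rw [hf.arr _ h4]; exact h.adj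

theorem Inst.index_lt (I : Inst) {a b : ℕ} (ha : a < I.n) (hb : b < I.n) :
    a * I.n + b < I.W := by
  have h1 := I.sq_lt
  have h2 : (a + 1) * I.n ≤ I.n * I.n := Nat.mul_le_mul_right _ ha
  rw [Nat.add_mul] at h2
  omega

/-- The adjacency test fits into the machine words. -/
theorem Static.adjExpr_fits {s : State} (h : Static I s) {e₁ e₂ : Expr} (h₁ : e₁.Fits I.W s)
    (h₂ : e₂.Fits I.W s) (h₁' : e₁.eval s < I.n) (h₂' : e₂.eval s < I.n) :
    (adjExpr e₁ e₂).Fits I.W s := by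
  have := I.index_lt h₁' h₂'
  have h3 := I.n_lt
  have h4 := h.adj_le (e₁.eval s * I.n + e₂.eval s)
  simp only [adjExpr, Expr.Fits, Expr.eval, h.n]
  refine ⟨⟨⟨h₁, by omega, by omega⟩, h₂, this⟩, by omega⟩

theorem Static.adjExpr_eval {s : State} (h : Static I s) {e₁ e₂ : Expr}
    (h₁ : e₁.eval s < I.n) (h₂ : e₂.eval s < I.n) :
    (adjExpr e₁ e₂).eval s ≠ 0 ↔ I.E (e₁.eval s) (e₂.eval s) := by
  simp only [adjExpr, Expr.eval, h.n]
  exact h.adj _ _ h₁ h₂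

structure PushPost (s s' : State) : Prop where
  old : s'.arr aOld = Function.update (s.arr aOld) (s.var xU) (s.arr aLab (s.var xU))
  lab : s'.arr aLab = Function.update (s.arr aLab) (s.var xU) (s.var xL)
  dec : s'.arr aDec = Function.update (s.arr aDec) (s.var xU) 1
  que : s'.arr aQue = Function.update (s.arr aQue) (s.var xLen) (s.var xU)
  len : s'.var xLen = s.var xLen + 1
  frame : Frame push s s'

theorem run_push {W : ℕ} {s : State} (hu : s.var xU < W) (hl : s.var xL < W)
    (hlen : s.var xLen + 1 < W) (hlab : s.arr aLab (s.var xU) < W) :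
    Run W push s 17 (PushPost s) := by
  have : Run W push s 17 fun s' =>
    s'.arr aOld = Function.update (s.arr aOld) (s.var xU) (s.arr aLab (s.var xU)) ∧
    s'.arr aLab = Function.update (s.arr aLab) (s.var xU) (s.var xL) ∧
    s'.arr aDec = Function.update (s.arr aDec) (s.var xU) 1 ∧
    s'.arr aQue = Function.update (s.arr aQue) (s.var xLen) (s.var xU) ∧
    s'.var xLen = s.var xLen + 1 := by
    simp [push, Run.write_seq_iff, Run.assign_iff, Expr.Fits, Expr.eval, Expr.cost, *]
    omega
  refine this.frame.mono le_rfl ?_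
  rintro s' ⟨⟨h1, h2, h3, h4, h5⟩, h6⟩
  exact ⟨h1, h2, h3, h4, h5, h6⟩

/-- The value `0` means that no such cluster was found; this is unambiguous because cluster labels
start at `2`. -/
structure FindSlotPost (I : Inst) (s s' : State) : Prop where
  adj : s'.var xT ≠ 0 → 2 ≤ s'.var xT ∧ s'.var xT < I.k + 2 ∧
    ∃ p, s.arr aPin (s'.var xT) = p + 1 ∧ I.E p (s.var xU)
  not_adj : s'.var xT = 0 → ∀ i p, 2 ≤ i → i < I.k + 2 → s.arr aPin i = p + 1 →
    ¬ I.E p (s.var xU)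
  empty : s'.var xS ≠ 0 → 2 ≤ s'.var xS ∧ s'.var xS < I.k + 2 ∧ s.arr aPin (s'.var xS) = 0
  full : s'.var xS = 0 → ∀ i, 2 ≤ i → i < I.k + 2 → s.arr aPin i ≠ 0

theorem run_findSlot {s : State} (h : Static I s) (hu : s.var xU < I.n)
    (hpin : ∀ i, s.arr aPin i ≤ I.n) :
    Run I.W findSlot s (25 * I.k + 20) fun s' => FindSlotPost I s s' ∧ Frame findSlot s s' := by
  have hW1 := I.n_lt
  have hW2 := I.k_lt
  refine Run.frame ?_
  unfold findSlot
  simp only [Run.assign_seq_iff, Expr.Fits, Expr.eval, Expr.cost]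
  refine ⟨by omega, by omega, by omega, by omega, by omega, by omega, ?_⟩
  set s₀ := ((s.setVar xT 0).setVar xS 0).setVar xI 2 with hs₀
  have h0 : Static I s₀ := ⟨by simp [hs₀, h.n], by simp [hs₀, h.k], by simp [hs₀, h.off],
    by simp [hs₀, h.nbr], by simpa [hs₀] using h.adj_le, by simpa [hs₀] using h.adj⟩
  have hu0 : s₀.var xU = s.var xU := by simp [hs₀]
  have hp0 : s₀.arr aPin = s.arr aPin := by simp [hs₀]
  have hi0 : s₀.var xI = 2 := by simp [hs₀]
  refine (Run.forUp (W := I.W) (b := I.k + 2) (C := 15) (fun j s' =>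
    (s'.var xT ≠ 0 → 2 ≤ s'.var xT ∧ s'.var xT < I.k + 2 ∧
      ∃ p, s.arr aPin (s'.var xT) = p + 1 ∧ I.E p (s.var xU)) ∧
    (s'.var xT = 0 → ∀ i p, 2 ≤ i → i < j → s.arr aPin i = p + 1 → ¬ I.E p (s.var xU)) ∧
    (s'.var xS ≠ 0 → 2 ≤ s'.var xS ∧ s'.var xS < I.k + 2 ∧ s.arr aPin (s'.var xS) = 0) ∧
    (s'.var xS = 0 → ∀ i, 2 ≤ i → i < j → s.arr aPin i ≠ 0))
    (by omega) (by omega) ?_ (by omega) (by decide) ?_ ?_).mono ?_ ?_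
  · refine ⟨by simp [hs₀], ?_, by simp [hs₀], ?_⟩ <;> rw [hi0]
    · intro _ i p h1 h2; omega
    · intro _ i h1 h2; omega
  · intro i s' _ hf
    have := (h0.frame hf).k
    simp only [Expr.Fits, Expr.eval, this, and_true]
    omega
  · rintro i s' ⟨h1, h2, h3, h4⟩ hi hib hx hf
    have hst := h0.frame hf
    have hu' : s'.var xU = s.var xU := (hf.var _ (by decide)).trans hu0
    have hp' : s'.arr aPin = s.arr aPin := (hf.arr _ (by decide)).trans hp0
    have hpi := hpin i
    rw [Run.ite_iff]
    simp only [Expr.eval, Expr.cost, hx, hp', Expr.Fits]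
    refine ⟨⟨by omega, by omega⟩, by omega, fun hne => ?_, fun heq => ?_⟩
    · have e1 : (sub (read aPin (var xI)) (const 1)).eval s' < I.n := by
        simp only [Expr.eval, hx, hp']; omega
      have e2 : (var xU).eval s' < I.n := by simp only [Expr.eval, hu']; exact hu
      rw [Run.ite_iff, hst.adjExpr_eval e1 e2]
      refine ⟨hst.adjExpr_fits ?_ ?_ e1 e2, ?_, fun hE => ?_, fun hE => ?_⟩
      · simp only [Expr.Fits, Expr.eval, hx, hp']; omega
      · simp only [Expr.Fits, hu']; omega
      · simp [adjExpr, Expr.cost]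
      · simp only [Run.assign_iff, Expr.Fits, Expr.eval, Expr.cost, State.setVar_var, adjExpr, hx]
        refine ⟨by omega, by omega, ?_⟩
        simp only [Expr.eval, hx, hp', hu'] at hE
        simp only [reduceIte, Nat.reduceEqDiff]
        refine ⟨fun _ => ⟨by omega, hib, s.arr aPin i - 1, by omega, hE⟩, by omega, h3,
          fun hs j hj hji => ?_⟩
        rcases Nat.lt_succ_iff_lt_or_eq.1 hji with hlt | rfl
        · exact h4 hs j hj hlt
        · exact hne
      · replace hE := fun h => (hst.adjExpr_eval e1 e2).2 h hE
        simp only [Run.skip_iff, Expr.cost, adjExpr, State.setVar_var]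
        simp only [Expr.eval, hx, hp', hu'] at hE
        simp only [reduceIte, Nat.reduceEqDiff]
        refine ⟨by omega, h1, fun ht j p hj hji hjp hEp => ?_, h3, fun hs j hj hji => ?_⟩
        · rcases Nat.lt_succ_iff_lt_or_eq.1 hji with hlt | rfl
          · exact h2 ht j p hj hlt hjp hEp
          · rw [hjp] at hE; exact hE hEp
        · rcases Nat.lt_succ_iff_lt_or_eq.1 hji with hlt | rfl
          · exact h4 hs j hj hlt
          · exact hne
    · simp only [Run.assign_iff, Expr.Fits, Expr.eval, Expr.cost, State.setVar_var, hx]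
      simp only [reduceIte, Nat.reduceEqDiff]
      refine ⟨by omega, by omega, h1, fun ht j p hj hji hjp => ?_, fun _ => ⟨by omega, hib, heq⟩,
        by omega⟩
      rcases Nat.lt_succ_iff_lt_or_eq.1 hji with hlt | rfl
      · exact h2 ht j p hj hlt hjp
      · omega
  · simp only [Expr.cost, hi0]; omega
  · rintro s' ⟨⟨h1, h2, h3, h4⟩, -, -⟩
    exact ⟨h1, h2, h3, h4⟩

/-! ### The state of the propagation -/

variable {I : Inst} {f rep bit : ℕ → ℕ} {v : ℕ}

/-- The state of the propagation: `f` is to be extended by `v` subject to the guess `bit`. -/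
structure Core (I : Inst) (f : ℕ → ℕ) (v : ℕ) (rep bit : ℕ → ℕ) (s : State) : Prop where
  trail : Trail I f v (s.arr aLab) (s.arr aDec) (s.arr aOld) (s.arr aQue) (s.var xLen)
  pins : s.var xFail = 0 → Pins I.E (I.k + 2) (s.arr aLab) (s.arr aDec) (s.arr aPin)
  pin_le : ∀ i, s.arr aPin i ≤ I.n
  fail_le : s.var xFail ≤ 1
  cons : ∀ g, Match I f v rep bit g → s.var xFail = 0 ∧ Cons g (s.arr aLab) (s.arr aDec)

/-- The new label is hidden: it is a cluster unless the placement failed, in which case it is an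
arbitrary legal value. -/
structure PlacePost (I : Inst) (f : ℕ → ℕ) (v : ℕ) (rep bit : ℕ → ℕ) (s s' : State) : Prop where
  core : Core I f v rep bit s'
  lab : ∃ l, 1 ≤ l ∧ (s'.var xFail = 0 → 1 < l) ∧
    s'.arr aLab = Function.update (s.arr aLab) (s.var xU) l
  dec : s'.arr aDec = Function.update (s.arr aDec) (s.var xU) 1
  que : s'.arr aQue = Function.update (s.arr aQue) (s.var xLen) (s.var xU)
  len : s'.var xLen = s.var xLen + 1
  pin : ∀ i, s.arr aPin i ≠ 0 → s'.arr aPin i = s.arr aPin i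

/-- By `hg` every matching solution puts the vertex into a cluster. This makes all three outcomes
sound: an adjacent pin is binding, without one an empty cluster is as good as any other, and having
neither refutes the guess. -/
theorem run_place {s : State} (hst : Static I s) (hx : Ext I f v) (hc : Core I f v rep bit s)
    (hfail : s.var xFail = 0) (hu : f (s.var xU) ≠ 0 ∨ s.var xU = v)
    (hd : s.arr aDec (s.var xU) = 0)
    (hg : ∀ g, Match I f v rep bit g → g (s.var xU) ≠ 1) (hlen : s.var xLen + 1 < I.W) :
    Run I.W place s (25 * I.k + 60) (PlacePost I f v rep bit s) := by
  have hW1 := I.n_lt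
  have hW2 := I.k_lt
  have hun : s.var xU < I.n := hx.lt_of hu
  have hp := hc.pins hfail
  unfold place
  refine Run.bind _ (run_findSlot hst hun hc.pin_le) (by omega) fun s₁ ⟨h₁, _⟩ hf₁ => ?_
  have eU : s₁.var xU = s.var xU := hf₁.var _ (by decide)
  have eLen : s₁.var xLen = s.var xLen := hf₁.var _ (by decide)
  have eFail : s₁.var xFail = 0 := (hf₁.var _ (by decide)).trans hfail
  have eLab : s₁.arr aLab = s.arr aLab := hf₁.arr _ (by decide)
  have ePin : s₁.arr aPin = s.arr aPin := hf₁.arr _ (by decide)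
  have eDec : s₁.arr aDec = s.arr aDec := hf₁.arr _ (by decide)
  have eOld : s₁.arr aOld = s.arr aOld := hf₁.arr _ (by decide)
  have eQue : s₁.arr aQue = s.arr aQue := hf₁.arr _ (by decide)
  have hlk := hc.trail.lab_le (s.var xU)
  -- The branch taken determines the label, the pins and the failure flag.
  refine Run.bind (R := fun s₂ => s₂.var xFail ≤ 1 ∧ s₂.var xU = s.var xU ∧ s₂.var xLen = s.var xLen ∧
    s₂.arr aLab = s.arr aLab ∧ s₂.arr aDec = s.arr aDec ∧ s₂.arr aOld = s.arr aOld ∧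
    s₂.arr aQue = s.arr aQue ∧ (∀ i, s.arr aPin i ≠ 0 → s₂.arr aPin i = s.arr aPin i) ∧
    (∀ i, s₂.arr aPin i ≤ I.n) ∧ 1 ≤ s₂.var xL ∧ s₂.var xL ≤ I.k + 1 ∧
    (s₂.var xFail = 0 → 1 < s₂.var xL ∧ Pins I.E (I.k + 2)
      (Function.update (s.arr aLab) (s.var xU) (s₂.var xL))
      (Function.update (s.arr aDec) (s.var xU) 1) (s₂.arr aPin)) ∧
    ∀ g, Match I f v rep bit g → s₂.var xFail = 0 ∧
      Cons g (Function.update (s.arr aLab) (s.var xU) (s₂.var xL))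
        (Function.update (s.arr aDec) (s.var xU) 1)) 20 ?_ (by omega) ?_
  · rw [Run.ite_iff]
    simp only [Expr.Fits, Expr.eval, Expr.cost]
    refine ⟨?_, by omega, fun hT => ?_, fun hT => ?_⟩
    · by_cases hT : s₁.var xT = 0
      · omega
      · have := h₁.adj hT; omega
    · obtain ⟨hT1, hT2, p, hp1, hp2⟩ := h₁.adj hT
      simp only [Run.assign_iff, Expr.Fits, Expr.eval, Expr.cost, State.setVar_var,
        State.setVar_arr, eU, eLen, eLab, eDec, eOld, eQue, ePin]
      simp only [reduceIte, Nat.reduceEqDiff, eFail]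
      refine ⟨by omega, by omega, by omega, trivial, trivial, trivial, trivial, trivial, trivial,
        fun _ _ => trivial, hc.pin_le, by omega, by omega, fun _ => ⟨by omega,
        hp.update_adj hd hp1 hp2⟩, fun g hgm => ⟨trivial, ?_⟩⟩
      exact (hc.cons g hgm).2.update_adj hgm.sol hp (hg g hgm) ((hgm.supp _).2 hu)
        ((hgm.supp p).2 (hc.trail.present p ((hp _ hT1 hT2).2 p hp1).1).1) hT1 hT2 hp1 hp2
    · rw [Run.ite_iff]
      simp only [Expr.Fits, Expr.eval, Expr.cost]
      refine ⟨?_, by omega, fun hS => ?_, fun hS => ?_⟩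
      · by_cases hS : s₁.var xS = 0
        · omega
        · have := h₁.empty hS; omega
      · obtain ⟨hS1, hS2, hp1⟩ := h₁.empty hS
        simp only [Run.assign_seq_iff, Run.write_iff, Expr.Fits, Expr.eval, Expr.cost,
          State.setVar_var, State.setVar_arr, State.setArr_var, State.setArr_arr]
        simp only [reduceIte, Nat.reduceEqDiff, eFail, eU, eLen, eLab, eDec, eOld, eQue, ePin]
        refine ⟨by omega, by omega, by omega, by omega, by omega, by omega, trivial, trivial, trivial,
          trivial, trivial, trivial, fun i hi => ?_, fun i => ?_, by omega, by omega,
          fun _ => ⟨by omega, hp.update_fresh hd hp1⟩, fun g hgm => ⟨trivial, ?_⟩⟩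
        · rw [Function.update_of_ne]; rintro rfl; exact hi hp1
        · have := hc.pin_le i
          rw [Function.update_apply]; split_ifs <;> omega
        · exact (hc.cons g hgm).2.update_fresh hc.trail hgm.sol hgm.supp hp (hg g hgm)
            ((hgm.supp _).2 hu) hd hS1 hS2 hp1 (h₁.not_adj hT)
      · simp only [Run.assign_seq_iff, Run.assign_iff, Expr.Fits, Expr.eval, Expr.cost,
          State.setVar_var, State.setVar_arr]
        simp only [reduceIte, Nat.reduceEqDiff, eFail, eU, eLen, eLab, eDec, eOld, eQue, ePin]
        refine ⟨by omega, by omega, by omega, by omega, by omega, trivial, trivial, trivial,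
          trivial, trivial, trivial, fun _ _ => trivial, hc.pin_le, by omega, by omega,
          by simp, fun g hgm => ?_⟩
        -- All clusters have pins and none is adjacent to the vertex, which contradicts any matching
        -- `g`.
        obtain ⟨i, p, hi, hi', hip, hE⟩ := (hc.cons g hgm).2.exists_adj hc.trail hgm.sol hgm.supp
          hp (hg g hgm) ((hgm.supp _).2 hu) hd (h₁.full hS)
        exact absurd hE (h₁.not_adj hT i p hi hi' hip)
  · rintro s₂ ⟨eFail, eU, eLen, eLab, eDec, eOld, eQue, hpin, hpl, hl, hl', hP, hC⟩ -
    refine (run_push (by omega) (by omega) (by omega) ?_).mono (by omega) fun s₃ h₃ => ?_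
    · rw [eLab, eU]; omega
    have fPin : s₃.arr aPin = s₂.arr aPin := h₃.frame.arr _ (by decide)
    have fFail : s₃.var xFail = s₂.var xFail := h₃.frame.var _ (by decide)
    have gLab := h₃.lab
    have gDec := h₃.dec
    have gOld := h₃.old
    have gQue := h₃.que
    have gLen := h₃.len
    rw [eU, eLab] at gLab
    rw [eU, eDec] at gDec
    rw [eU, eLab, eOld] at gOld
    rw [eU, eLen, eQue] at gQue
    rw [eLen] at gLen
    refine ⟨⟨?_, ?_, ?_, by omega, ?_⟩, ⟨_, hl, ?_, gLab⟩, gDec, gQue, gLen, ?_⟩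
    · rw [gLab, gDec, gOld, gQue, gLen]
      exact hc.trail.push hu hd hl hl'
    · rw [fFail, gLab, gDec, fPin]
      exact fun h => (hP h).2
    · rw [fPin]; exact hpl
    · rw [fFail, gLab, gDec]; exact hC
    · rw [fFail]; exact fun h => (hP h).1
    · rw [fPin]; exact hpin

/-! ### The program: repairing a conflict -/

/-- Let the vertex `xU` change sides, or fail. -/
def flip : Prog :=
  ite (read aDec (var xU)) (assign xFail (const 1))
    (ite (lt (var xLen) (var xCap))
      (ite (eq (read aLab (var xU)) (const 1)) place (assign xL (const 1) ;; push))
      (assign xFail (const 1)))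

/-- If the vertex `xU` is in conflict with the vertex `xW`, let it change sides. -/
def check : Prog :=
  ite (var xFail) skip
    (ite (eq (read aLab (var xW)) (const 1))
      (ite (eq (read aLab (var xU)) (const 1))
        (ite (adjExpr (var xW) (var xU)) flip skip) skip)
      (ite (lt (const 1) (read aLab (var xU)))
        (ite (eq (var xW) (var xU)) skip
          (ite (adjExpr (var xW) (var xU))
            (ite (eq (read aLab (var xW)) (read aLab (var xU))) skip flip)
            (ite (eq (read aLab (var xW)) (read aLab (var xU))) flip skip))) skip))

/-- The invariant of the propagation. -/
structure Busy (I : Inst) (f : ℕ → ℕ) (v : ℕ) (rep bit : ℕ → ℕ) (s : State) : Prop where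
  static : Static I s
  core : Core I f v rep bit s
  flips : Flips I.k f (s.arr aLab) (s.arr aDec) (s.var xLen) (s.var xCap) (s.var xFail)
  len_le : s.var xLen ≤ s.var xCap
  cap_le : s.var xCap ≤ 4 * I.k + 1

/-- The state `s'` arises from `s` by changing the labels of vertices appended to the queue. -/
structure Grow (s s' : State) : Prop where
  len : s.var xLen ≤ s'.var xLen
  que : ∀ j, j < s.var xLen → s'.arr aQue j = s.arr aQue j
  lab : ∀ x, s'.arr aLab x = s.arr aLab x ∨
    ∃ j, s.var xLen ≤ j ∧ j < s'.var xLen ∧ s'.arr aQue j = x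
  dec : ∀ x, s.arr aDec x ≠ 0 → s'.arr aDec x ≠ 0 ∧ s'.arr aLab x = s.arr aLab x
  pin : ∀ i, s.arr aPin i ≠ 0 → s'.arr aPin i = s.arr aPin i
  fail : s'.var xFail = 0 → s.var xFail = 0
  supp : ∀ x, s'.arr aLab x = 0 ↔ s.arr aLab x = 0

/-- The vertex `x` occurs in the queue at a position at least `q`. -/
def Pending (s : State) (q x : ℕ) : Prop := ∃ j, q ≤ j ∧ j < s.var xLen ∧ s.arr aQue j = x

theorem Grow.refl (s : State) : Grow s s :=
  ⟨le_rfl, fun _ _ => rfl, fun _ => .inl rfl, fun _ h => ⟨h, rfl⟩, fun _ _ => rfl, id,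
    fun _ => .rfl⟩

theorem Grow.of_eq {s s' : State} (h1 : s'.var xLen = s.var xLen) (h2 : s'.arr aQue = s.arr aQue)
    (h3 : s'.arr aLab = s.arr aLab) (h4 : s'.arr aDec = s.arr aDec)
    (h5 : s'.arr aPin = s.arr aPin) (h6 : s'.var xFail = 0 → s.var xFail = 0) : Grow s s' where
  len := h1.ge
  que := by simp [h2]
  lab := by simp [h3]
  dec := by simp [h3, h4]
  pin := by simp [h5]
  fail := h6
  supp := by simp [h3]

theorem Grow.pending {s s' : State} (h : Grow s s') {q x : ℕ} (hp : Pending s q x) :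
    Pending s' q x := by
  obtain ⟨j, hj, hj', he⟩ := hp
  exact ⟨j, hj, hj'.trans_le h.len, (h.que j hj').trans he⟩

theorem Grow.trans {s s' s'' : State} (h : Grow s s') (h' : Grow s' s'') : Grow s s'' where
  len := h.len.trans h'.len
  que j hj := (h'.que j (hj.trans_le h.len)).trans (h.que j hj)
  lab x := by
    rcases h'.lab x with h1 | ⟨j, hj, hj', he⟩
    · rcases h.lab x with h2 | ⟨j, hj, hj', he⟩
      · exact .inl (h1.trans h2)
      · exact .inr ⟨j, hj, hj'.trans_le h'.len, (h'.que j hj').trans he⟩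
    · exact .inr ⟨j, h.len.trans hj, hj', he⟩
  dec x hx := by
    obtain ⟨a, b⟩ := h.dec x hx
    obtain ⟨c, d⟩ := h'.dec x a
    exact ⟨c, d.trans b⟩
  pin i hi := by rw [h'.pin i (by rwa [h.pin i hi]), h.pin i hi]
  fail h0 := h.fail (h'.fail h0)
  supp x := (h'.supp x).trans (h.supp x)

/-- A satisfied condition stays satisfied unless one of the vertices becomes pending. -/
theorem Grow.ok {s s' : State} (h : Grow s s') {E : ℕ → ℕ → Prop} {q a b : ℕ}
    (hq : q ≤ s.var xLen) (hok : Ok E (s.arr aLab) a b) :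
    Ok E (s'.arr aLab) a b ∨ Pending s' q a ∨ Pending s' q b := by
  rcases h.lab a with ha | ⟨j, hj, hj', he⟩
  · rcases h.lab b with hb | ⟨j, hj, hj', he⟩
    · exact .inl (hok.congr ha hb)
    · exact .inr (.inr ⟨j, hq.trans hj, hj', he⟩)
  · exact .inr (.inl ⟨j, hq.trans hj, hj', he⟩)

structure CheckPost (I : Inst) (f : ℕ → ℕ) (v : ℕ) (rep bit : ℕ → ℕ) (s s' : State) : Prop where
  busy : Busy I f v rep bit s'
  grow : Grow s s'
  ok : s'.var xFail = 0 → s.var xW ≠ s.var xU →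
    Ok I.E (s'.arr aLab) (s.var xW) (s.var xU) ∨ Pending s' (s.var xLen) (s.var xU)

/-- Failing is correct if no solution matches the guess. -/
theorem Busy.fail {s s' : State} (h : Busy I f v rep bit s)
    (hg : ∀ g, ¬ Match I f v rep bit g) (hf : s' = s.setVar xFail 1) :
    CheckPost I f v rep bit s s' := by
  subst hf
  obtain ⟨h1, ⟨h2, h3, h4, h5', h5⟩, ⟨F, hF, hF'⟩, h7, h8⟩ := h
  refine ⟨⟨⟨by simpa using h1.n, by simpa using h1.k, by simpa using h1.off,
    by simpa using h1.nbr, by simpa using h1.adj_le, by simpa using h1.adj⟩,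
    ⟨by simpa using h2, by simp, by simpa using h4, by simp, fun g hgm => absurd hgm (hg g)⟩,
    ⟨F, by simpa using hF, fun u hu => ?_⟩, by simpa using h7, by simpa using h8⟩,
    Grow.of_eq (by simp) (by simp) (by simp) (by simp) (by simp) (by simp), by simp⟩
  obtain ⟨a, b, -⟩ := hF' u hu
  exact ⟨by simpa using a, b, by simp⟩

/-- The only label that changes is that of the vertex just appended, which was undecided; its old
and new labels are nonzero, so the support is kept. -/
theorem grow_of_push {s s' : State} {l u : ℕ} (hd : s.arr aDec u = 0)
    (hl : 1 ≤ l) (hu : s.arr aLab u ≠ 0)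
    (eLab : s'.arr aLab = Function.update (s.arr aLab) u l)
    (eDec : s'.arr aDec = Function.update (s.arr aDec) u 1)
    (eQue : s'.arr aQue = Function.update (s.arr aQue) (s.var xLen) u)
    (eLen : s'.var xLen = s.var xLen + 1)
    (hpin : ∀ i, s.arr aPin i ≠ 0 → s'.arr aPin i = s.arr aPin i)
    (hfail : s.var xFail = 0) : Grow s s' where
  len := by omega
  que j hj := by rw [eQue, Function.update_of_ne (by omega)]
  lab x := by
    by_cases hxu : x = u
    · exact .inr ⟨s.var xLen, le_rfl, by omega, by rw [eQue, hxu]; simp⟩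
    · exact .inl (by rw [eLab, Function.update_of_ne hxu])
  dec x hx' := by
    have hxu : x ≠ u := fun h => hx' (h ▸ hd)
    rw [eDec, eLab, Function.update_of_ne hxu, Function.update_of_ne hxu]
    exact ⟨hx', rfl⟩
  pin := hpin
  fail _ := hfail
  supp x := by
    rw [eLab, Function.update_apply]; split_ifs with h
    · subst h; omega
    · rfl

/-- There are two reasons to fail: `u` is already decided, although a matching `g` has no conflicts,
or the queue is full, although a matching `g` leaves room for one more flip. Otherwise the change of
side is forced. -/
theorem run_flip {s : State} (hx : Ext I f v) (h : Busy I f v rep bit s)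
    (hfail : s.var xFail = 0) (hw : s.arr aDec (s.var xW) ≠ 0) (hu : s.arr aLab (s.var xU) ≠ 0)
    (hne : s.var xW ≠ s.var xU) (hn : ¬ Ok I.E (s.arr aLab) (s.var xW) (s.var xU)) :
    Run I.W flip s (25 * I.k + 80) (CheckPost I f v rep bit s) := by
  have hW1 := I.n_lt
  have hW2 := I.k_lt
  have ht := h.core.trail
  have hl := h.len_le
  have hcl := h.cap_le
  have hun : s.var xU < I.n := hx.lt_of (ht.present_of hu)
  have hdle := ht.dec_le (s.var xU)
  have hlu := ht.lab_le (s.var xU)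
  unfold flip
  rw [Run.ite_iff]
  simp only [Expr.Fits, Expr.eval, Expr.cost]
  refine ⟨by omega, by omega, fun hd => ?_, fun hd => ?_⟩
  · rw [Run.assign_iff]
    refine ⟨by simp [Expr.Fits]; omega, by simp only [Expr.cost]; omega,
      h.fail (fun g hg => ?_) (by simp [Expr.eval])⟩
    exact hn ((h.core.cons g hg).2.ok hg.sol hw hd ((hg.supp _).2 (ht.present _ hw).1)
      ((hg.supp _).2 (ht.present _ hd).1) hne)
  have hfu : f (s.var xU) ≠ 0 := by rwa [← ht.keep _ hd]
  have hflip : ∀ g, Match I f v rep bit g → (f (s.var xU) = 1 ↔ g (s.var xU) ≠ 1) := fun g hg =>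
    flip_of_not_ok ht (h.core.pins hfail) (h.core.cons g hg).2 hg.sol hg.supp hw hd hfu hne hn
  rw [Run.ite_iff]
  simp only [Expr.Fits, Expr.eval, Expr.cost]
  refine ⟨by omega, by omega, fun hlt => ?_, fun hlt => ?_⟩
  swap
  · rw [Run.assign_iff]
    refine ⟨by simp [Expr.Fits]; omega, by simp only [Expr.cost]; omega,
      h.fail (fun g hg => ?_) (by simp [Expr.eval])⟩
    have hF := h.flips
    rw [hfail] at hF
    have := hF.lt_cap hx (h.core.cons g hg).2 hg.sol hg.supp hd hfu (hflip g hg)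
    simp [this] at hlt
  have hlt' : s.var xLen < s.var xCap := by
    by_contra hcon; simp [hcon] at hlt
  rw [Run.ite_iff]
  simp only [Expr.Fits, Expr.eval, Expr.cost]
  refine ⟨by omega, by omega, fun hB => ?_, fun hB => ?_⟩
  · have hB' : f (s.var xU) = 1 := by
      rw [← ht.keep _ hd]; by_contra hcon; simp [hcon] at hB
    refine (run_place h.static hx h.core hfail (.inl hfu) hd
      (fun g hg => (hflip g hg).1 hB') (by omega)).frame.mono (by omega) ?_
    rintro s' ⟨⟨hc, ⟨l, hl1, hl2, eLab⟩, eDec, eQue, eLen, hpin⟩, hf⟩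
    have eCap : s'.var xCap = s.var xCap := hf.var _ (by decide)
    refine ⟨⟨h.static.frame hf, hc, ?_, by omega, by omega⟩,
      grow_of_push hd hl1 hu eLab eDec eQue eLen hpin hfail,
      fun _ _ => .inr ⟨s.var xLen, le_rfl, by omega, by rw [eQue]; simp⟩⟩
    rw [eLab, eDec, eLen, eCap]
    exact h.flips.push hd hfu (fun hf0 => by have := hl2 hf0; omega) (fun _ => hfail)
  · have hB' : f (s.var xU) ≠ 1 := by
      rw [← ht.keep _ hd]; intro hcon; simp [hcon] at hB
    rw [Run.assign_seq_iff]
    simp only [Expr.Fits, Expr.eval, Expr.cost]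
    refine ⟨by omega, by omega, ?_⟩
    refine (run_push (by simp; omega) (by simp; omega) (by simp; omega)
      (by simp; omega)).mono (by omega) ?_
    rintro s' ⟨eOld, eLab, eDec, eQue, eLen, hf⟩
    simp only [State.setVar_var, State.setVar_arr, Nat.reduceEqDiff, if_false,
      if_true] at eOld eLab eDec eQue eLen
    have eCap : s'.var xCap = s.var xCap := by rw [hf.var _ (by decide)]; simp
    have eFail : s'.var xFail = s.var xFail := by rw [hf.var _ (by decide)]; simp
    have ePin : s'.arr aPin = s.arr aPin := by rw [hf.arr _ (by decide)]; simp
    have hst : Static I (s.setVar xL 1) := ⟨by simpa using h.static.n, by simpa using h.static.k,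
      by simpa using h.static.off, by simpa using h.static.nbr, by simpa using h.static.adj_le,
      by simpa using h.static.adj⟩
    have hgrow := grow_of_push hd le_rfl hu eLab eDec eQue eLen (by simp [ePin]) hfail
    refine ⟨⟨hst.frame hf, ⟨?_, ?_, ?_, by omega, ?_⟩, ?_, by omega, by omega⟩, hgrow,
      fun _ _ => .inr ⟨s.var xLen, le_rfl, by omega, by rw [eQue]; simp⟩⟩
    · rw [eOld, eLab, eDec, eQue, eLen]
      exact ht.push (.inl hfu) hd le_rfl (by omega)
    · rw [eLab, eDec, ePin]
      exact fun _ => (h.core.pins hfail).update_one hd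
    · rw [ePin]; exact h.core.pin_le
    · rw [eLab, eDec, eFail]
      exact fun g hg => ⟨hfail, (h.core.cons g hg).2.update_one
        (by by_contra hcon; exact hB' ((hflip g hg).2 hcon))⟩
    · rw [eLab, eDec, eLen, eCap]
      exact h.flips.push hd hfu (fun _ => by simp [hB']) (fun _ => hfail)

/-- The label `0` passes every test, so vertices that have not been inserted may occur in a scan of
an adjacency list of the whole graph. The program treats `w = u` separately only inside clusters, as
the edgeless case asks for adjacency. -/
theorem run_check {s : State} (hx : Ext I f v) (h : Busy I f v rep bit s)
    (hw : s.arr aDec (s.var xW) ≠ 0) (hu : s.var xU < I.n) :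
    Run I.W check s (25 * I.k + 130) (CheckPost I f v rep bit s) := by
  have hW1 := I.n_lt
  have hW2 := I.k_lt
  have ht := h.core.trail
  have hl := h.len_le
  have hcl := h.cap_le
  have hwn : s.var xW < I.n := hx.lt_of (ht.present _ hw).1
  have hwl : s.arr aLab (s.var xW) ≠ 0 := (ht.present _ hw).2
  have hlw := ht.lab_le (s.var xW)
  have hlu := ht.lab_le (s.var xU)
  have hskip : ∀ T, 1 ≤ T → (s.var xFail = 0 → s.var xW ≠ s.var xU →
      Ok I.E (s.arr aLab) (s.var xW) (s.var xU)) →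
      Run I.W skip s T (CheckPost I f v rep bit s) := fun T hT hok =>
    Run.skip_iff.2 ⟨hT, h, Grow.refl s, fun h1 h2 => .inl (hok h1 h2)⟩
  have hfits : s.var xFail < I.W := by have := h.core.fail_le; omega
  have hmat : (adjExpr (var xW) (var xU)).Fits I.W s :=
    h.static.adjExpr_fits (by simp only [Expr.Fits]; omega) (by simp only [Expr.Fits]; omega)
      (by simpa [Expr.eval] using hwn) (by simpa [Expr.eval] using hu)
  have hadj : (adjExpr (var xW) (var xU)).eval s ≠ 0 ↔ I.E (s.var xW) (s.var xU) :=
    h.static.adjExpr_eval (e₁ := var xW) (e₂ := var xU) hwn hu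
  have hadj0 : (adjExpr (var xW) (var xU)).eval s = 0 ↔ ¬ I.E (s.var xW) (s.var xU) := by
    rw [← hadj, not_not]
  have hmc : (adjExpr (var xW) (var xU)).cost = 6 := rfl
  have hflip : ∀ T, 25 * I.k + 80 ≤ T → s.var xFail = 0 → s.arr aLab (s.var xU) ≠ 0 →
      s.var xW ≠ s.var xU → ¬ Ok I.E (s.arr aLab) (s.var xW) (s.var xU) →
      Run I.W flip s T (CheckPost I f v rep bit s) := fun T hT h1 h2 h3 h4 =>
    (run_flip hx h h1 hw h2 h3 h4).mono hT fun _ => id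
  unfold check
  simp only [Run.ite_iff, Expr.Fits, Expr.cost, hadj, hadj0, hmat, hmc, lt_eval_ne_zero,
    lt_eval_eq_zero, eq_eval_ne_zero, eq_eval_eq_zero]
  simp only [Expr.eval, true_and]
  refine ⟨hfits, by omega, fun h0 => hskip _ (by omega) (fun h => absurd h h0), fun h0 =>
    ⟨by omega, by omega, fun hw1 => ⟨by omega, by omega, fun hu1 => ⟨by omega,
      fun hE => hflip _ (by omega) h0 (by omega) (I.ne hE) fun hok => hok.1 hw1 hu1 hE,
      fun hE => hskip _ (by omega) fun _ _ => ⟨fun _ _ => hE, by omega⟩⟩,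
      fun hu1 => hskip _ (by omega) fun _ _ => ⟨by omega, by omega⟩⟩,
      fun hw1 => ⟨by omega, by omega, fun hu1 => ⟨by omega, by omega,
        fun hwu => hskip _ (by omega) fun _ h => absurd hwu h, fun hwu => ⟨by omega,
          fun hE => ⟨by omega, by omega, fun he => hskip _ (by omega) fun _ _ => ⟨by omega, ?_⟩,
            fun he => hflip _ (by omega) h0 (by omega) hwu fun hok => ?_⟩,
          fun hE => ⟨by omega, by omega,
            fun he => hflip _ (by omega) h0 (by omega) hwu fun hok => ?_,
            fun he => hskip _ (by omega) fun _ _ => ⟨by omega, ?_⟩⟩⟩⟩,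
        fun hu1 => hskip _ (by omega) fun _ _ => ⟨by omega, by omega⟩⟩⟩⟩
  · exact fun _ _ => ⟨fun _ => he, fun _ => hE⟩
  · exact he ((hok.2 (by omega) hu1).1 hE)
  · exact hE ((hok.2 (by omega) hu1).2 he)
  · exact fun _ _ => ⟨fun h => absurd h hE, fun h => absurd h he⟩

/-! ### The program: checking a vertex -/

/-- Check the vertex `xW` against the neighbours of `xX`. -/
def scan : Prog :=
  assign xE (read aOff (var xX)) ;;
  forUp xE (read aOff (add (var xX) (const 1))) (assign xU (read aNbr (var xE)) ;; check)

/-- Check the next vertex of the queue against all other vertices. -/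
def process : Prog :=
  assign xW (read aQue (var xQ)) ;; assign xX (var xW) ;; scan ;;
  ite (var xFail) skip
    (ite (lt (const 1) (read aLab (var xW)))
      (assign xX (sub (read aPin (read aLab (var xW))) (const 1)) ;; scan) skip) ;;
  assign xQ (add (var xQ) (const 1))

/-! ### Invariants and scratch variables -/

theorem Static.setVar {s : State} (h : Static I s) {x y : ℕ} (h0 : x ≠ 0) (h1 : x ≠ 1) :
    Static I (s.setVar x y) where
  n := by simpa [h0.symm] using h.n
  k := by simpa [h1.symm] using h.k
  off := h.off
  nbr := h.nbr
  adj_le := h.adj_le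
  adj := h.adj

theorem Core.setVar {s : State} (h : Core I f v rep bit s) {x y : ℕ} (h0 : xLen ≠ x)
    (h1 : xFail ≠ x) : Core I f v rep bit (s.setVar x y) := by
  obtain ⟨a, b, c, d, e⟩ := h
  constructor <;> simpa only [State.setVar_var, State.setVar_arr, h0, h1, if_false]

theorem Busy.setVar {s : State} (h : Busy I f v rep bit s) {x y : ℕ} (h0 : x ≠ 0) (h1 : x ≠ 1)
    (h2 : xLen ≠ x) (h3 : xFail ≠ x) (h4 : xCap ≠ x) : Busy I f v rep bit (s.setVar x y) := by
  refine ⟨h.static.setVar h0 h1, h.core.setVar h2 h3, ?_, ?_, ?_⟩ <;>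
    simp only [State.setVar_var, State.setVar_arr, h2, h3, h4, if_false]
  exacts [h.flips, h.len_le, h.cap_le]

theorem Grow.setVar {s s' : State} (h : Grow s s') {x y : ℕ} (h2 : xLen ≠ x) (h3 : xFail ≠ x) :
    Grow s (s'.setVar x y) := by
  refine h.trans (Grow.of_eq ?_ rfl rfl rfl rfl ?_) <;> simp [h2, h3]

theorem Pending.mono {s : State} {q q' x : ℕ} (h : Pending s q x) (hq : q' ≤ q) :
    Pending s q' x := by
  obtain ⟨j, hj, h⟩ := h
  exact ⟨j, hq.trans hj, h⟩

/-- One-sided form of `Grow.ok`: the label of the decided vertex `a` is frozen, so only `b` can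
become pending. -/
theorem Grow.ok_or {s s' : State} (h : Grow s s') {E : ℕ → ℕ → Prop} {q a b : ℕ}
    (hq : q ≤ s.var xLen) (ha : s.arr aDec a ≠ 0)
    (hok : Ok E (s.arr aLab) a b ∨ Pending s q b) :
    Ok E (s'.arr aLab) a b ∨ Pending s' q b := by
  rcases hok with hok | hp
  · rcases h.lab b with hb | ⟨j, hj, hj', he⟩
    · exact .inl (hok.congr (h.dec a ha).2 hb)
    · exact .inr ⟨j, hq.trans hj, hj', he⟩
  · exact .inr (h.pending hp)

structure ScanPost (I : Inst) (f : ℕ → ℕ) (v : ℕ) (rep bit : ℕ → ℕ) (s s' : State) : Prop where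
  busy : Busy I f v rep bit s'
  grow : Grow s s'
  ok : s'.var xFail = 0 → ∀ u, I.E (s.var xX) u → s.var xW ≠ u →
    Ok I.E (s'.arr aLab) (s.var xW) u ∨ Pending s' (s.var xLen) u

/-- The insertion order enters here: the scanned vertex is `v` or was inserted before it, so its
list is no longer than `deg v`, whichever vertex is scanned. -/
theorem run_scan {s : State} (hx : Ext I f v) (h : Busy I f v rep bit s)
    (hw : s.arr aDec (s.var xW) ≠ 0) (hX : f (s.var xX) ≠ 0 ∨ s.var xX = v) :
    Run I.W scan s (I.deg v * (25 * I.k + 150) + 12) (ScanPost I f v rep bit s) := by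
  have hW1 := I.n_lt
  have hW2 := I.k_lt
  have hXn : s.var xX < I.n := hx.lt_of hX
  have hdeg := hx.deg_le_of hX
  have hol := I.off_le _ hXn
  have hmul : I.deg (s.var xX) * (25 * I.k + 150) ≤ I.deg v * (25 * I.k + 150) :=
    Nat.mul_le_mul_right _ hdeg
  have ho1 := I.off_lt (s.var xX) hXn.le
  have ho2 := I.off_lt (s.var xX + 1) hXn
  unfold scan
  rw [Run.assign_seq_iff]
  simp only [Expr.Fits, Expr.eval, Expr.cost, h.static.off]
  refine ⟨⟨by omega, ho1⟩, by omega, ?_⟩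
  set s₀ := s.setVar xE (I.off (s.var xX)) with hs₀
  have hb0 : Busy I f v rep bit s₀ := h.setVar (by decide) (by decide) (by decide) (by decide)
    (by decide)
  have hg0 : Grow s s₀ := (Grow.refl s).setVar (by decide) (by decide)
  have eE : s₀.var xE = I.off (s.var xX) := by simp [hs₀]
  have eX : s₀.var xX = s.var xX := by simp [hs₀]
  have eW : s₀.var xW = s.var xW := by simp [hs₀]
  refine (Run.forUp (W := I.W) (b := I.off (s.var xX + 1)) (C := 25 * I.k + 138) (fun e s' =>
    Busy I f v rep bit s' ∧ Grow s s' ∧ (s'.var xFail = 0 → ∀ e', I.off (s.var xX) ≤ e' → e' < e →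
      s.var xW ≠ I.nbr e' → Ok I.E (s'.arr aLab) (s.var xW) (I.nbr e') ∨
        Pending s' (s.var xLen) (I.nbr e')))
    (by omega) ho2 ?_ (by omega) (by decide) ?_ ?_).mono ?_ ?_
  · refine ⟨hb0, hg0, fun _ e' h1 h2 => ?_⟩
    omega
  · rintro e s' ⟨hb, -, -⟩ hf
    have e1 : s'.var xX = s.var xX := (hf.var _ (by decide)).trans eX
    simp only [Expr.Fits, Expr.eval, e1, hb.static.off, and_true]
    refine ⟨⟨by omega, by omega, by omega⟩, ho2⟩
  · rintro e s' ⟨hb, hg, hok⟩ he1 he2 heE hf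
    have e2 : s'.var xW = s.var xW := (hf.var _ (by decide)).trans eW
    have hE : I.E (s.var xX) (I.nbr e) := (I.mem _ hXn _).2 ⟨e, by omega, he2, rfl⟩
    have hn := I.lt' hE
    rw [Run.assign_seq_iff]
    simp only [Expr.Fits, Expr.eval, Expr.cost, hb.static.nbr, heE]
    refine ⟨⟨by omega, by omega⟩, by omega, ?_⟩
    set s₁ := s'.setVar xU (I.nbr e) with hs₁
    have hb1 : Busy I f v rep bit s₁ := hb.setVar (by decide) (by decide) (by decide) (by decide)
      (by decide)
    have hg1 : Grow s' s₁ := (Grow.refl s').setVar (by decide) (by decide)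
    have e3 : s₁.var xW = s.var xW := by simp [hs₁, e2]
    have e4 : s₁.var xU = I.nbr e := by simp [hs₁]
    have hw1 : s₁.arr aDec (s₁.var xW) ≠ 0 := by
      rw [e3]; exact ((hg.trans hg1).dec _ hw).1
    refine (run_check hx hb1 hw1 (by omega)).mono (by omega) ?_
    rintro s₂ ⟨hb2, hg2, hok2⟩
    rw [e3, e4] at hok2
    have hg02 : Grow s s₂ := hg.trans (hg1.trans hg2)
    refine ⟨hb2.setVar (by decide) (by decide) (by decide) (by decide) (by decide),
      hg02.setVar (by decide) (by decide), ?_⟩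
    intro h0 e' h1 h2 hne
    have h0' : s₂.var xFail = 0 := by simpa using h0
    have hlen : s.var xLen ≤ s₁.var xLen := (hg.trans hg1).len
    have : Ok I.E (s₂.arr aLab) (s.var xW) (I.nbr e') ∨ Pending s₂ (s.var xLen) (I.nbr e') := by
      rcases Nat.lt_succ_iff_lt_or_eq.1 h2 with hlt | rfl
      · exact (hg1.trans hg2).ok_or hg.len (hg.dec _ hw).1
          (hok ((hg1.trans hg2).fail h0') e' h1 hlt hne)
      · exact (hok2 h0' hne).imp_right fun h => h.mono hlen
    simpa [Pending] using this
  · rw [eE]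
    simp only [Expr.cost]
    have : I.off (s.var xX + 1) - I.off (s.var xX) = I.deg (s.var xX) := rfl
    rw [this, show 25 * I.k + 138 + (1 + 1 + 1 + 1) + 7 = 25 * I.k + 149 by omega]
    have : I.deg (s.var xX) * (25 * I.k + 149) ≤ I.deg (s.var xX) * (25 * I.k + 150) :=
      Nat.mul_le_mul_left _ (by omega)
    omega
  · rintro s' ⟨⟨hb, hg, hok⟩, -, -⟩
    refine ⟨hb, hg, fun h0 u hE hne => ?_⟩
    obtain ⟨e, h1, h2, rfl⟩ := (I.mem _ hXn _).1 hE
    exact hok h0 e h1 h2 hne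

structure ProcessPost (I : Inst) (f : ℕ → ℕ) (v : ℕ) (rep bit : ℕ → ℕ) (s s' : State) :
    Prop where
  busy : Busy I f v rep bit s'
  grow : Grow s s'
  pos : s'.var xQ = s.var xQ + 1
  ok : s'.var xFail = 0 → ∀ u, s.arr aQue (s.var xQ) ≠ u →
    Ok I.E (s'.arr aLab) (s.arr aQue (s.var xQ)) u ∨ Pending s' (s.var xQ + 1) u

/-- The first scan settles the neighbours of `w`. A non-neighbour can conflict with `w` only inside
the same cluster, and then it is found among the neighbours of the pin by the second scan. -/
theorem run_process {s : State} (hx : Ext I f v) (h : Busy I f v rep bit s)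
    (hq : s.var xQ < s.var xLen) :
    Run I.W process s ((I.deg v + 1) * (50 * I.k + 300)) (ProcessPost I f v rep bit s) := by
  have hW1 := I.n_lt
  have hW2 := I.k_lt
  have hl := h.len_le
  have hcl := h.cap_le
  set w := s.arr aQue (s.var xQ) with hwdef
  have hw : s.arr aDec w ≠ 0 := h.core.trail.que_dec _ hq
  have hwp := (h.core.trail.present w hw).1
  have hwn := hx.lt_of hwp
  obtain ⟨C, hC⟩ : ∃ C, I.deg v * (25 * I.k + 150) = C := ⟨_, rfl⟩
  have hT : (I.deg v + 1) * (50 * I.k + 300) = 2 * C + 50 * I.k + 300 := by rw [← hC]; ring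
  rw [hT]
  unfold process
  rw [Run.assign_seq_iff]
  simp only [Expr.Fits, Expr.eval, Expr.cost]
  refine ⟨⟨by omega, by omega⟩, by omega, ?_⟩
  rw [Run.assign_seq_iff]
  simp only [Expr.Fits, Expr.eval, Expr.cost, State.setVar_var, reduceIte, ← hwdef]
  refine ⟨by omega, by omega, ?_⟩
  set s₁ := (s.setVar xW w).setVar xX w with hs₁
  have hb1 : Busy I f v rep bit s₁ := (h.setVar (by decide) (by decide) (by decide) (by decide)
    (by decide)).setVar (by decide) (by decide) (by decide) (by decide) (by decide)
  have hg1 : Grow s s₁ := ((Grow.refl s).setVar (by decide) (by decide)).setVar (by decide)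
    (by decide)
  have e1 : s₁.var xW = w := by simp [hs₁]
  have e2 : s₁.var xX = w := by simp [hs₁]
  have e3 : s₁.var xQ = s.var xQ := by simp [hs₁]
  have e4 : s₁.var xLen = s.var xLen := by simp [hs₁]
  have hw1 : s₁.arr aDec w ≠ 0 := (hg1.dec _ hw).1
  refine Run.bind _ (run_scan hx hb1 (by rwa [e1]) (by rwa [e2])) (by omega)
    fun s₂ ⟨hb2, hg2, hok2⟩ hf2 => ?_
  rw [e1, e2, e4] at hok2
  have f1 : s₂.var xW = w := (hf2.var _ (by decide)).trans e1
  have f3 : s₂.var xQ = s.var xQ := (hf2.var _ (by decide)).trans e3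
  have hg02 := hg1.trans hg2
  have hw2 : s₂.arr aDec w ≠ 0 := (hg02.dec _ hw).1
  have hlw := hb2.core.trail.lab_le w
  have hlen02 := hg02.len
  have hfl := hb2.core.fail_le
  refine Run.bind (R := fun s₃ => Busy I f v rep bit s₃ ∧ Grow s₂ s₃ ∧ s₃.var xQ = s.var xQ ∧
    (s₃.var xFail = 0 → ∀ u, ¬ I.E w u → w ≠ u → Ok I.E (s₃.arr aLab) w u ∨
      Pending s₃ (s₂.var xLen) u)) (C + 50) ?_ (by omega) ?_
  · rw [Run.ite_iff]
    simp only [Expr.Fits, Expr.eval, Expr.cost]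
    refine ⟨by omega, by omega, fun hfail => ?_, fun hfail => ?_⟩
    · exact Run.skip_iff.2 ⟨by omega, hb2, Grow.refl _, f3, fun h => absurd h hfail⟩
    rw [Run.ite_iff, lt_eval_ne_zero, lt_eval_eq_zero]
    simp only [Expr.Fits, Expr.eval, Expr.cost, f1]
    refine ⟨by omega, by omega, fun h1 => ?_, fun h1 => ?_⟩
    swap
    · refine Run.skip_iff.2 ⟨by omega, hb2, Grow.refl _, f3, fun _ u hE _ => .inl ?_⟩
      exact ⟨fun _ _ => hE, by omega⟩
    obtain ⟨hp0, hp1⟩ := hb2.core.pins hfail (s₂.arr aLab w) h1 (by omega)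
    rcases hpi : s₂.arr aPin (s₂.arr aLab w) with _ | p
    · exact absurd rfl (hp0 hpi w)
    obtain ⟨hdp, hlp, -⟩ := hp1 p hpi
    have hpp := (hb2.core.trail.present p hdp).1
    have hpn := hx.lt_of hpp
    rw [Run.assign_seq_iff]
    simp only [Expr.Fits, Expr.eval, Expr.cost, f1, hpi]
    refine ⟨by omega, by omega, ?_⟩
    set s₃ := s₂.setVar xX (p + 1 - 1) with hs₃
    have hb3 : Busy I f v rep bit s₃ := hb2.setVar (by decide) (by decide) (by decide)
      (by decide) (by decide)
    have hg3 : Grow s₂ s₃ := (Grow.refl s₂).setVar (by decide) (by decide)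
    have g1 : s₃.var xW = w := by simp [hs₃, f1]
    have g2 : s₃.var xX = p := by simp [hs₃]
    have g3 : s₃.var xQ = s.var xQ := by simp [hs₃, f3]
    have g4 : s₃.var xLen = s₂.var xLen := by simp [hs₃]
    refine (run_scan hx hb3 (by rw [g1]; exact (hg3.dec _ hw2).1)
      (by rwa [g2])).frame.mono (by omega) ?_
    rintro s₄ ⟨⟨hb4, hg4, hok4⟩, hf4⟩
    rw [g1, g2, g4] at hok4
    have hg24 := hg3.trans hg4
    refine ⟨hb4, hg24, (hf4.var _ (by decide)).trans g3, fun h0 u hE hne => ?_⟩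
    by_cases hlu : s₄.arr aLab u = s₄.arr aLab w
    · have hlw4 : s₄.arr aLab w = s₂.arr aLab w := (hg24.dec w hw2).2
      have hp4 : s₄.arr aPin (s₂.arr aLab w) = p + 1 := by
        rw [hg24.pin _ (by omega), hpi]
      obtain ⟨-, -, hpu⟩ := (hb4.core.pins h0 (s₂.arr aLab w) h1 (by omega)).2 p hp4
      -- If `u` is the pin itself, then `w` equals it or is adjacent to it, and both are excluded;
      -- so `u` occurs in the list of the pin.
      rcases hpu u (by omega) with rfl | hup
      · rcases hpu w (by omega) with rfl | hwp
        · exact absurd rfl hne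
        · exact absurd hwp hE
      · exact hok4 h0 u (I.symm hup) hne
    · exact .inl ⟨fun _ _ => hE, fun _ _ => ⟨fun h => absurd h hE, fun h => absurd h.symm hlu⟩⟩
  · rintro s₃ ⟨hb3, hg3, g3, hok3⟩ -
    rw [Run.assign_iff]
    simp only [Expr.Fits, Expr.eval, Expr.cost, g3]
    have hg03 := hg02.trans hg3
    refine ⟨by omega, by omega, hb3.setVar (by decide) (by decide) (by decide) (by decide)
      (by decide), hg03.setVar (by decide) (by decide), by simp, ?_⟩
    intro h0 u hne
    have h0' : s₃.var xFail = 0 := by simpa using h0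
    have : Ok I.E (s₃.arr aLab) w u ∨ Pending s₃ (s.var xQ + 1) u := by
      by_cases hE : I.E w u
      · exact (hg3.ok_or hg02.len hw2 (hok2 (hg3.fail h0') u hE hne)).imp_right
          fun h => h.mono hq
      · exact (hok3 h0' u hE hne).imp_right fun h => h.mono (by omega)
    simpa [Pending] using this

/-! ### The program: propagation and clean-up -/

/-- Check the queue until it is exhausted. -/
def propagate : Prog := assign xQ (const 0) ;; loop (lt (var xQ) (var xLen)) process

/-- After a failure restore the labels; in any case clear the decisions. -/
def cleanup : Prog :=
  assign xQ (const 0) ;;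
  forUp xQ (var xLen)
    (assign xU (read aQue (var xQ)) ;;
     ite (var xFail) (write aLab (var xU) (read aOld (var xU))) skip ;;
     write aDec (var xU) (const 0))

structure PropagatePost (I : Inst) (f : ℕ → ℕ) (v : ℕ) (rep bit : ℕ → ℕ) (s s' : State) :
    Prop where
  busy : Busy I f v rep bit s'
  grow : Grow s s'
  ok : s'.var xFail = 0 → ∀ a b, s'.arr aLab a ≠ 0 → s'.arr aLab b ≠ 0 → a ≠ b →
    Ok I.E (s'.arr aLab) a b

/-- Invariant: every pair of present vertices is compatible unless one of the two is still waiting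
in the queue. At the start this holds because two undecided vertices carry their labels from the
solution `f`. -/
theorem run_propagate {s : State} (hx : Ext I f v) (h : Busy I f v rep bit s) :
    Run I.W propagate s ((4 * I.k + 1) * ((I.deg v + 1) * (50 * I.k + 300) + 4) + 6)
      (PropagatePost I f v rep bit s) := by
  have hW1 := I.n_lt
  have hW2 := I.k_lt
  obtain ⟨C, hC⟩ : ∃ C, (I.deg v + 1) * (50 * I.k + 300) = C := ⟨_, rfl⟩
  rw [hC]
  unfold propagate
  rw [Run.assign_seq_iff]
  simp only [Expr.Fits, Expr.eval, Expr.cost]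
  refine ⟨by omega, by omega, ?_⟩
  set s₀ := s.setVar xQ 0 with hs₀
  have hb0 : Busy I f v rep bit s₀ := h.setVar (by decide) (by decide) (by decide) (by decide)
    (by decide)
  have hg0 : Grow s s₀ := (Grow.refl s).setVar (by decide) (by decide)
  refine (Run.loop (W := I.W) (γ := Unit) (c₀ := ()) (fun _ s' =>
    Busy I f v rep bit s' ∧ Grow s s' ∧ s'.var xQ ≤ s'.var xLen ∧
    (s'.var xFail = 0 → ∀ a b, s'.arr aLab a ≠ 0 → s'.arr aLab b ≠ 0 → a ≠ b →
      Ok I.E (s'.arr aLab) a b ∨ Pending s' (s'.var xQ) a ∨ Pending s' (s'.var xQ) b))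
    -- The queue never grows beyond `4 * k + 1`, and `4` pays for the loop guard.
    (fun _ s' => (4 * I.k + 1 - s'.var xQ) * (C + 4)) ?_ ?_ ?_).mono ?_ ?_
  · refine ⟨hb0, hg0, by simp [hs₀], fun _ a b ha hb hab => ?_⟩
    have hpend : ∀ x, s₀.arr aDec x ≠ 0 → Pending s₀ (s₀.var xQ) x := fun x hx => by
      obtain ⟨j, hj, he⟩ := hb0.core.trail.mem_que x hx
      exact ⟨j, by simp [hs₀], hj, he⟩
    by_cases hda : s₀.arr aDec a = 0
    · by_cases hdb : s₀.arr aDec b = 0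
      · have ea := hb0.core.trail.keep a hda
        have eb := hb0.core.trail.keep b hdb
        exact .inl ((hx.sol.ok a b (by rwa [← ea]) (by rwa [← eb]) hab).congr ea eb)
      · exact .inr (.inr (hpend b hdb))
    · exact .inr (.inl (hpend a hda))
  · rintro _ s' ⟨hb, -, hq, -⟩ -
    have := hb.len_le
    have := hb.cap_le
    simp only [Expr.Fits]
    omega
  · rintro _ s' ⟨hb, hg, hq, hok⟩ - hlt
    rw [lt_eval_ne_zero] at hlt
    simp only [Expr.eval] at hlt
    have hlc := hb.len_le
    have hcc := hb.cap_le
    refine ⟨C, (run_process hx hb hlt).mono hC.le ?_⟩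
    rintro s'' ⟨hb2, hg2, hpos, hok2⟩
    have hl2 := hg2.len
    refine ⟨(), ⟨hb2, hg.trans hg2, by omega, fun h0 a b ha hb' hab => ?_⟩, ?_⟩
    · set w := s'.arr aQue (s'.var xQ) with hw
      -- Advancing the queue drops just one position, that of `w`, so any other pending vertex stays
      -- pending.
      have hpend : ∀ x, x ≠ w → Pending s' (s'.var xQ) x → Pending s'' (s''.var xQ) x := by
        rintro x hxw ⟨j, hj, hj', he⟩
        have : j ≠ s'.var xQ := by rintro rfl; exact hxw he.symm
        rw [hpos]
        exact hg2.pending ⟨j, by omega, hj', he⟩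
      rw [← hpos] at hok2
      by_cases haw : a = w
      · subst haw
        exact (hok2 h0 b hab).imp_right .inr
      by_cases hbw : b = w
      · subst hbw
        exact (hok2 h0 a (Ne.symm hab)).imp I.ok_symm .inl
      rcases hok (hg2.fail h0) a b (by rwa [Ne, ← hg2.supp a]) (by rwa [Ne, ← hg2.supp b]) hab
        with h | h | h
      · exact hg2.ok (by omega) h
      · exact .inr (.inl (hpend a haw h))
      · exact .inr (.inr (hpend b hbw h))
    · rw [hpos, show 4 * I.k + 1 - s'.var xQ = (4 * I.k + 1 - (s'.var xQ + 1)) + 1 by omega,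
        Nat.add_mul]
      simp only [Expr.cost]
      omega
  · simp only [hs₀, Expr.cost, State.setVar_var, reduceIte, Nat.sub_zero]
    omega
  · rintro s' ⟨_, ⟨hb, hg, hq, hok⟩, hlt, -⟩
    rw [lt_eval_eq_zero] at hlt
    simp only [Expr.eval] at hlt
    refine ⟨hb, hg, fun h0 a b ha hb' hab => ?_⟩
    have hpend : ∀ x, ¬ Pending s' (s'.var xQ) x := by
      rintro x ⟨j, hj, hj', -⟩
      omega
    rcases hok h0 a b ha hb' hab with h | h | h
    exacts [h, absurd h (hpend a), absurd h (hpend b)]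

structure CleanupPost (f : ℕ → ℕ) (s s' : State) : Prop where
  dec : ∀ u, s'.arr aDec u = 0
  keep : s.var xFail = 0 → s'.arr aLab = s.arr aLab
  undo : s.var xFail ≠ 0 → s'.arr aLab = f

/-- Decided vertices all occur in the queue and undecided ones still carry their label from `f`.
Running through the queue therefore suffices, in time `O(k)` instead of `O(n)`. -/
theorem run_cleanup {s : State} (hx : Ext I f v) (h : Busy I f v rep bit s) :
    Run I.W cleanup s ((4 * I.k + 1) * 25 + 10) (CleanupPost f s) := by
  have hW1 := I.n_lt
  have hW2 := I.k_lt
  have hlc := h.len_le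
  have hcc := h.cap_le
  have ht := h.core.trail
  have hfl := h.core.fail_le
  unfold cleanup
  rw [Run.assign_seq_iff]
  simp only [Expr.Fits, Expr.eval, Expr.cost]
  refine ⟨by omega, by omega, ?_⟩
  set s₀ := s.setVar xQ 0 with hs₀
  have eLen : s₀.var xLen = s.var xLen := by simp [hs₀]
  have eFail : s₀.var xFail = s.var xFail := by simp [hs₀]
  have eQ : s₀.var xQ = 0 := by simp [hs₀]
  have eQue : s₀.arr aQue = s.arr aQue := by simp [hs₀]
  have eOld : s₀.arr aOld = s.arr aOld := by simp [hs₀]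
  refine (Run.forUp (W := I.W) (b := s.var xLen) (C := 15) (fun q s' =>
    (∀ u, s'.arr aDec u = 0 ∨ s.arr aDec u ≠ 0 ∧ ∀ j, j < q → s.arr aQue j ≠ u) ∧
    (s.var xFail = 0 → s'.arr aLab = s.arr aLab) ∧
    (s.var xFail ≠ 0 → ∀ u, s'.arr aLab u = f u ∨
      s.arr aDec u ≠ 0 ∧ ∀ j, j < q → s.arr aQue j ≠ u))
    (by omega) (by omega) ?_ (by omega) (by decide) ?_ ?_).mono ?_ ?_
  · rw [eQ]
    refine ⟨fun u => ?_, fun _ => by simp [hs₀], fun _ u => ?_⟩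
    · by_cases hd : s.arr aDec u = 0
      · exact .inl (by simpa [hs₀] using hd)
      · exact .inr ⟨hd, by omega⟩
    · by_cases hd : s.arr aDec u = 0
      · exact .inl (by simpa [hs₀] using ht.keep u hd)
      · exact .inr ⟨hd, by omega⟩
  · intro q s' _ hf
    have : s'.var xLen = s.var xLen := (hf.var _ (by decide)).trans eLen
    simp only [Expr.Fits, Expr.eval, this, and_true]
    omega
  · rintro q s' ⟨h1, h2, h3⟩ - hqb hq hf
    have gFail : s'.var xFail = s.var xFail := (hf.var _ (by decide)).trans eFail
    have gQue : s'.arr aQue = s.arr aQue := (hf.arr _ (by decide)).trans eQue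
    have gOld : s'.arr aOld = s.arr aOld := (hf.arr _ (by decide)).trans eOld
    obtain ⟨w, hw⟩ : ∃ w, s.arr aQue q = w := ⟨_, rfl⟩
    have hdw : s.arr aDec w ≠ 0 := hw ▸ ht.que_dec q hqb
    have hwn := hx.lt_of (ht.present w hdw).1
    have how := ht.saved w hdw
    have hfk := hx.sol.le w
    have hstep : ∀ u, u ≠ w → (∀ j, j < q → s.arr aQue j ≠ u) → ∀ j, j < q + 1 →
        s.arr aQue j ≠ u := by
      intro u huw hu j hj
      rcases Nat.lt_succ_iff_lt_or_eq.1 hj with hlt | rfl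
      · exact hu j hlt
      · rw [hw]; exact huw.symm
    rw [Run.assign_seq_iff]
    simp only [Expr.Fits, Expr.eval, Expr.cost, gQue, hq, hw]
    refine ⟨by omega, by omega, ?_⟩
    refine Run.bind (R := fun s'' => s''.var xU = w ∧ s''.arr aDec = s'.arr aDec ∧
      (s.var xFail = 0 → s''.arr aLab = s.arr aLab) ∧
      (s.var xFail ≠ 0 → ∀ u, s''.arr aLab u = f u ∨
        s.arr aDec u ≠ 0 ∧ ∀ j, j < q + 1 → s.arr aQue j ≠ u)) 8 ?_ (by omega) ?_
    · rw [Run.ite_iff]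
      simp only [Expr.Fits, Expr.eval, Expr.cost, Run.skip_iff, Run.write_iff, State.setVar_var,
        State.setVar_arr, State.setArr_var, State.setArr_arr]
      simp only [reduceIte, Nat.reduceEqDiff, gFail, gOld, how]
      refine ⟨by omega, by omega, fun hfail => ⟨by omega, by omega, by omega, trivial, trivial,
        fun h => absurd h hfail, fun _ u => ?_⟩, fun hfail => ⟨by omega, trivial, trivial, h2,
        fun h => absurd hfail h⟩⟩
      by_cases huw : u = w
      · subst huw; simp
      · rw [Function.update_of_ne huw]
        exact (h3 hfail u).imp_right fun h => ⟨h.1, hstep u huw h.2⟩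
    · rintro s'' ⟨k1, k2, k3, k4⟩ -
      simp only [Run.write_iff, Expr.Fits, Expr.eval, Expr.cost, State.setVar_arr,
        State.setArr_arr, k1, k2]
      simp only [reduceIte, Nat.reduceEqDiff]
      refine ⟨by omega, by omega, by omega, fun u => ?_, k3, k4⟩
      by_cases huw : u = w
      · subst huw; simp
      · rw [Function.update_of_ne huw]
        exact (h1 u).imp_right fun h => ⟨h.1, hstep u huw h.2⟩
  · rw [eQ]; simp only [Expr.cost]; omega
  · rintro s' ⟨⟨h1, h2, h3⟩, -, -⟩
    have hno : ∀ u, ¬ (s.arr aDec u ≠ 0 ∧ ∀ j, j < s.var xLen → s.arr aQue j ≠ u) := by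
      rintro u ⟨hd, hj⟩
      obtain ⟨j, hj', he⟩ := ht.mem_que u hd
      exact hj j hj' he
    exact ⟨fun u => (h1 u).resolve_right (hno u), h2,
      fun hf => funext fun u => (h3 hf u).resolve_right (hno u)⟩

/-! ### The program: the guess on the clusters -/

/-- Decide the representative of the cluster `xJ` according to the guess. If it leaves the cluster,
then decide that another vertex, if there is one, stays. -/
def anchor : Prog :=
  write aPin (var xJ) (read aRep (var xJ)) ;;
  ite (read aRep (var xJ))
    (assign xU (sub (read aRep (var xJ)) (const 1)) ;;
     ite (read aBit (var xJ)) (assign xL (var xJ) ;; push)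
      (assign xL (const 1) ;; push ;; write aPin (var xJ) (const 0) ;;
       assign xE (read aOff (var xU)) ;;
       forUp xE (read aOff (add (var xU) (const 1)))
        (ite (eq (read aLab (read aNbr (var xE))) (var xJ))
          (write aPin (var xJ) (add (read aNbr (var xE)) (const 1))) skip) ;;
       ite (read aPin (var xJ))
        (assign xU (sub (read aPin (var xJ)) (const 1)) ;; assign xL (var xJ) ;; push) skip))
    skip

/-- The vertices `rep i - 1` represent the nonempty clusters. -/
structure Rep (I : Inst) (f rep : ℕ → ℕ) : Prop where
  le : ∀ i, rep i ≤ I.n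
  empty : ∀ i, 2 ≤ i → i < I.k + 2 → rep i = 0 → ∀ u, f u ≠ i
  mem : ∀ i r, 2 ≤ i → i < I.k + 2 → rep i = r + 1 → f r = i

/-- The guess has been processed for the clusters below `j`. -/
structure Partial (I : Inst) (f : ℕ → ℕ) (v : ℕ) (rep bit : ℕ → ℕ) (j : ℕ)
    (lab dec old que pin : ℕ → ℕ) (len : ℕ) : Prop where
  trail : Trail I f v lab dec old que len
  pins : Pins I.E j lab dec pin
  fresh : ∀ u, dec u ≠ 0 → 1 < f u ∧ f u < j ∧ (lab u = f u ∨ lab u = 1)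
  cons : ∀ g, Match I f v rep bit g → ∀ w, dec w ≠ 0 → (lab w = 1 ↔ g w = 1)
  pin_le : ∀ i, pin i ≤ I.n
  len_le : len + 4 ≤ 2 * j

/-- Reduces one step of the anchoring to the vertices of the cluster `j` of `f`: all earlier
decisions lie in smaller clusters and are untouched. That the pin is adjacent to the rest of its
cluster is automatic, the cluster being a clique. -/
theorem Partial.step {j len len' : ℕ} {lab dec old que pin lab' dec' old' que' pin' : ℕ → ℕ}
    (hx : Ext I f v) (h : Partial I f v rep bit j lab dec old que pin len) (hj2 : 2 ≤ j)
    (ht : Trail I f v lab' dec' old' que' len')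
    (hne : ∀ u, f u ≠ j → lab' u = lab u ∧ dec' u = dec u)
    (hj : ∀ u, f u = j → lab' u = j ∨ lab' u = 1)
    (hpin : ∀ i, i ≠ j → pin' i = pin i) (hpinj : pin' j = 0 → ∀ u, f u = j → lab' u ≠ j)
    (hpinj' : ∀ p, pin' j = p + 1 → f p = j ∧ dec' p ≠ 0 ∧ lab' p = j)
    (hcons : ∀ g, Match I f v rep bit g → ∀ u, f u = j → dec' u ≠ 0 → (lab' u = 1 ↔ g u = 1))
    (hlen : len' ≤ len + 2) :
    Partial I f v rep bit (j + 1) lab' dec' old' que' pin' len' := by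
  have hlab : ∀ u, lab u = f u ∨ lab u = 1 := fun u => by
    by_cases hd : dec u = 0
    · exact .inl (h.trail.keep u hd)
    · exact (h.fresh u hd).2.2
  have hlabj : ∀ u, lab' u = j → f u = j := fun u hu => by
    by_contra hne'
    have := (hne u hne').1
    have := hlab u
    omega
  refine ⟨ht, fun i hi hij => ?_, fun u hu => ?_, fun g hg w hw => ?_, fun i => ?_, ?_⟩
  · rcases Nat.lt_succ_iff_lt_or_eq.1 hij with hlt | rfl
    · obtain ⟨h0, h1⟩ := h.pins i hi hlt
      rw [hpin i (by omega)]
      have hlabi : ∀ u, lab' u = i → lab u = i := fun u hu => by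
        by_cases hfu : f u = j
        · have := hj u hfu; omega
        · rw [← (hne u hfu).1, hu]
      refine ⟨fun hp u hu => h0 hp u (hlabi u hu), fun p hp => ?_⟩
      obtain ⟨a, b, c⟩ := h1 p hp
      have hfp := h.fresh p a
      obtain ⟨e1, e2⟩ := hne p (by omega)
      exact ⟨by rwa [e2], by rwa [e1], fun u hu => c u (hlabi u hu)⟩
    · refine ⟨fun hp u hu => hpinj hp u (hlabj u hu) hu, fun p hp => ?_⟩
      obtain ⟨a, b, c⟩ := hpinj' p hp
      refine ⟨b, c, fun u hu => ?_⟩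
      have hfu := hlabj u hu
      by_cases hup : u = p
      · exact .inl hup
      · exact .inr (((hx.sol.ok u p (by omega) (by omega) hup).2 (by omega) (by omega)).2
          (by omega))
  · by_cases hfu : f u = j
    · have := hj u hfu; omega
    · obtain ⟨e1, e2⟩ := hne u hfu
      rw [e2] at hu
      have := h.fresh u hu
      omega
  · by_cases hfw : f w = j
    · exact hcons g hg w hfw hw
    · obtain ⟨e1, e2⟩ := hne w hfw
      rw [e1]
      exact h.cons g hg w (by rwa [← e2])
  · by_cases hij : i = j
    · subst hij
      rcases hp : pin' i with _ | p
      · omega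
      · have := hx.lt p (by have := (hpinj' p hp).1; omega)
        omega
    · rw [hpin i hij]; exact h.pin_le i
  · have := h.len_le; omega

theorem run_anchor {s : State} {j : ℕ} (hst : Static I s) (hx : Ext I f v) (hr : Rep I f rep)
    (hrep : s.arr aRep = rep) (hbit : s.arr aBit = bit) (hbit1 : ∀ i, bit i ≤ 1)
    (hJ : s.var xJ = j) (hj2 : 2 ≤ j) (hjk : j < I.k + 2)
    (h : Partial I f v rep bit j (s.arr aLab) (s.arr aDec) (s.arr aOld) (s.arr aQue)
      (s.arr aPin) (s.var xLen)) :
    Run I.W anchor s (I.deg v * 23 + 100) fun s' =>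
      Partial I f v rep bit (j + 1) (s'.arr aLab) (s'.arr aDec) (s'.arr aOld) (s'.arr aQue)
        (s'.arr aPin) (s'.var xLen) := by
  have hW1 := I.n_lt
  have hW2 := I.k_lt
  have hrj := hr.le j
  have hbj := hbit1 j
  have hll := h.len_le
  have hlab : ∀ u, f u = j → s.arr aDec u = 0 ∧ s.arr aLab u = j := fun u hu => by
    have hd : s.arr aDec u = 0 := by
      by_contra hd
      have := h.fresh u hd
      omega
    exact ⟨hd, by rw [h.trail.keep u hd, hu]⟩
  have hlab' : ∀ u, s.arr aLab u = j → f u = j := fun u hu => by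
    by_cases hd : s.arr aDec u = 0
    · rw [← h.trail.keep u hd, hu]
    · have := h.fresh u hd
      omega
  unfold anchor
  rw [Run.write_seq_iff]
  simp only [Expr.Fits, Expr.eval, Expr.cost, hJ, hrep]
  refine ⟨by omega, by omega, by omega, ?_⟩
  rw [Run.ite_iff]
  simp only [Expr.Fits, Expr.eval, Expr.cost, State.setArr_var, State.setArr_arr, hJ]
  simp only [reduceIte, Nat.reduceEqDiff, hrep]
  refine ⟨by omega, by omega, fun hne => ?_, fun h0 => ?_⟩
  swap
  · rw [Run.skip_iff]
    simp only [State.setArr_var, State.setArr_arr]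
    simp only [reduceIte, Nat.reduceEqDiff]
    refine ⟨by omega, h.step hx hj2 h.trail (fun u _ => ⟨rfl, rfl⟩) (fun u hu => .inl (hlab u hu).2)
      (fun i hi => by rw [Function.update_of_ne hi])
      (fun _ u hu => absurd hu (hr.empty j hj2 hjk h0 u)) (fun p hp => ?_)
      (fun g hg u hu hd => absurd (hlab u hu).1 hd) (by omega)⟩
    simp [h0] at hp
  obtain ⟨r, hrr⟩ : ∃ r, rep j = r + 1 := ⟨rep j - 1, by omega⟩
  have hfr : f r = j := hr.mem j r hj2 hjk hrr
  have hrn : r < I.n := hx.lt r (by omega)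
  obtain ⟨hdr, hlr⟩ := hlab r hfr
  have hrp : f r ≠ 0 ∨ r = v := .inl (by omega)
  rw [Run.assign_seq_iff]
  simp only [Expr.Fits, Expr.eval, Expr.cost, State.setArr_var, State.setArr_arr, hJ]
  simp only [reduceIte, Nat.reduceEqDiff, hrep, hrr, Nat.add_sub_cancel]
  refine ⟨by omega, by omega, ?_⟩
  rw [Run.ite_iff]
  simp only [Expr.Fits, Expr.eval, Expr.cost, State.setArr_var, State.setArr_arr,
    State.setVar_var, State.setVar_arr]
  simp only [reduceIte, Nat.reduceEqDiff, hbit, hJ]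
  refine ⟨by omega, by omega, fun hb => ?_, fun hb => ?_⟩
  · rw [Run.assign_seq_iff]
    simp only [Expr.Fits, Expr.eval, Expr.cost, State.setArr_var, State.setVar_var]
    simp only [reduceIte, Nat.reduceEqDiff, hJ]
    refine ⟨by omega, by omega, ?_⟩
    refine (run_push (by simp; omega) (by simp; omega) (by simp; omega) (by simp; omega)).mono
      (by omega) ?_
    rintro s' ⟨eOld, eLab, eDec, eQue, eLen, hf⟩
    have ePin := hf.arr aPin (by decide)
    simp only [State.setVar_var, State.setVar_arr, State.setArr_var, State.setArr_arr]
      at eOld eLab eDec eQue eLen ePin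
    simp only [reduceIte, Nat.reduceEqDiff] at eOld eLab eDec eQue eLen ePin
    rw [eOld, eLab, eDec, eQue, eLen, ePin]
    refine h.step hx hj2 (h.trail.push hrp hdr (by omega) (by omega))
      (fun u hu => ?_) (fun u hu => ?_) (fun i hi => by rw [Function.update_of_ne hi])
      (fun h0 => by simp at h0) (fun p hp => ?_) (fun g hg u hu hd => ?_) (by omega)
    · have : u ≠ r := by rintro rfl; exact hu hfr
      rw [Function.update_of_ne this, Function.update_of_ne this]
      exact ⟨rfl, rfl⟩
    · rw [Function.update_apply]; split_ifs
      · exact .inl rfl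
      · exact .inl (hlab u hu).2
    · obtain rfl : r = p := by simpa using hp
      simp [hfr]
    · have : u = r := by
        by_contra hur
        rw [Function.update_of_ne hur] at hd
        exact hd (hlab u hu).1
      subst this
      have := (hg.rep j u hj2 hjk hrr).1 hb
      rw [Function.update_self]
      omega
  · rw [Run.assign_seq_iff]
    simp only [Expr.Fits, Expr.eval, Expr.cost]
    refine ⟨by omega, by omega, ?_⟩
    refine Run.bind _ (run_push (by simp; omega) (by simp; omega) (by simp; omega)
      (by simp; omega)) (by omega) ?_
    rintro s₁ ⟨eOld, eLab, eDec, eQue, eLen, -⟩ hf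
    have eU := hf.var xU (by decide)
    have eJ := hf.var xJ (by decide)
    have ePin := hf.arr aPin (by decide)
    have eOff := hf.arr aOff (by decide)
    have eNbr := hf.arr aNbr (by decide)
    simp only [State.setVar_var, State.setVar_arr, State.setArr_var, State.setArr_arr]
      at eOld eLab eDec eQue eLen ePin eU eJ eOff eNbr
    simp only [reduceIte, Nat.reduceEqDiff, hJ, hst.off, hst.nbr]
      at eOld eLab eDec eQue eLen ePin eU eJ eOff eNbr
    have ht1 := h.trail.push hrp hdr le_rfl (show 1 ≤ I.k + 1 by omega)
    rw [← eOld, ← eLab, ← eDec, ← eQue, ← eLen] at ht1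
    have hlab1 : ∀ u, u ≠ r → s₁.arr aLab u = s.arr aLab u ∧ s₁.arr aDec u = s.arr aDec u :=
      fun u hu => by
        rw [eLab, eDec, Function.update_of_ne hu, Function.update_of_ne hu]
        exact ⟨rfl, rfl⟩
    have hlab1r : s₁.arr aLab r = 1 ∧ s₁.arr aDec r = 1 := by rw [eLab, eDec]; simp
    have hdeg := hx.deg_le_of hrp
    have hol := I.off_le r hrn
    have ho1 := I.off_lt r hrn.le
    have ho2 := I.off_lt (r + 1) hrn
    -- The zero bit says that the representative goes to the edgeless part in every matching
    -- solution.
    have hconsr : ∀ g, Match I f v rep bit g → g r = 1 := fun g hg => by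
      by_contra hgr
      exact (hg.rep j r hj2 hjk hrr).2 hgr hb
    rw [Run.write_seq_iff]
    simp only [Expr.Fits, Expr.eval, Expr.cost, eJ]
    refine ⟨by omega, by omega, by omega, ?_⟩
    rw [Run.assign_seq_iff]
    simp only [Expr.Fits, Expr.eval, Expr.cost, State.setArr_var, State.setArr_arr, eU]
    simp only [reduceIte, Nat.reduceEqDiff, eOff]
    refine ⟨by omega, by omega, ?_⟩
    set s₂ := (s₁.setArr aPin j 0).setVar xE (I.off r) with hs₂
    have gE : s₂.var xE = I.off r := by simp [hs₂]
    have gJ : s₂.var xJ = j := by simp [hs₂, eJ]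
    have gU : s₂.var xU = r := by simp [hs₂, eU]
    have gLen : s₂.var xLen = s₁.var xLen := by simp [hs₂]
    have gLab : s₂.arr aLab = s₁.arr aLab := by simp [hs₂]
    have gDec : s₂.arr aDec = s₁.arr aDec := by simp [hs₂]
    have gOld : s₂.arr aOld = s₁.arr aOld := by simp [hs₂]
    have gQue : s₂.arr aQue = s₁.arr aQue := by simp [hs₂]
    have gOff : s₂.arr aOff = I.off := by simp [hs₂, eOff]
    have gNbr : s₂.arr aNbr = I.nbr := by simp [hs₂, eNbr]
    have gPin : ∀ i, i ≠ j → s₂.arr aPin i = s.arr aPin i := fun i hi => by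
      simp [hs₂, ePin, Function.update_of_ne hi]
    have gPinj : s₂.arr aPin j = 0 := by simp [hs₂]
    refine Run.bind _ (Run.forUp (W := I.W) (b := I.off (r + 1)) (C := 12) (fun e s' =>
      (∀ i, i ≠ j → s'.arr aPin i = s.arr aPin i) ∧
      (s'.arr aPin j = 0 → ∀ e', I.off r ≤ e' → e' < e → s₁.arr aLab (I.nbr e') ≠ j) ∧
      (∀ p, s'.arr aPin j = p + 1 → I.E r p ∧ s₁.arr aLab p = j))
      (by omega) ho2 ?_ (by omega) (by decide) ?_ ?_) ?_ ?_
    · refine ⟨gPin, fun _ e' h1 h2 => by omega, fun p hp => ?_⟩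
      omega
    · intro e s' _ hf
      have k1 : s'.var xU = r := (hf.var _ (by decide)).trans gU
      have k2 : s'.arr aOff = I.off := (hf.arr _ (by decide)).trans gOff
      simp only [Expr.Fits, Expr.eval, k1, k2, and_true]
      refine ⟨⟨by omega, by omega, by omega⟩, ho2⟩
    · rintro e s' ⟨h1, h2, h3⟩ he he' heE hf
      have k1 : s'.var xJ = j := (hf.var _ (by decide)).trans gJ
      have k2 : s'.arr aNbr = I.nbr := (hf.arr _ (by decide)).trans gNbr
      have k3 : s'.arr aLab = s₁.arr aLab := ((hf.arr _ (by decide)).trans gLab)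
      have hE : I.E r (I.nbr e) := (I.mem r hrn _).2 ⟨e, by omega, he', rfl⟩
      have hn := I.lt' hE
      have hle := ht1.lab_le (I.nbr e)
      rw [Run.ite_iff, eq_eval_ne_zero, eq_eval_eq_zero]
      simp only [Expr.Fits, Expr.eval, Expr.cost, k1, k2, k3, heE, Run.write_iff, Run.skip_iff,
        State.setVar_arr, State.setArr_arr]
      simp only [reduceIte]
      refine ⟨by omega, by omega, fun hyes => ⟨by omega, by omega, by omega, fun i hi => ?_,
        fun h0 => ?_, fun p hp => ?_⟩, fun hno => ⟨by omega, h1, fun h0 e' he1 he2 => ?_, h3⟩⟩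
      · rw [Function.update_of_ne hi]; exact h1 i hi
      · simp at h0
      · obtain rfl : I.nbr e = p := by simpa using hp
        exact ⟨hE, hyes⟩
      · rcases Nat.lt_succ_iff_lt_or_eq.1 he2 with hlt | rfl
        · exact h2 h0 e' he1 hlt
        · exact hno
    · rw [gE]
      simp only [Expr.cost]
      have : I.off (r + 1) - I.off r = I.deg r := rfl
      omega
    · rintro s₃ ⟨⟨h1, h2, h3⟩, -, hf3⟩ -
      have kJ : s₃.var xJ = j := (hf3.var _ (by decide)).trans gJ
      have kLen : s₃.var xLen = s₁.var xLen := (hf3.var _ (by decide)).trans gLen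
      have kLab : s₃.arr aLab = s₁.arr aLab := (hf3.arr _ (by decide)).trans gLab
      have kDec : s₃.arr aDec = s₁.arr aDec := (hf3.arr _ (by decide)).trans gDec
      have kOld : s₃.arr aOld = s₁.arr aOld := (hf3.arr _ (by decide)).trans gOld
      have kQue : s₃.arr aQue = s₁.arr aQue := (hf3.arr _ (by decide)).trans gQue
      have hdegr : I.off (r + 1) - I.off r = I.deg r := rfl
      have hpn : s₃.arr aPin j ≤ I.n := by
        rcases hp : s₃.arr aPin j with _ | p
        · omega
        · have := I.lt' (h3 p hp).1; omega
      rw [Run.ite_iff]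
      simp only [Expr.Fits, Expr.eval, Expr.cost, kJ, gE]
      refine ⟨by omega, by omega, fun hp => ?_, fun hp => ?_⟩
      · obtain ⟨p, hpp⟩ : ∃ p, s₃.arr aPin j = p + 1 := ⟨s₃.arr aPin j - 1, by omega⟩
        obtain ⟨hE, hlp⟩ := h3 p hpp
        have hpr : p ≠ r := (I.ne hE).symm
        -- Only `r` has been relabelled so far, so `p` is an untouched, undecided member of the old
        -- cluster.
        have hfp : f p = j := hlab' p (by rw [← (hlab1 p hpr).1, hlp])
        have hdp : s₁.arr aDec p = 0 := by rw [(hlab1 p hpr).2]; exact (hlab p hfp).1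
        rw [Run.assign_seq_iff]
        simp only [Expr.Fits, Expr.eval, Expr.cost, kJ, hpp, Nat.add_sub_cancel]
        refine ⟨by omega, by omega, ?_⟩
        rw [Run.assign_seq_iff]
        simp only [Expr.Fits, Expr.eval, Expr.cost, State.setVar_var]
        simp only [reduceIte, Nat.reduceEqDiff, kJ]
        refine ⟨by omega, by omega, ?_⟩
        refine (run_push (by simp; omega) (by simp; omega) (by simp; omega)
          (by simp [kLab]; omega)).mono (by omega) ?_
        rintro s₄ ⟨lOld, lLab, lDec, lQue, lLen, hf⟩
        have lPin := hf.arr aPin (by decide)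
        simp only [State.setVar_var, State.setVar_arr] at lOld lLab lDec lQue lLen lPin
        simp only [reduceIte, Nat.reduceEqDiff, kOld, kLab, kDec, kQue, kLen]
          at lOld lLab lDec lQue lLen
        rw [lOld, lLab, lDec, lQue, lLen, lPin]
        refine h.step hx hj2 (ht1.push (.inl (by omega)) hdp (by omega) (by omega))
          (fun u hu => ?_) (fun u hu => ?_) h1 (fun h0 => by omega) (fun q hq => ?_)
          (fun g hg u hu hd => ?_) (by omega)
        · have hup : u ≠ p := by rintro rfl; exact hu hfp
          have hur : u ≠ r := by rintro rfl; exact hu hfr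
          rw [Function.update_of_ne hup, Function.update_of_ne hup]
          exact hlab1 u hur
        · rw [Function.update_apply]; split_ifs
          · exact .inl rfl
          · by_cases hur : u = r
            · subst hur; exact .inr hlab1r.1
            · rw [(hlab1 u hur).1]; exact .inl (hlab u hu).2
        · obtain rfl : p = q := by omega
          simp [hfp]
        · by_cases hup : u = p
          · subst hup
            have hgr := hconsr g hg
            -- The neighbour `r` is in the edgeless part of `g`, so this vertex cannot be; its
            -- decision to stay needs no further guess.
            have := (hg.sol.ok r u (by omega) ((hg.supp u).2 (.inl (by omega))) (Ne.symm hpr)).1 hgr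
            rw [Function.update_self]
            constructor
            · omega
            · intro hgu; exact absurd hE (this hgu)
          · rw [Function.update_of_ne hup] at hd ⊢
            by_cases hur : u = r
            · subst hur; simp [hlab1r.1, hconsr g hg]
            · rw [(hlab1 u hur).2] at hd
              exact absurd (hlab u hu).1 hd
      · rw [Run.skip_iff, kLab, kDec, kOld, kQue, kLen]
        refine ⟨by omega, h.step hx hj2 ht1 (fun u hu => ?_) (fun u hu => ?_) h1
          (fun _ u hu => ?_) (fun q hq => by omega) (fun g hg u hu hd => ?_) (by omega)⟩
        · have hur : u ≠ r := by rintro rfl; exact hu hfr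
          exact hlab1 u hur
        · by_cases hur : u = r
          · subst hur; exact .inr hlab1r.1
          · rw [(hlab1 u hur).1]; exact .inl (hlab u hu).2
        · by_cases hur : u = r
          · subst hur; rw [hlab1r.1]; omega
          -- Another member of the cluster would be adjacent to `r` and would have been found in its
          -- list. So the cluster was just `r`, and its label is now empty, as the zero pin asserts.
          · have hE := ((hx.sol.ok r u (by omega) (by omega) (Ne.symm hur)).2 (by omega)
              (by omega)).2 (by omega)
            obtain ⟨e, he1, he2, rfl⟩ := (I.mem r hrn u).1 hE
            exact h2 hp e he1 he2
        · by_cases hur : u = r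
          · subst hur; simp [hlab1r.1, hconsr g hg]
          · rw [(hlab1 u hur).2] at hd
            exact absurd (hlab u hu).1 hd

/-! ### The program: one guess -/

/-- Try to extend the labelling by the vertex `xV`, subject to the guess. -/
def guess : Prog :=
  assign xFail (const 0) ;; assign xLen (const 0) ;; assign xJ (const 2) ;;
  forUp xJ (add (var xK) (const 2)) anchor ;;
  assign xU (var xV) ;;
  ite (read aBit (const 1)) place (assign xL (const 1) ;; push) ;;
  assign xCap (add (var xLen) (add (var xK) (var xK))) ;;
  propagate ;; cleanup

/-- The vertices decided so far are labelled consistently. -/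
theorem Partial.cons_of {j len : ℕ} {lab dec old que pin g : ℕ → ℕ} (hx : Ext I f v)
    (h : Partial I f v rep bit j lab dec old que pin len) (hg : Match I f v rep bit g) :
    Cons g lab dec := by
  refine ⟨h.cons g hg, fun w w' hw hw' hl hl' => ?_⟩
  have h1 := h.fresh w hw
  have h2 := h.fresh w' hw'
  have c1 := h.cons g hg w hw
  have c2 := h.cons g hg w' hw'
  have g1 := (hg.supp w).2 (.inl (by omega))
  have g2 := (hg.supp w').2 (.inl (by omega))
  by_cases hww : w = w'
  · subst hww; simp
  -- Both vertices lie in clusters of `f` and of `g`, so sharing a cluster means adjacency in either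
  -- solution.
  rw [← (hg.sol.ok w w' g1 g2 hww).2 (by omega) (by omega),
    (hx.sol.ok w w' (by omega) (by omega) hww).2 (by omega) (by omega)]
  omega

/-- On success the pins meet the requirements on representatives, so they serve as such for the next
insertion. -/
structure GuessPost (I : Inst) (f : ℕ → ℕ) (v : ℕ) (rep bit : ℕ → ℕ) (s' : State) : Prop where
  dec : ∀ u, s'.arr aDec u = 0
  pin_le : ∀ i, s'.arr aPin i ≤ I.n
  fail_le : s'.var xFail ≤ 1
  fail : s'.var xFail ≠ 0 → s'.arr aLab = f ∧ ∀ g, ¬ Match I f v rep bit g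
  success : s'.var xFail = 0 → IsSol I (s'.arr aLab) ∧
    (∀ u, s'.arr aLab u ≠ 0 ↔ f u ≠ 0 ∨ u = v) ∧ Rep I (s'.arr aLab) (s'.arr aPin)

/-- Deciding the new vertex. -/
theorem run_new {s : State} (hst : Static I s) (hx : Ext I f v)
    (hc : Core I f v rep bit s) (hfail : s.var xFail = 0) (hU : s.var xU = v)
    (hd : s.arr aDec v = 0) (hbit : s.arr aBit = bit) (hbit1 : ∀ i, bit i ≤ 1)
    (hlen : s.var xLen ≤ 2 * I.k) :
    Run I.W (ite (read aBit (const 1)) place (assign xL (const 1) ;; push)) s (25 * I.k + 70)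
      fun s' => Core I f v rep bit s' ∧ s'.var xLen = s.var xLen + 1 ∧
        s'.arr aDec v ≠ 0 := by
  have hW1 := I.n_lt
  have hW2 := I.k_lt
  have hvn := hx.v_lt
  have hll := hc.trail.lab_le v
  have hb1 := hbit1 1
  rw [Run.ite_iff]
  simp only [Expr.Fits, Expr.eval, Expr.cost, hbit]
  refine ⟨by omega, by omega, fun hb => ?_, fun hb => ?_⟩
  · refine (run_place hst hx hc hfail (.inr hU) (by rw [hU, hd])
      (fun g hg => by rw [hU]; exact hg.new.1 hb) (by omega)).mono (by omega) ?_
    rintro s' ⟨h1, -, h3, -, h5, -⟩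
    exact ⟨h1, h5, by rw [h3, hU]; simp⟩
  · rw [Run.assign_seq_iff]
    simp only [Expr.Fits, Expr.eval, Expr.cost]
    refine ⟨by omega, by omega, ?_⟩
    refine (run_push (by simp; omega) (by simp; omega) (by simp; omega)
      (by simp [hU]; omega)).mono (by omega) ?_
    rintro s' ⟨eOld, eLab, eDec, eQue, eLen, hf⟩
    have ePin := hf.arr aPin (by decide)
    have eFail := hf.var xFail (by decide)
    simp only [State.setVar_var, State.setVar_arr] at eOld eLab eDec eQue eLen ePin eFail
    simp only [reduceIte, Nat.reduceEqDiff, hU] at eOld eLab eDec eQue eLen ePin eFail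
    refine ⟨⟨?_, ?_, ?_, by omega, ?_⟩, eLen, by rw [eDec]; simp⟩
    · rw [eOld, eLab, eDec, eQue, eLen]
      exact hc.trail.push (.inr rfl) hd le_rfl (by omega)
    · rw [eLab, eDec, ePin]
      exact fun _ => (hc.pins hfail).update_one hd
    · rw [ePin]; exact hc.pin_le
    · rw [eLab, eDec, eFail]
      exact fun g hg => ⟨hfail, (hc.cons g hg).2.update_one
        (by by_contra hcon; exact hg.new.2 hcon hb)⟩

theorem run_guess {s : State} (hst : Static I s) (hx : Ext I f v) (hr : Rep I f rep)
    (hrep : s.arr aRep = rep) (hbit : s.arr aBit = bit) (hbit1 : ∀ i, bit i ≤ 1)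
    (hlab : s.arr aLab = f) (hdec : ∀ u, s.arr aDec u = 0) (hpin : ∀ i, s.arr aPin i ≤ I.n)
    (hV : s.var xV = v) :
    Run I.W guess s ((4 * I.k + 5) * ((I.deg v + 1) * (50 * I.k + 450)))
      (GuessPost I f v rep bit) := by
  have hW1 := I.n_lt
  have hW2 := I.k_lt
  have hvn := hx.v_lt
  -- The summands are the propagation over at most `4 * k + 1` queue entries, the `k` anchors with
  -- one list scan each, the clean-up of the queue, and the placement of `v` with the
  -- initialisations.
  have hT : (4 * I.k + 1) * ((I.deg v + 1) * (50 * I.k + 300) + 4) + I.k * (I.deg v * 23 + 110) +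
      (4 * I.k + 1) * 25 + 25 * I.k + 150 ≤
      (4 * I.k + 5) * ((I.deg v + 1) * (50 * I.k + 450)) := by
    have h0 : 0 ≤ I.k * I.deg v := Nat.zero_le _
    have h1 : 0 ≤ I.k * I.k := Nat.zero_le _
    have h2 : 0 ≤ I.k * I.k * I.deg v := Nat.zero_le _
    nlinarith
  refine Run.mono ?_ hT fun _ => id
  obtain ⟨A, hA⟩ : ∃ A, (4 * I.k + 1) * ((I.deg v + 1) * (50 * I.k + 300) + 4) = A := ⟨_, rfl⟩
  obtain ⟨B, hB⟩ : ∃ B, I.k * (I.deg v * 23 + 110) = B := ⟨_, rfl⟩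
  rw [hA, hB]
  unfold guess
  simp only [Run.assign_seq_iff, Expr.Fits, Expr.eval, Expr.cost]
  refine ⟨by omega, by omega, by omega, by omega, by omega, by omega, ?_⟩
  set s₀ := ((s.setVar xFail 0).setVar xLen 0).setVar xJ 2 with hs₀
  have hst0 : Static I s₀ := ((hst.setVar (by decide) (by decide)).setVar (by decide)
    (by decide)).setVar (by decide) (by decide)
  have aJ : s₀.var xJ = 2 := by simp [hs₀]
  have aFail : s₀.var xFail = 0 := by simp [hs₀]
  have aV : s₀.var xV = v := by simp [hs₀, hV]
  have a5 : s₀.arr aRep = rep := by simp [hs₀, hrep]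
  have a6 : s₀.arr aBit = bit := by simp [hs₀, hbit]
  refine Run.bind _ (Run.forUp (W := I.W) (b := I.k + 2) (C := I.deg v * 23 + 100) (fun j s' =>
    Partial I f v rep bit j (s'.arr aLab) (s'.arr aDec) (s'.arr aOld) (s'.arr aQue)
      (s'.arr aPin) (s'.var xLen))
    (by omega) (by omega) ?_ (by omega) (by decide) ?_ ?_) ?_ ?_
  · have b1 : s₀.arr aLab = f := by simp [hs₀, hlab]
    have b2 : s₀.arr aDec = s.arr aDec := by simp [hs₀]
    have b3 : s₀.var xLen = 0 := by simp [hs₀]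
    have b4 : s₀.arr aPin = s.arr aPin := by simp [hs₀]
    rw [aJ, b1, b2, b3, b4]
    refine ⟨⟨hx.sol.le, fun _ _ => rfl, fun u hu => absurd (hdec u) hu,
      fun u hu => absurd (hdec u) hu, fun u => by rw [hdec u]; omega, by omega,
      fun u hu => absurd (hdec u) hu⟩, fun i h1 h2 => by omega, fun u hu => absurd (hdec u) hu,
      fun g _ u hu => absurd (hdec u) hu, hpin, by omega⟩
  · intro j s' _ hf
    have := (hst0.frame hf).k
    simp only [Expr.Fits, Expr.eval, this, and_true]
    omega
  · intro j s' hP hj hjk hJ hf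
    have e1 : s'.arr aRep = rep := (hf.arr _ (by decide)).trans a5
    have e2 : s'.arr aBit = bit := (hf.arr _ (by decide)).trans a6
    refine (run_anchor (hst0.frame hf) hx hr e1 e2 hbit1 hJ (by omega) hjk hP).mono le_rfl ?_
    intro s'' h
    simpa using h
  · simp only [aJ, Expr.cost, Nat.add_sub_cancel]
    have : I.deg v * 23 + 100 + (1 + 1 + 1) + 7 = I.deg v * 23 + 110 := by omega
    rw [this, hB]
    omega
  rintro s₁ ⟨hP, hJ1, hf1⟩ -
  have hst1 := hst0.frame hf1
  have c1 : s₁.var xFail = 0 := (hf1.var _ (by decide)).trans aFail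
  have c2 : s₁.var xV = v := (hf1.var _ (by decide)).trans aV
  have c4 : s₁.arr aBit = bit := (hf1.arr _ (by decide)).trans a6
  have hlen1 := hP.len_le
  have hcost : (I.k + 2 - s₀.var xJ) * (I.deg v * 23 + 100 +
      ((var xK).add (const 2)).cost + 7) + (((var xK).add (const 2)).cost + 3) = B + 6 := by
    simp only [aJ, Expr.cost, Nat.add_sub_cancel]
    have : I.deg v * 23 + 100 + (1 + 1 + 1) + 7 = I.deg v * 23 + 110 := by omega
    rw [this, hB]
  rw [hcost]
  rw [Run.assign_seq_iff]
  simp only [Expr.Fits, Expr.eval, Expr.cost, c2]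
  refine ⟨by omega, by omega, ?_⟩
  set s₂ := s₁.setVar xU v with hs₂
  have hdv : s₁.arr aDec v = 0 := by
    by_contra hd
    have := hP.fresh v hd
    have := hx.absent
    omega
  have hcore2 : Core I f v rep bit s₂ := by
    have : Core I f v rep bit s₁ := ⟨hP.trail, fun _ => hP.pins, hP.pin_le, by omega,
      fun g hg => ⟨c1, hP.cons_of hx hg⟩⟩
    exact this.setVar (by decide) (by decide)
  refine Run.bind _ (run_new (hst1.setVar (by decide) (by decide)) hx hcore2 (by simpa [hs₂] using c1)
    (by simp [hs₂]) (by simpa [hs₂] using hdv) (by simpa [hs₂] using c4) hbit1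
    (by simp [hs₂]; omega)) (by omega) ?_
  rintro s₃ ⟨hcore3, hlen3, hdv3⟩ hf3
  have hst3 : Static I s₃ := (hst1.setVar (by decide) (by decide)).frame hf3
  have hlen2 : s₂.var xLen = s₁.var xLen := by simp [hs₂]
  rw [Run.assign_seq_iff]
  simp only [Expr.Fits, Expr.eval, Expr.cost, hst3.k]
  refine ⟨by omega, by omega, ?_⟩
  set s₄ := s₃.setVar xCap (s₃.var xLen + (I.k + I.k)) with hs₄
  have hb4 : Busy I f v rep bit s₄ := by
    refine ⟨hst3.setVar (by decide) (by decide), hcore3.setVar (by decide) (by decide), ?_, ?_, ?_⟩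
    -- The cap is the current length plus `2 * k`: anchors and `v` are decided by the guess and do
    -- not count as flips.
    · exact ⟨∅, by simp [hs₄]; omega, by simp⟩
    · simp [hs₄]
    · simp [hs₄]; omega
  have hdv4 : s₄.arr aDec v ≠ 0 := by simpa [hs₄] using hdv3
  refine Run.bind _ (run_propagate hx hb4) (by omega) ?_
  rintro s₅ ⟨hb5, hg5, hok5⟩ -
  refine (run_cleanup hx hb5).frame.mono (by omega) ?_
  rintro s₆ ⟨⟨hd6, hk6, hu6⟩, hf6⟩
  have e1 : s₆.var xFail = s₅.var xFail := hf6.var _ (by decide)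
  have e2 : s₆.arr aPin = s₅.arr aPin := hf6.arr _ (by decide)
  have hc5 := hb5.core
  refine ⟨hd6, by rw [e2]; exact hc5.pin_le, by rw [e1]; exact hc5.fail_le, fun hfail => ?_,
    fun hfail => ?_⟩
  · rw [e1] at hfail
    exact ⟨hu6 hfail, fun g hg => hfail (hc5.cons g hg).1⟩
  · rw [e1] at hfail
    rw [hk6 hfail, e2]
    have hsupp : ∀ u, s₅.arr aLab u ≠ 0 ↔ f u ≠ 0 ∨ u = v := by
      intro u
      refine ⟨hc5.trail.present_of, fun h => ?_⟩
      by_cases hd : s₅.arr aDec u = 0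
      · rcases h with h | rfl
        · rwa [hc5.trail.keep u hd]
        · exact absurd hd (hg5.dec u hdv4).1
      · exact (hc5.trail.present u hd).2
    refine ⟨⟨hc5.trail.lab_le, fun a b ha hb hab => hok5 hfail a b ha hb hab⟩, hsupp,
      hc5.pin_le, fun i h1 h2 h3 => ((hc5.pins hfail) i h1 h2).1 h3,
      fun i r h1 h2 h3 => (((hc5.pins hfail) i h1 h2).2 r h3).2.1⟩

/-! ### The program: updating the representatives and enumerating the guesses -/

/-- Proceed to the next guess, or give up. -/
def increment : Prog :=
  assign xJ (const 0) ;;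
  loop (mul (lt (var xJ) (add (var xK) (const 2))) (read aBit (var xJ)))
    (write aBit (var xJ) (const 0) ;; assign xJ (add (var xJ) (const 1))) ;;
  ite (lt (var xJ) (add (var xK) (const 2))) (write aBit (var xJ) (const 1))
    (assign xDone (const 1) ;; assign xAns (const 0))

/-- Extend the labelling by the vertex `xV`, trying all guesses. -/
def extend : Prog :=
  assign xJ (const 0) ;;
  forUp xJ (add (var xK) (const 2)) (write aBit (var xJ) (const 0)) ;;
  assign xDone (const 0) ;;
  loop (eq (var xDone) (const 0)) (guess ;; ite (var xFail) increment (assign xDone (const 1))) ;;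
  ite (var xAns)
    (assign xJ (const 2) ;;
     forUp xJ (add (var xK) (const 2)) (write aRep (var xJ) (read aPin (var xJ)))) skip

/-- The binary digits of a number. -/
def bitsOf (t i : ℕ) : ℕ := if t.testBit i then 1 else 0

/-! ### Binary counting through the guesses -/

theorem bitsOf_le (t i : ℕ) : bitsOf t i ≤ 1 := by
  unfold bitsOf; split_ifs <;> omega

theorem bitsOf_ne_zero {t i : ℕ} : bitsOf t i ≠ 0 ↔ t.testBit i = true := by
  unfold bitsOf; split_ifs with h <;> simp [h]

/-- The carry of a binary counter: adding one clears the trailing ones and sets the lowest zero. -/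
theorem testBit_succ_of_ones : ∀ {j t : ℕ}, (∀ i, i < j → t.testBit i = true) →
    t.testBit j = false → ∀ i, (t + 1).testBit i =
      if i < j then false else if i = j then true else t.testBit i := by
  intro j
  induction j with
  | zero =>
    intro t _ h i
    have h2 : t % 2 = 0 := by simpa [Nat.testBit_zero] using h
    cases i with
    | zero => simp [Nat.testBit_zero]; omega
    | succ i =>
      rw [Nat.testBit_succ, Nat.testBit_succ, show (t + 1) / 2 = t / 2 by omega]
      simp
  | succ j ih =>
    intro t h h' i
    have h2 : t % 2 = 1 := by simpa [Nat.testBit_zero] using h 0 (by omega)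
    cases i with
    | zero => simp [Nat.testBit_zero]; omega
    | succ i =>
      rw [Nat.testBit_succ, Nat.testBit_succ, show (t + 1) / 2 = t / 2 + 1 by omega,
        ih (fun i hi => by rw [← Nat.testBit_succ]; exact h (i + 1) (by omega))
          (by rw [← Nat.testBit_succ]; exact h')]
      simp

theorem succ_eq_two_pow : ∀ {K t : ℕ}, t < 2 ^ K → (∀ i, i < K → t.testBit i = true) →
    t + 1 = 2 ^ K := by
  intro K
  induction K with
  | zero => intro t h _; simp at h; simp [h]
  | succ K ih =>
    intro t ht h
    have h2 : t % 2 = 1 := by simpa [Nat.testBit_zero] using h 0 (by omega)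
    have := ih (t := t / 2) (by rw [pow_succ] at ht; omega)
      (fun i hi => by rw [← Nat.testBit_succ]; exact h (i + 1) (by omega))
    rw [pow_succ]
    omega

theorem exists_bitsOf (K : ℕ) (p : ℕ → Prop) :
    ∃ t, t < 2 ^ K ∧ ∀ i, i < K → (bitsOf t i ≠ 0 ↔ p i) := by
  classical
  refine ⟨Nat.ofBits fun i : Fin K => decide (p i), Nat.ofBits_lt_two_pow _, fun i hi => ?_⟩
  rw [bitsOf_ne_zero, Nat.testBit_ofBits_lt _ _ hi]
  simp

/-- The guard is a product because expressions have no short-circuit conjunction. When all digits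
are ones, the cell `k + 2` is read as well, which is harmless because it holds `0`. -/
theorem run_increment {s : State} {t : ℕ} (hst : Static I s) (hbit : s.arr aBit = bitsOf t)
    (ht : t < 2 ^ (I.k + 2)) :
    Run I.W increment s (25 * I.k + 100) fun s' =>
      (t + 1 < 2 ^ (I.k + 2) ∧ s'.arr aBit = bitsOf (t + 1) ∧ s'.var xDone = s.var xDone ∧
        s'.var xAns = s.var xAns) ∨
      (t + 1 = 2 ^ (I.k + 2) ∧ (∀ i, I.k + 2 ≤ i → s'.arr aBit i = 0) ∧ s'.var xDone = 1 ∧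
        s'.var xAns = 0) := by
  have hW1 := I.n_lt
  have hW2 := I.k_lt
  have hhigh : ∀ i, I.k + 2 ≤ i → t.testBit i = false := fun i hi =>
    Nat.testBit_lt_two_pow (ht.trans_le (Nat.pow_le_pow_right (by omega) hi))
  unfold increment
  rw [Run.assign_seq_iff]
  simp only [Expr.Fits, Expr.eval, Expr.cost]
  refine ⟨by omega, by omega, ?_⟩
  set s₀ := s.setVar xJ 0 with hs₀
  have hst0 : Static I s₀ := hst.setVar (by decide) (by decide)
  refine Run.bind _ (Run.loop (W := I.W) (γ := Unit) (c₀ := ()) (fun _ s' =>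
    s'.var xJ ≤ I.k + 2 ∧ (∀ i, i < s'.var xJ → t.testBit i = true) ∧
    ∀ i, s'.arr aBit i = if i < s'.var xJ then 0 else bitsOf t i)
    (fun _ s' => (I.k + 2 - s'.var xJ) * 18) ?_ ?_ ?_) ?_ ?_
  · simp [hs₀, hbit]
  · rintro _ s' ⟨h1, h2, h3⟩ hf
    have hk := (hst0.frame (p := write aBit (var xJ) (const 0) ;;
      assign xJ (add (var xJ) (const 1))) hf).k
    have hb : s'.arr aBit (s'.var xJ) ≤ 1 := by
      rw [h3]; split_ifs
      · omega
      · exact bitsOf_le _ _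
    have hlt : (lt (var xJ) (add (var xK) (const 2))).eval s' ≤ 1 := by
      rw [Expr.eval]; split_ifs <;> omega
    refine ⟨?_, ?_, ?_⟩
    · simp only [Expr.Fits, Expr.eval, hk]; omega
    · simp only [Expr.Fits, Expr.eval]; omega
    · exact (Nat.mul_le_mul hlt hb).trans_lt (by omega)
  · rintro _ s' ⟨h1, h2, h3⟩ hf hg
    have hk := (hst0.frame (p := write aBit (var xJ) (const 0) ;;
      assign xJ (add (var xJ) (const 1))) hf).k
    obtain ⟨g1, g2⟩ : s'.var xJ < I.k + 2 ∧ s'.arr aBit (s'.var xJ) ≠ 0 := by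
      rw [Expr.eval] at hg
      have := mul_ne_zero_iff.1 hg
      rw [lt_eval_ne_zero] at this
      simpa only [Expr.eval, hk] using this
    refine ⟨7, ?_⟩
    rw [Run.write_seq_iff, Run.assign_iff]
    simp only [Expr.Fits, Expr.eval, Expr.cost, State.setArr_var, State.setArr_arr,
      State.setVar_var, State.setVar_arr]
    simp only [reduceIte]
    refine ⟨by omega, by omega, by omega, by omega, by omega, (), ⟨by omega, fun i hi => ?_,
      fun i => ?_⟩, ?_⟩
    · rcases Nat.lt_succ_iff_lt_or_eq.1 hi with hlt | rfl
      · exact h2 i hlt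
      · rw [h3] at g2
        simpa [bitsOf_ne_zero] using g2
    · have := h3 i
      rw [Function.update_apply]; split_ifs with a b b
      · rfl
      · omega
      · rw [this, if_pos (by omega)]
      · rw [this, if_neg (by omega)]
    · omega
  · simp [hs₀, Expr.cost]; omega
  rintro s₁ ⟨_, ⟨h1, h2, h3⟩, hg, hf1'⟩ hf1
  have hst1 := hst0.frame hf1
  have hcost : ((fun (_ : Unit) s' => (I.k + 2 - s'.var xJ) * 18) () s₀) +
      ((mul (lt (var xJ) (add (var xK) (const 2))) (read aBit (var xJ))).cost + 1) =
      18 * I.k + 45 := by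
    simp [hs₀, Expr.cost]; omega
  have e1 : s₁.var xDone = s.var xDone := (hf1.var _ (by decide)).trans (by simp [hs₀])
  have e2 : s₁.var xAns = s.var xAns := (hf1.var _ (by decide)).trans (by simp [hs₀])
  rw [Run.ite_iff, lt_eval_ne_zero, lt_eval_eq_zero, hcost]
  simp only [Expr.Fits, Expr.eval, Expr.cost, hst1.k, Run.write_iff, Run.assign_seq_iff,
    Run.assign_iff, State.setArr_var, State.setArr_arr, State.setVar_var, State.setVar_arr]
  simp only [reduceIte, Nat.reduceEqDiff]
  refine ⟨by omega, by omega, fun hlt => ⟨by omega, by omega, by omega, .inl ?_⟩,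
    fun hge => ⟨by omega, by omega, by omega, by omega, .inr ?_⟩⟩
  · have hbit0 : t.testBit (s₁.var xJ) = false := by
      by_contra hb
      have hb' : s₁.arr aBit (s₁.var xJ) ≠ 0 := by
        rw [h3, if_neg (by omega), bitsOf_ne_zero]
        simpa using hb
      rw [Expr.eval] at hg
      rcases mul_eq_zero.1 hg with h | h
      · rw [lt_eval_eq_zero] at h
        simp only [Expr.eval, hst1.k] at h
        omega
      · exact hb' h
    refine ⟨?_, funext fun i => ?_, e1, e2⟩
    · refine lt_of_le_of_ne ht fun heq => ?_
      have := testBit_succ_of_ones h2 hbit0 (s₁.var xJ)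
      rw [heq, Nat.testBit_two_pow] at this
      simp at this
      omega
    · have h4 := testBit_succ_of_ones h2 hbit0 i
      have h5 := h3 i
      unfold bitsOf at h5 ⊢
      rw [h4, Function.update_apply, h5]
      by_cases ha : i < s₁.var xJ
      · have : i ≠ s₁.var xJ := by omega
        simp [ha, this]
      · by_cases hb : i = s₁.var xJ
        · simp [hb]
        · simp [ha, hb]
  · refine ⟨succ_eq_two_pow ht fun i hi => h2 i (by omega), fun i hi => ?_, trivial, trivial⟩
    rw [h3, bitsOf, hhigh i hi]
    simp

/-! ### The program: extension by one vertex -/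

/-- The labelling `g` is a solution for the support of `f` together with `v`. -/
def Extends (I : Inst) (f : ℕ → ℕ) (v : ℕ) (g : ℕ → ℕ) : Prop :=
  IsSol I g ∧ ∀ u, g u ≠ 0 ↔ f u ≠ 0 ∨ u = v

/-- Every solution matches one of the guesses. -/
theorem Extends.exists_match {g : ℕ → ℕ} (hg : Extends I f v g) :
    ∃ t, t < 2 ^ (I.k + 2) ∧ Match I f v rep (bitsOf t) g := by
  -- Digits are indexed by labels, with `1` for the new vertex; digit `0` is idle and merely doubles
  -- the number of guesses. For an empty cluster, `rep i - 1` is a dummy whose digit is never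
  -- consulted by `Match`.
  obtain ⟨t, ht, h⟩ := exists_bitsOf (I.k + 2) fun i =>
    if i = 1 then g v ≠ 1 else g (rep i - 1) ≠ 1
  refine ⟨t, ht, hg.1, hg.2, fun i r hi hik hir => ?_, ?_⟩
  · rw [h i hik, if_neg (by omega), hir, Nat.add_sub_cancel]
  · rw [h 1 (by omega), if_pos rfl]

/-- The state between two extensions. -/
structure Rest (I : Inst) (f : ℕ → ℕ) (s : State) : Prop where
  static : Static I s
  lab : s.arr aLab = f
  rep : Rep I f (s.arr aRep)
  dec : ∀ u, s.arr aDec u = 0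
  pin_le : ∀ i, s.arr aPin i ≤ I.n
  bit : ∀ i, I.k + 2 ≤ i → s.arr aBit i = 0

/-- The time for trying one guess. -/
def guessTime (k d : ℕ) : ℕ := (4 * k + 6) * ((d + 1) * (50 * k + 450))

structure TryPost (I : Inst) (f : ℕ → ℕ) (v : ℕ) (s' : State) : Prop where
  dec : ∀ u, s'.arr aDec u = 0
  pin_le : ∀ i, s'.arr aPin i ≤ I.n
  bit : ∀ i, I.k + 2 ≤ i → s'.arr aBit i = 0
  result : (s'.var xAns = 1 ∧ Extends I f v (s'.arr aLab) ∧
    Rep I (s'.arr aLab) (s'.arr aPin)) ∨ (s'.var xAns = 0 ∧ ∀ g, ¬ Extends I f v g)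

theorem run_try {s : State} (hx : Ext I f v) (hs : Rest I f s) (hbit0 : s.arr aBit = bitsOf 0)
    (hV : s.var xV = v) (hdone : s.var xDone = 0) (hans : s.var xAns = 1) :
    Run I.W (loop (eq (var xDone) (const 0))
      (guess ;; ite (var xFail) increment (assign xDone (const 1)))) s
      (2 ^ (I.k + 2) * guessTime I.k (I.deg v) + 4) (TryPost I f v) := by
  have hW1 := I.n_lt
  have hW2 := I.k_lt
  -- `guessTime` has `4 * k + 6` in place of `4 * k + 5`: the surplus pays for stepping the counter
  -- and for the tests.
  have hC : (4 * I.k + 5) * ((I.deg v + 1) * (50 * I.k + 450)) + 50 * I.k + 450 ≤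
      guessTime I.k (I.deg v) := by
    have : (50 * I.k + 450) ≤ (I.deg v + 1) * (50 * I.k + 450) := Nat.le_mul_of_pos_left _ (by omega)
    unfold guessTime
    rw [show 4 * I.k + 6 = (4 * I.k + 5) + 1 by omega, Nat.add_mul (4 * I.k + 5)]
    omega
  obtain ⟨C, hCC⟩ : ∃ C, guessTime I.k (I.deg v) = C := ⟨_, rfl⟩
  obtain ⟨A, hA⟩ : ∃ A, (4 * I.k + 5) * ((I.deg v + 1) * (50 * I.k + 450)) = A := ⟨_, rfl⟩
  rw [hCC, hA] at hC
  rw [hCC]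
  have hbz : ∀ t, t < 2 ^ (I.k + 2) → ∀ i, I.k + 2 ≤ i → bitsOf t i = 0 := fun t ht i hi => by
    rw [bitsOf, Nat.testBit_lt_two_pow (ht.trans_le (Nat.pow_le_pow_right (by omega) hi))]
    simp
  refine (Run.loop (W := I.W) (γ := ℕ) (c₀ := 0) (fun t s' =>
    (∀ u, s'.arr aDec u = 0) ∧ (∀ i, s'.arr aPin i ≤ I.n) ∧
    ((s'.var xDone = 0 ∧ t < 2 ^ (I.k + 2) ∧ s'.arr aBit = bitsOf t ∧ s'.arr aLab = f ∧
        s'.var xAns = 1 ∧ ∀ t', t' < t → ∀ g, ¬ Match I f v (s.arr aRep) (bitsOf t') g) ∨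
      (s'.var xDone = 1 ∧ TryPost I f v s')))
    -- The ghost `t` counts refuted guesses; the potential drops to zero once the search has ended.
    (fun t s' => if s'.var xDone = 0 then (2 ^ (I.k + 2) - t) * C else 0) ?_ ?_ ?_).mono ?_ ?_
  · exact ⟨hs.dec, hs.pin_le, .inl ⟨hdone, by positivity, hbit0, hs.lab, hans, by omega⟩⟩
  · rintro t s' ⟨-, -, h⟩ -
    have : s'.var xDone ≤ 1 := by omega
    simp only [Expr.Fits]
    omega
  · rintro t s' ⟨hd, hp, h⟩ hf hg
    rw [eq_eval_ne_zero] at hg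
    simp only [Expr.eval] at hg
    obtain ⟨-, ht, hb, hl, ha, hno⟩ := h.resolve_right fun h => by omega
    have hst : Static I s' := hs.static.frame hf
    have hrep : s'.arr aRep = s.arr aRep := hf.arr _ (by decide)
    have hV' : s'.var xV = v := (hf.var _ (by decide)).trans hV
    have hΦ : (2 ^ (I.k + 2) - t) * C = (2 ^ (I.k + 2) - (t + 1)) * C + C := by
      rw [show 2 ^ (I.k + 2) - t = (2 ^ (I.k + 2) - (t + 1)) + 1 by omega, Nat.add_mul, one_mul]
    refine ⟨A + (25 * I.k + 110), Run.bind _ (run_guess hst hx hs.rep hrep hb (bitsOf_le t) hl hd hp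
      hV') (by omega) ?_⟩
    rintro s₁ ⟨g1, g2, g3, g4, g5⟩ hf1
    have hst1 := hst.frame hf1
    have hb1 : s₁.arr aBit = bitsOf t := (hf1.arr _ (by decide)).trans hb
    have hd1 : s₁.var xDone = 0 := (hf1.var _ (by decide)).trans hg
    have ha1 : s₁.var xAns = 1 := (hf1.var _ (by decide)).trans ha
    rw [Run.ite_iff]
    simp only [Expr.Fits, Expr.eval, Expr.cost]
    refine ⟨by omega, by omega, fun hfail => ?_, fun hfail => ?_⟩
    · obtain ⟨hl1, hm1⟩ := g4 hfail
      have hno' : ∀ t', t' < t + 1 → ∀ g, ¬ Match I f v (s.arr aRep) (bitsOf t') g := by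
        intro t' ht'
        rcases Nat.lt_succ_iff_lt_or_eq.1 ht' with hlt | rfl
        · exact hno t' hlt
        · exact hm1
      refine (run_increment hst1 hb1 ht).frame.mono (by omega) ?_
      rintro s₂ ⟨h2, hf2⟩
      have j1 : s₂.arr aDec = s₁.arr aDec := hf2.arr _ (by decide)
      have j2 : s₂.arr aPin = s₁.arr aPin := hf2.arr _ (by decide)
      have j3 : s₂.arr aLab = s₁.arr aLab := hf2.arr _ (by decide)
      rcases h2 with ⟨k1, k2, k3, k4⟩ | ⟨k1, k2, k3, k4⟩
      · refine ⟨t + 1, ⟨by rwa [j1], by rwa [j2], .inl ⟨by omega, k1, k2, j3.trans hl1, by omega,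
          hno'⟩⟩, ?_⟩
        rw [if_pos hg, if_pos (by omega), hΦ]
        omega
      · refine ⟨t + 1, ⟨by rwa [j1], by rwa [j2], .inr ⟨k3, by rwa [j1], by rwa [j2], k2,
          .inr ⟨k4, fun g hg => ?_⟩⟩⟩, ?_⟩
        -- All `2 ^ (k + 2)` guesses are refuted, yet an extension would match one of them.
        · obtain ⟨t', ht', hm⟩ := hg.exists_match (rep := s.arr aRep)
          exact hno' t' (by omega) g hm
        · rw [if_pos hg, if_neg (by omega), hΦ]
          omega
    · obtain ⟨h1, h2, h3⟩ := g5 hfail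
      rw [Run.assign_iff]
      simp only [Expr.Fits, Expr.eval, Expr.cost, State.setVar_var, State.setVar_arr]
      simp only [reduceIte]
      refine ⟨by omega, by omega, t, ⟨g1, g2, .inr ⟨trivial, g1, g2, ?_, .inl ⟨?_, ⟨h1, h2⟩,
        h3⟩⟩⟩, ?_⟩
      · simp only [State.setVar_arr, hb1]; exact hbz t ht
      · simpa using ha1
      · rw [if_pos hg, hΦ]
        simp only [one_ne_zero, if_false]
        omega
  · simp [hdone, Expr.cost]
  · rintro s' ⟨t, ⟨-, -, h⟩, hg, -⟩
    rw [eq_eval_eq_zero] at hg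
    simp only [Expr.eval] at hg
    rcases h with h | h
    · exact absurd h.1 hg
    · exact h.2

structure ExtendPost (I : Inst) (f : ℕ → ℕ) (v : ℕ) (s' : State) : Prop where
  result : (s'.var xAns = 1 ∧ ∃ f', Extends I f v f' ∧ Rest I f' s') ∨
    (s'.var xAns = 0 ∧ ∀ g, ¬ Extends I f v g)

/-- The time for extending the labelling by a vertex of degree `d`. -/
def extendTime (k d : ℕ) : ℕ := 2 ^ (k + 2) * guessTime k d + 60 * k + 150

theorem run_extend {s : State} (hx : Ext I f v) (hs : Rest I f s)
    (hV : s.var xV = v) (hans : s.var xAns = 1) :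
    Run I.W extend s (extendTime I.k (I.deg v)) (ExtendPost I f v) := by
  have hW1 := I.n_lt
  have hW2 := I.k_lt
  obtain ⟨C, hC⟩ : ∃ C, 2 ^ (I.k + 2) * guessTime I.k (I.deg v) = C := ⟨_, rfl⟩
  rw [extendTime, hC]
  unfold extend
  rw [Run.assign_seq_iff]
  simp only [Expr.Fits, Expr.eval, Expr.cost]
  refine ⟨by omega, by omega, ?_⟩
  set s₀ := s.setVar xJ 0 with hs₀
  have hst0 : Static I s₀ := hs.static.setVar (by decide) (by decide)
  have e0 : s₀.var xJ = 0 := by simp [hs₀]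
  refine Run.bind _ (Run.forUp (W := I.W) (b := I.k + 2) (C := 3) (fun j s' =>
    ∀ i, i < j ∨ I.k + 2 ≤ i → s'.arr aBit i = 0)
    (by omega) (by omega) ?_ (by omega) (by decide) ?_ ?_) ?_ ?_
  · rw [e0]
    intro i hi
    simpa [hs₀] using hs.bit i (by omega)
  · intro j s' _ hf
    simp only [Expr.Fits, Expr.eval, (hst0.frame hf).k, and_true]
    omega
  · intro j s' hI hj hjk hJ hf
    rw [Run.write_iff]
    simp only [Expr.Fits, Expr.eval, Expr.cost, State.setVar_arr, State.setArr_arr, hJ]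
    simp only [reduceIte]
    refine ⟨by omega, by omega, by omega, fun i hi => ?_⟩
    rw [Function.update_apply]; split_ifs
    · rfl
    · exact hI i (by omega)
  · simp only [e0, Expr.cost]; omega
  rintro s₁ ⟨hI1, -, hf1'⟩ hf1
  have hst1 := hst0.frame hf1
  simp only [e0, Expr.cost]
  rw [Run.assign_seq_iff]
  simp only [Expr.Fits, Expr.eval, Expr.cost]
  refine ⟨by omega, by omega, ?_⟩
  set s₂ := s₁.setVar xDone 0 with hs₂
  have hrest2 : Rest I f s₂ := by
    have e1 : s₁.arr aLab = s.arr aLab := hf1.arr _ (by decide)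
    have e2 : s₁.arr aRep = s.arr aRep := hf1.arr _ (by decide)
    have e3 : s₁.arr aDec = s.arr aDec := hf1.arr _ (by decide)
    have e4 : s₁.arr aPin = s.arr aPin := hf1.arr _ (by decide)
    refine ⟨hst1.setVar (by decide) (by decide), ?_, ?_, ?_, ?_, ?_⟩ <;>
      simp only [hs₂, State.setVar_arr, e1, e2, e3, e4]
    exacts [hs.lab, hs.rep, hs.dec, hs.pin_le, fun i hi => hI1 i (.inr hi)]
  have hV2 : s₂.var xV = v := by
    have : s₁.var xV = s₀.var xV := hf1.var _ (by decide)
    simp [hs₂, this, hs₀, hV]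
  have ha2 : s₂.var xAns = 1 := by
    have : s₁.var xAns = s₀.var xAns := hf1.var _ (by decide)
    simp [hs₂, this, hs₀, hans]
  have hb2 : s₂.arr aBit = bitsOf 0 := by
    funext i
    simp only [hs₂, State.setVar_arr, bitsOf, Nat.zero_testBit]
    exact hI1 i (by omega)
  refine Run.bind _ (run_try hx hrest2 hb2 hV2 (by simp [hs₂]) ha2) (by omega) ?_
  rintro s₃ ⟨h1, h2, h3, h4⟩ hf3
  have hst3 : Static I s₃ := hrest2.static.frame hf3
  have hrep3 : s₃.arr aRep = s₂.arr aRep := hf3.arr _ (by decide)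
  rw [hC]
  rw [Run.ite_iff]
  simp only [Expr.Fits, Expr.eval, Expr.cost]
  refine ⟨by omega, by omega, fun ha => ?_, fun ha => ?_⟩
  swap
  · rw [Run.skip_iff]
    exact ⟨by omega, ⟨.inr (h4.resolve_left fun h => by omega)⟩⟩
  obtain ⟨ha', hext, hrp⟩ := h4.resolve_right fun h => by omega
  rw [Run.assign_seq_iff]
  simp only [Expr.Fits, Expr.eval, Expr.cost]
  refine ⟨by omega, by omega, ?_⟩
  set s₄ := s₃.setVar xJ 2 with hs₄
  have hst4 : Static I s₄ := hst3.setVar (by decide) (by decide)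
  have k0 : s₄.var xJ = 2 := by simp [hs₄]
  refine (Run.forUp (W := I.W) (b := I.k + 2) (C := 4) (fun j s' =>
    (∀ i, s'.arr aRep i ≤ I.n) ∧ ∀ i, 2 ≤ i → i < j → s'.arr aRep i = s₃.arr aPin i)
    (by omega) (by omega) ?_ (by omega) (by decide) ?_ ?_).frame.mono ?_ ?_
  · rw [k0]
    refine ⟨fun i => ?_, fun i h1 h2 => by omega⟩
    simp only [hs₄, State.setVar_arr, hrep3]
    exact hrest2.rep.le i
  · intro j s' _ hf
    simp only [Expr.Fits, Expr.eval, (hst4.frame hf).k, and_true]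
    omega
  · intro j s' hI hj hjk hJ hf
    have hp : s'.arr aPin = s₃.arr aPin := hf.arr _ (by decide)
    have := h2 j
    rw [Run.write_iff]
    simp only [Expr.Fits, Expr.eval, Expr.cost, State.setVar_arr, State.setArr_arr, hJ, hp]
    simp only [reduceIte]
    refine ⟨by omega, by omega, by omega, fun i => ?_, fun i hi hij => ?_⟩
    · have := hI.1 i
      rw [Function.update_apply]; split_ifs <;> omega
    · rw [Function.update_apply]; split_ifs with h
      · rw [h]
      · exact hI.2 i hi (by omega)
  · simp only [k0, Expr.cost]; omega
  · rintro s₅ ⟨⟨⟨hr1, hr2⟩, -, -⟩, hf5⟩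
    have e1 : s₅.arr aLab = s₃.arr aLab := hf5.arr _ (by decide)
    have e3 : s₅.arr aDec = s₃.arr aDec := hf5.arr _ (by decide)
    have e4 : s₅.arr aPin = s₃.arr aPin := hf5.arr _ (by decide)
    have e5 : s₅.arr aBit = s₃.arr aBit := hf5.arr _ (by decide)
    have e6 : s₅.var xAns = s₃.var xAns := (hf5.var _ (by decide)).trans (by simp [hs₄])
    refine ⟨.inl ⟨by omega, s₃.arr aLab, hext, hst4.frame hf5, e1, ⟨hr1, fun i hi hik h0 => ?_,
      fun i r hi hik h0 => ?_⟩, by rwa [e3], by rwa [e4], by rwa [e5]⟩⟩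
    · rw [hr2 i hi hik] at h0; exact hrp.empty i hi hik h0
    · rw [hr2 i hi hik] at h0; exact hrp.mem i r hi hik h0

/-! ### The program: the adjacency matrix and the order of the vertices -/

/-- Build the adjacency matrix and the linked lists of the vertices of equal degree. -/
def setup : Prog :=
  assign xU (const 0) ;;
  loop (lt (var xU) (var xN))
    (assign xD (sub (read aOff (add (var xU) (const 1))) (read aOff (var xU))) ;;
     write aNext (var xU) (read aHead (var xD)) ;;
     write aHead (var xD) (add (var xU) (const 1)) ;;
     assign xE (read aOff (var xU)) ;;
     forUp xE (read aOff (add (var xU) (const 1)))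
      (write aAdj (add (mul (var xU) (var xN)) (read aNbr (var xE))) (const 1)) ;;
     assign xU (add (var xU) (const 1)))

/-- `h - 1` is the last vertex of degree `d` below `i`; `h = 0` if there is none. -/
def IsLast (I : Inst) (i d h : ℕ) : Prop :=
  (h = 0 ∨ h ≤ i ∧ I.deg (h - 1) = d) ∧ ∀ u, u < i → I.deg u = d → u < h

/-- The initial memory. -/
structure Init (I : Inst) (s : State) : Prop where
  n : s.var xN = I.n
  k : s.var xK = I.k
  off : s.arr aOff = I.off
  nbr : s.arr aNbr = I.nbr
  zero : ∀ a, 2 ≤ a → ∀ i, s.arr a i = 0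

structure SetupPost (I : Inst) (s' : State) : Prop where
  static : Static I s'
  head : ∀ d, IsLast I I.n d (s'.arr aHead d)
  next : ∀ u, u < I.n → IsLast I u (I.deg u) (s'.arr aNext u)

theorem index_inj {n a b c d : ℕ} (hb : b < n) (hd : d < n) (h : a * n + b = c * n + d) :
    a = c ∧ b = d := by
  have h1 : (a * n + b) % n = (c * n + d) % n := by rw [h]
  rw [Nat.mul_add_mod', Nat.mul_add_mod', Nat.mod_eq_of_lt hb, Nat.mod_eq_of_lt hd] at h1
  subst h1
  exact ⟨Nat.eq_of_mul_eq_mul_right (by omega) (Nat.add_right_cancel h), rfl⟩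

/-- The potential combines the unread part of the concatenated lists with the number of remaining
vertices, so the total is linear in `n + m` although single lists may be long. Prepending to the
bucket lists sorts the vertices by degree in linear time. -/
theorem run_setup {s : State} (hs : Init I s) :
    Run I.W setup s ((I.off I.n - I.off 0) * 25 + I.n * 60 + 10) (SetupPost I) := by
  have hW1 := I.n_lt
  have hW2 := I.k_lt
  unfold setup
  rw [Run.assign_seq_iff]
  simp only [Expr.Fits, Expr.eval, Expr.cost]
  refine ⟨by omega, by omega, ?_⟩
  set s₀ := s.setVar xU 0 with hs₀
  have e0 : s₀.var xU = 0 := by simp [hs₀]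
  refine (Run.loop (W := I.W) (γ := ℕ) (c₀ := 0) (fun u s' => s'.var xU = u ∧ u ≤ I.n ∧
    (∀ d, IsLast I u d (s'.arr aHead d)) ∧
    (∀ v, v < u → IsLast I v (I.deg v) (s'.arr aNext v)) ∧
    (∀ i, s'.arr aAdj i ≤ 1) ∧
    ∀ a b, a < I.n → b < I.n → (s'.arr aAdj (a * I.n + b) ≠ 0 ↔ a < u ∧ I.E a b))
    (fun u _ => (I.off I.n - I.off u) * 25 + (I.n - u) * 60) ?_ ?_ ?_).mono ?_ ?_
  · refine ⟨e0, by omega, fun d => ?_, fun v hv => by omega, fun i => ?_, fun a b _ _ => ?_⟩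
    · have : s₀.arr aHead d = 0 := by simp [hs₀, hs.zero aHead (by omega)]
      rw [this]
      exact ⟨.inl rfl, fun u hu => by omega⟩
    · simp [hs₀, hs.zero aAdj (by omega)]
    · simp [hs₀, hs.zero aAdj (by omega)]
  · rintro u s' ⟨h1, h2, -⟩ hf
    have hn : s'.var xN = I.n := (hf.var _ (by decide)).trans (by simp [hs₀, hs.n])
    simp only [Expr.Fits, hn, h1]
    omega
  · rintro u s' ⟨h1, h2, h3, h4, h5, h6⟩ hf hg
    have hn : s'.var xN = I.n := (hf.var _ (by decide)).trans (by simp [hs₀, hs.n])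
    have ho : s'.arr aOff = I.off := (hf.arr _ (by decide)).trans (by simp [hs₀, hs.off])
    have hb : s'.arr aNbr = I.nbr := (hf.arr _ (by decide)).trans (by simp [hs₀, hs.nbr])
    rw [lt_eval_ne_zero] at hg
    simp only [Expr.eval, hn, h1] at hg
    have hol := I.off_le u hg
    have ho1 := I.off_lt u hg.le
    have ho2 := I.off_lt (u + 1) hg
    have hdeg : I.off (u + 1) - I.off u = I.deg u := rfl
    have hh := h3 (I.deg u)
    have hhn : s'.arr aHead (I.deg u) ≤ I.n := by rcases hh.1 with h | h <;> omega
    have hmono : I.off (u + 1) ≤ I.off I.n := by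
      have : ∀ w, w ≤ I.n → u + 1 ≤ w → I.off (u + 1) ≤ I.off w := by
        intro w
        induction w with
        | zero => intro _ h; omega
        | succ w ih =>
          intro hw huw
          rcases Nat.lt_or_ge u w with h | h
          · exact (ih (by omega) h).trans (I.off_le w (by omega))
          · rw [show u = w by omega]
      exact this I.n le_rfl hg
    refine ⟨I.deg u * 25 + 50, ?_⟩
    rw [Run.assign_seq_iff, Run.write_seq_iff, Run.write_seq_iff, Run.assign_seq_iff]
    simp only [Expr.Fits, Expr.eval, Expr.cost, State.setVar_var, State.setVar_arr,
      State.setArr_var, State.setArr_arr]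
    simp only [reduceIte, Nat.reduceEqDiff, h1, ho, hdeg]
    refine ⟨by omega, by omega, by omega, by omega, by omega, by omega, by omega, by omega,
      by omega, by omega, ?_⟩
    set s₁ := (((s'.setVar xD (I.deg u)).setArr aNext u (s'.arr aHead (I.deg u))).setArr aHead
      (I.deg u) (u + 1)).setVar xE (I.off u) with hs₁
    have k1 : s₁.var xU = u := by simp [hs₁, h1]
    have k2 : s₁.var xN = I.n := by simp [hs₁, hn]
    have k3 : s₁.arr aOff = I.off := by simp [hs₁, ho]
    have k4 : s₁.arr aNbr = I.nbr := by simp [hs₁, hb]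
    have k5 : s₁.arr aAdj = s'.arr aAdj := by simp [hs₁]
    have k6 : s₁.arr aNext = Function.update (s'.arr aNext) u (s'.arr aHead (I.deg u)) := by
      simp [hs₁]
    have k7 : s₁.arr aHead = Function.update (s'.arr aHead) (I.deg u) (u + 1) := by simp [hs₁]
    have k8 : s₁.var xE = I.off u := by simp [hs₁]
    refine Run.bind _ (Run.forUp (W := I.W) (b := I.off (u + 1)) (C := 8) (fun e s'' =>
      (∀ i, s''.arr aAdj i ≤ 1) ∧
      ∀ a b, a < I.n → b < I.n → (s''.arr aAdj (a * I.n + b) ≠ 0 ↔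
        (a < u ∧ I.E a b) ∨ (a = u ∧ ∃ e', I.off u ≤ e' ∧ e' < e ∧ I.nbr e' = b)))
      (by omega) ho2 ?_ (by omega) (by decide) ?_ ?_) ?_ ?_
    · rw [k5, k8]
      refine ⟨h5, fun a b ha hb => (h6 a b ha hb).trans ⟨.inl, ?_⟩⟩
      rintro (h | ⟨-, e', he, he', -⟩)
      · exact h
      · omega
    · intro e s'' _ hf
      have l1 : s''.var xU = u := (hf.var _ (by decide)).trans k1
      have l2 : s''.arr aOff = I.off := (hf.arr _ (by decide)).trans k3
      simp only [Expr.Fits, Expr.eval, l1, l2, and_true]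
      refine ⟨⟨by omega, by omega, by omega⟩, ho2⟩
    · rintro e s'' ⟨i1, i2⟩ he he' heE hf
      have l1 : s''.var xU = u := (hf.var _ (by decide)).trans k1
      have l2 : s''.var xN = I.n := (hf.var _ (by decide)).trans k2
      have l3 : s''.arr aNbr = I.nbr := (hf.arr _ (by decide)).trans k4
      have hE : I.E u (I.nbr e) := (I.mem u hg _).2 ⟨e, by omega, he', rfl⟩
      have hnb := I.lt' hE
      have hidx := I.index_lt hg hnb
      rw [Run.write_iff]
      simp only [Expr.Fits, Expr.eval, Expr.cost, State.setVar_arr, State.setArr_arr, l1, l2, l3,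
        heE]
      simp only [reduceIte]
      refine ⟨by omega, by omega, by omega, fun i => ?_, fun a b ha hb => ?_⟩
      · have := i1 i
        rw [Function.update_apply]; split_ifs <;> omega
      · rw [Function.update_apply]
        split_ifs with heq
        · obtain ⟨rfl, rfl⟩ := index_inj hb hnb heq
          simp only [ne_eq, one_ne_zero, not_false_eq_true, true_iff]
          exact .inr ⟨trivial, e, by omega, by omega, rfl⟩
        · rw [i2 a b ha hb]
          refine or_congr_right (and_congr_right fun hau => ⟨?_, ?_⟩)
          · rintro ⟨e', p1, p2, p3⟩; exact ⟨e', p1, by omega, p3⟩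
          · rintro ⟨e', p1, p2, p3⟩
            refine ⟨e', p1, ?_, p3⟩
            rcases Nat.lt_succ_iff_lt_or_eq.1 p2 with h | rfl
            · exact h
            · exact absurd (by rw [hau, p3]) heq
    · rw [k8, hdeg]; simp only [Expr.cost]; omega
    · rintro s₂ ⟨⟨i1, i2⟩, -, -⟩ hf2
      have l1 : s₂.var xU = u := (hf2.var _ (by decide)).trans k1
      have l2 : s₂.arr aNext = s₁.arr aNext := hf2.arr _ (by decide)
      have l3 : s₂.arr aHead = s₁.arr aHead := hf2.arr _ (by decide)
      rw [Run.assign_iff]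
      simp only [Expr.Fits, Expr.eval, Expr.cost, State.setVar_arr, State.setVar_var, l1, l2, l3,
        k6, k7, k8, hdeg]
      simp only [reduceIte]
      refine ⟨by omega, by omega, u + 1, ⟨rfl, hg, fun d => ?_, fun w hw => ?_, i1,
        fun a b ha hb => ?_⟩, ?_⟩
      · rw [Function.update_apply]; split_ifs with h
        · subst h
          exact ⟨.inr ⟨le_rfl, by simp⟩, fun w hw _ => hw⟩
        · obtain ⟨p1, p2⟩ := h3 d
          refine ⟨p1.imp_right fun p => ⟨by omega, p.2⟩, fun w hw hwd => ?_⟩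
          rcases Nat.lt_succ_iff_lt_or_eq.1 hw with h' | rfl
          · exact p2 w h' hwd
          · exact absurd hwd.symm h
      · rw [Function.update_apply]; split_ifs with h
        · subst h; exact hh
        · exact h4 w (by omega)
      · rw [i2 a b ha hb]
        constructor
        · rintro (⟨p, q⟩ | ⟨rfl, e', p1, p2, p3⟩)
          · exact ⟨by omega, q⟩
          · exact ⟨by omega, (I.mem a ha b).2 ⟨e', p1, p2, p3⟩⟩
        · rintro ⟨p, q⟩
          rcases Nat.lt_succ_iff_lt_or_eq.1 p with h' | rfl
          · exact .inl ⟨h', q⟩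
          · exact .inr ⟨rfl, (I.mem a ha b).1 q⟩
      · have : (I.off I.n - I.off u) = (I.off I.n - I.off (u + 1)) + I.deg u := by omega
        rw [this, show I.n - u = (I.n - (u + 1)) + 1 by omega, Nat.add_mul, Nat.add_mul _ 1]
        omega
  · simp only [Expr.cost, Nat.sub_zero]; omega
  · rintro s' ⟨u, ⟨h1, h2, h3, h4, h5, h6⟩, hg, hf⟩
    have hn : s'.var xN = I.n := (hf.var _ (by decide)).trans (by simp [hs₀, hs.n])
    rw [lt_eval_eq_zero] at hg
    simp only [Expr.eval, hn, h1] at hg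
    obtain rfl : u = I.n := le_antisymm h2 hg
    refine ⟨⟨hn, (hf.var _ (by decide)).trans (by simp [hs₀, hs.k]),
      (hf.arr _ (by decide)).trans (by simp [hs₀, hs.off]),
      (hf.arr _ (by decide)).trans (by simp [hs₀, hs.nbr]), h5, fun a b ha hb => ?_⟩, h3, h4⟩
    rw [h6 a b ha hb]
    exact ⟨fun h => h.2, fun h => ⟨ha, h⟩⟩

/-! ### The program: inserting all vertices -/

/-- Insert the vertices of degree `xD`. -/
def insertBucket : Prog :=
  loop (var xCur)
    (assign xV (sub (var xCur) (const 1)) ;; assign xCur (read aNext (var xV)) ;;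
     ite (var xAns) extend skip)

/-- Insert the vertices in the order of their degrees. -/
def insertAll : Prog :=
  assign xAns (const 1) ;; assign xD (const 0) ;;
  loop (lt (var xD) (var xN))
    (assign xCur (read aHead (var xD)) ;; insertBucket ;; assign xD (add (var xD) (const 1)))

/-- There is no solution, or a solution on the set `S` of vertices has been computed. -/
structure Progress (I : Inst) (S : ℕ → Prop) (s : State) : Prop where
  result : (s.var xAns = 1 ∧ ∃ f, Rest I f s ∧ IsSol I f ∧ ∀ u, f u ≠ 0 ↔ S u) ∨
    (s.var xAns = 0 ∧ ∀ g, IsSol I g → ¬ ∀ u, g u ≠ 0 ↔ u < I.n)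

theorem Progress.congr {S S' : ℕ → Prop} {s : State} (h : Progress I S s)
    (hS : ∀ u, S u ↔ S' u) : Progress I S' s := by
  rwa [← funext fun u => propext (hS u)]

theorem Rest.setVar {s : State} (h : Rest I f s) {x y : ℕ} (h0 : x ≠ 0) (h1 : x ≠ 1) :
    Rest I f (s.setVar x y) :=
  ⟨h.static.setVar h0 h1, h.lab, h.rep, h.dec, h.pin_le, h.bit⟩

theorem Progress.setVar {S : ℕ → Prop} {s : State} (h : Progress I S s) {x y : ℕ} (h0 : x ≠ 0)
    (h1 : x ≠ 1) (h2 : x ≠ 2) : Progress I S (s.setVar x y) := by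
  constructor
  rw [State.setVar_var, if_neg (Ne.symm h2)]
  exact h.result.imp_left fun ⟨a, f, b, c⟩ => ⟨a, f, b.setVar h0 h1, c⟩

/-- The restriction of a solution is a solution. -/
theorem IsSol.restrict {g : ℕ → ℕ} (hg : IsSol I g) (S : ℕ → Prop) [DecidablePred S] :
    IsSol I fun u => if S u then g u else 0 where
  le u := by
    have := hg.le u
    split_ifs <;> omega
  ok a b ha hb hab := by
    simp only [ne_eq, ite_eq_right_iff, Classical.not_imp] at ha hb
    exact (hg.ok a b ha.2 hb.2 hab).congr (if_pos ha.1) (if_pos hb.1)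

/-- The vertices that have been inserted, if those of degree `d` below `cur` are still missing. -/
def Inserted (I : Inst) (d cur u : ℕ) : Prop :=
  u < I.n ∧ (I.deg u < d ∨ I.deg u = d ∧ cur ≤ u)

/-- The number of vertices of degree `d` below `c`. -/
def bucketCard (I : Inst) (d c : ℕ) : ℕ := ((Finset.range c).filter fun u => I.deg u = d).card

theorem bucketCard_mono {d c c' : ℕ} (h : c ≤ c') : bucketCard I d c ≤ bucketCard I d c' :=
  Finset.card_le_card (Finset.filter_subset_filter _ (Finset.range_subset_range.2 h))

theorem bucketCard_succ {d c : ℕ} (h : I.deg c = d) :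
    bucketCard I d (c + 1) = bucketCard I d c + 1 := by
  unfold bucketCard
  rw [Finset.range_add_one, Finset.filter_insert, if_pos h,
    Finset.card_insert_of_notMem (by simp)]

/-- A bucket lists its vertices in decreasing order and all smaller degrees are done before, so each
inserted vertex has maximum degree among those present, as `Ext` requires. -/
theorem run_insertBucket {s : State} {d cur : ℕ} (hst : Static I s)
    (hnext : ∀ u, u < I.n → IsLast I u (I.deg u) (s.arr aNext u)) (hcur : s.var xCur = cur)
    (hlast : IsLast I I.n d cur) (hp : Progress I (Inserted I d cur) s) :
    Run I.W insertBucket s (bucketCard I d I.n * (extendTime I.k d + 20) + 2) fun s' =>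
      Progress I (Inserted I (d + 1) I.n) s' := by
  have hW1 := I.n_lt
  have hW2 := I.k_lt
  unfold insertBucket
  have hcn : cur ≤ I.n := by rcases hlast.1 with h | h <;> omega
  refine (Run.loop (W := I.W) (γ := ℕ) (c₀ := cur) (fun c s' => s'.var xCur = c ∧
    (c = 0 ∨ c ≤ I.n ∧ I.deg (c - 1) = d) ∧ Progress I (Inserted I d c) s')
    (fun c _ => bucketCard I d c * (extendTime I.k d + 20)) ⟨hcur, hlast.1, hp⟩ ?_ ?_).mono ?_ ?_
  · rintro c s' ⟨h1, h2, -⟩ -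
    simp only [Expr.Fits, h1]
    omega
  · rintro c s' ⟨h1, h2, h3⟩ hf hg
    simp only [Expr.eval, h1] at hg
    obtain ⟨w, rfl⟩ : ∃ w, c = w + 1 := ⟨c - 1, by omega⟩
    obtain ⟨hwn, hwd⟩ := h2.resolve_left hg
    rw [Nat.add_sub_cancel] at hwd
    have hn : s'.arr aNext = s.arr aNext := hf.arr _ (by decide)
    have hlw := hnext w hwn
    rw [hwd] at hlw
    obtain ⟨c', hc'⟩ : ∃ c', s.arr aNext w = c' := ⟨_, rfl⟩
    rw [hc'] at hlw
    have hc'w : c' ≤ w := by rcases hlw.1 with h | h <;> omega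
    have hst' : Static I s' := hst.frame hf
    refine ⟨extendTime I.k d + 10, ?_⟩
    rw [Run.assign_seq_iff, Run.assign_seq_iff]
    simp only [Expr.Fits, Expr.eval, Expr.cost, State.setVar_var, State.setVar_arr]
    simp only [reduceIte, h1, hn, Nat.add_sub_cancel, hc']
    refine ⟨by omega, by omega, by omega, by omega, ?_⟩
    have hins : ∀ u, Inserted I d c' u ↔ Inserted I d (w + 1) u ∨ u = w := by
      intro u
      unfold Inserted
      constructor
      · rintro ⟨p, q | ⟨q, r⟩⟩
        · exact .inl ⟨p, .inl q⟩
        · by_cases huw : u = w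
          · exact .inr huw
          · left
            refine ⟨p, .inr ⟨q, ?_⟩⟩
            by_contra hcon
            have := hlw.2 u (by omega) q
            omega
      · rintro (⟨p, q⟩ | rfl)
        · exact ⟨p, q.imp_right fun q => ⟨q.1, by omega⟩⟩
        · exact ⟨hwn, .inr ⟨hwd, hc'w⟩⟩
    set s₁ := (s'.setVar xV w).setVar xCur c' with hs₁
    have hp1 : Progress I (Inserted I d (w + 1)) s₁ := (h3.setVar (by decide) (by decide)
      (by decide)).setVar (by decide) (by decide) (by decide)
    have e1 : s₁.var xCur = c' := by simp [hs₁]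
    have e2 : s₁.var xV = w := by simp [hs₁]
    have hΦ : (var xCur).cost + 1 + (extendTime I.k d + 10) +
        bucketCard I d c' * (extendTime I.k d + 20) ≤
        bucketCard I d (w + 1) * (extendTime I.k d + 20) := by
      rw [bucketCard_succ hwd, Nat.add_mul _ 1]
      have := Nat.mul_le_mul_right (extendTime I.k d + 20) (bucketCard_mono (I := I) (d := d) hc'w)
      simp only [Expr.cost]
      omega
    have hlast' : c' = 0 ∨ c' ≤ I.n ∧ I.deg (c' - 1) = d :=
      hlw.1.imp_right fun h => ⟨by omega, h.2⟩
    have hans : s₁.var xAns ≤ 1 := by rcases hp1.result with h | h <;> omega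
    rw [Run.ite_iff]
    simp only [Expr.Fits, Expr.eval]
    refine ⟨by omega, by simp only [Expr.cost]; omega, fun ha => ?_, fun ha => ?_⟩
    · obtain ⟨ha1, f, hr, hsol, hf'⟩ := hp1.result.resolve_right fun h => ha h.1
      have hx : Ext I f w := by
        refine ⟨hsol, fun u hu => ((hf' u).1 hu).1, hwn, ?_, fun u hu => ?_⟩
        · by_contra hcon
          have := (hf' w).1 hcon
          unfold Inserted at this
          omega
        · have := (hf' u).1 hu
          unfold Inserted at this
          omega
      have := run_extend hx hr e2 ha1
      rw [hwd] at this
      refine this.frame.mono (by simp only [Expr.cost]; omega) ?_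
      rintro s₂ ⟨⟨h2⟩, hf2⟩
      refine ⟨c', ⟨(hf2.var _ (by decide)).trans e1, hlast', ⟨?_⟩⟩, hΦ⟩
      rcases h2 with ⟨p1, f', ⟨p2, p3⟩, p4⟩ | ⟨p1, p2⟩
      · exact .inl ⟨p1, f', p4, p2, fun u => by rw [p3, hins, hf']⟩
      · refine .inr ⟨p1, fun g hg hgs => ?_⟩
        classical
        -- A solution on all vertices would restrict to one on the inserted vertices and `w`, which
        -- was just excluded.
        refine p2 _ ⟨hg.restrict (Inserted I d c'), fun u => ?_⟩
        rw [hf', ← hins]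
        constructor
        · intro h
          by_contra hcon
          exact h (if_neg hcon)
        · intro h
          rw [if_pos h]
          exact (hgs u).2 h.1
    · rw [Run.skip_iff]
      refine ⟨by simp only [Expr.cost]; omega, c', ⟨e1, hlast', ⟨?_⟩⟩, hΦ⟩
      exact .inr (hp1.result.resolve_left fun h => by omega)
  · have := Nat.mul_le_mul_right (extendTime I.k d + 20) (bucketCard_mono (I := I) (d := d) hcn)
    simp only [Expr.cost]
    omega
  · rintro s' ⟨c, ⟨h1, h2, h3⟩, hg, -⟩
    simp only [Expr.eval, h1] at hg
    subst hg
    refine h3.congr fun u => ?_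
    unfold Inserted
    omega

/-- The time for inserting the vertices of degree at least `d`. -/
def insertTime (I : Inst) (d : ℕ) : ℕ :=
  ∑ u ∈ (Finset.range I.n).filter fun u => d ≤ I.deg u, (extendTime I.k (I.deg u) + 20)

theorem insertTime_succ (d : ℕ) :
    insertTime I d = bucketCard I d I.n * (extendTime I.k d + 20) + insertTime I (d + 1) := by
  have h1 : (Finset.range I.n).filter (fun u => d ≤ I.deg u) =
      (Finset.range I.n).filter (fun u => I.deg u = d) ∪
        (Finset.range I.n).filter (fun u => d + 1 ≤ I.deg u) := by
    ext u
    simp only [Finset.mem_filter, Finset.mem_union, Finset.mem_range]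
    omega
  unfold insertTime bucketCard
  rw [h1, Finset.sum_union]
  · congr 1
    rw [Finset.sum_congr rfl (g := fun _ => extendTime I.k d + 20) fun u hu => by
      rw [(Finset.mem_filter.1 hu).2], Finset.sum_const, smul_eq_mul]
  · rw [Finset.disjoint_left]
    intro u hu hu'
    have := (Finset.mem_filter.1 hu).2
    have := (Finset.mem_filter.1 hu').2
    omega

/-- By `hdeg` the buckets of degrees `0, …, n - 1` contain every vertex. -/
theorem run_insertAll {s : State} (hs : SetupPost I s) (hdeg : ∀ u, u < I.n → I.deg u < I.n)
    (hr : Rest I (fun _ => 0) s) :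
    Run I.W insertAll s (insertTime I 0 + I.n * 20 + 10) (Progress I (fun u => u < I.n)) := by
  have hW1 := I.n_lt
  have hW2 := I.k_lt
  unfold insertAll
  simp only [Run.assign_seq_iff, Expr.Fits, Expr.eval, Expr.cost]
  refine ⟨by omega, by omega, by omega, by omega, ?_⟩
  set s₀ := (s.setVar xAns 1).setVar xD 0 with hs₀
  have hst0 : Static I s₀ := (hs.static.setVar (by decide) (by decide)).setVar (by decide)
    (by decide)
  have e0 : s₀.var xD = 0 := by simp [hs₀]
  refine (Run.loop (W := I.W) (γ := ℕ) (c₀ := 0) (fun d s' => s'.var xD = d ∧ d ≤ I.n ∧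
    Progress I (fun u => u < I.n ∧ I.deg u < d) s')
    (fun d _ => insertTime I d + (I.n - d) * 20) ⟨e0, by omega, ⟨.inl ⟨by simp [hs₀],
      fun _ => 0, ?_, ⟨fun _ => by omega, fun a b ha => absurd rfl ha⟩, by simp⟩⟩⟩ ?_ ?_).mono ?_ ?_
  · exact (hr.setVar (by decide) (by decide)).setVar (by decide) (by decide)
  · rintro d s' ⟨h1, h2, -⟩ hf
    have hn : s'.var xN = I.n := (hst0.frame (p := assign xCur (read aHead (var xD)) ;;
      insertBucket ;; assign xD (add (var xD) (const 1))) hf).n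
    simp only [Expr.Fits, hn, h1]
    omega
  · rintro d s' ⟨h1, h2, h3⟩ hf hg
    have hst' : Static I s' := hst0.frame hf
    have k1 : s'.arr aHead = s.arr aHead := hf.arr _ (by decide)
    have k2 : s'.arr aNext = s.arr aNext := hf.arr _ (by decide)
    rw [lt_eval_ne_zero] at hg
    simp only [Expr.eval, h1, hst'.n] at hg
    have hhead := hs.head d
    obtain ⟨c, hc⟩ : ∃ c, s.arr aHead d = c := ⟨_, rfl⟩
    rw [hc] at hhead
    have hcn : c ≤ I.n := by rcases hhead.1 with h | h <;> omega
    refine ⟨bucketCard I d I.n * (extendTime I.k d + 20) + 9, ?_⟩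
    rw [Run.assign_seq_iff]
    simp only [Expr.Fits, Expr.eval, Expr.cost, h1, k1, hc]
    refine ⟨by omega, by omega, ?_⟩
    refine Run.bind _ (run_insertBucket (d := d) (cur := c) (hst'.setVar (by decide) (by decide))
      (by simpa [k2] using hs.next) (by simp) hhead ?_) (by omega) ?_
    · refine (h3.setVar (by decide) (by decide) (by decide)).congr fun u => ?_
      unfold Inserted
      refine and_congr_right fun hu => ⟨.inl, ?_⟩
      rintro (h | ⟨h, h'⟩)
      · exact h
      · have := hhead.2 u hu h
        omega
    · intro s₂ hp hf2
      have l1 : s₂.var xD = d := by rw [hf2.var _ (by decide)]; simp [h1]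
      rw [Run.assign_iff]
      simp only [Expr.Fits, Expr.eval, Expr.cost, l1]
      refine ⟨by omega, by omega, d + 1, ⟨by simp, hg, ?_⟩, ?_⟩
      · refine (hp.setVar (by decide) (by decide) (by decide)).congr fun u => ?_
        unfold Inserted
        omega
      · rw [insertTime_succ d, show I.n - d = (I.n - (d + 1)) + 1 by omega, Nat.add_mul _ 1]
        omega
  · simp only [Expr.cost]; omega
  · rintro s' ⟨d, ⟨h1, h2, h3⟩, hg, hf⟩
    have hst' : Static I s' := hst0.frame (p := assign xCur (read aHead (var xD)) ;;
      insertBucket ;; assign xD (add (var xD) (const 1))) hf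
    rw [lt_eval_eq_zero] at hg
    simp only [Expr.eval, h1, hst'.n] at hg
    refine h3.congr fun u => ?_
    refine ⟨fun h => h.1, fun h => ⟨h, ?_⟩⟩
    have := hdeg u h
    omega

/-- The algorithm. -/
def decideMonopolar : Prog := setup ;; insertAll

theorem run_decideMonopolar {s : State} (hs : Init I s) (hdeg : ∀ u, u < I.n → I.deg u < I.n) :
    Run I.W decideMonopolar s ((I.off I.n - I.off 0) * 25 + I.n * 80 + insertTime I 0 + 20)
      (Progress I (fun u => u < I.n)) := by
  refine Run.bind _ (run_setup hs) (by omega) fun s₁ h1 hf => ?_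
  refine (run_insertAll h1 hdeg ⟨h1.static, ?_, ⟨fun i => ?_, fun i _ _ _ u h => ?_,
    fun i r _ _ h => ?_⟩, fun u => ?_, fun i => ?_, fun i _ => ?_⟩).mono (by omega) fun _ => id
  · rw [hf.arr _ (by decide)]; exact funext (hs.zero _ (by omega))
  · rw [hf.arr _ (by decide), hs.zero _ (by omega)]; omega
  · omega
  · rw [hf.arr _ (by decide), hs.zero _ (by omega)] at h; omega
  · rw [hf.arr _ (by decide), hs.zero _ (by omega)]
  · rw [hf.arr _ (by decide), hs.zero _ (by omega)]; omega
  · rw [hf.arr _ (by decide), hs.zero _ (by omega)]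

/-! ### Adjacency lists of a graph -/

variable {n : ℕ} {G : SimpleGraph (Fin n)} {L : Fin n → List (Fin n)}

/-- An entry of a concatenation sits at the total length of the preceding lists plus its position in
its own list. -/
theorem getElem?_flatten {α : Type*} (l : List (List α)) (i j : ℕ) (hi : i < l.length)
    (hj : j < l[i].length) : l.flatten[(l.take i).flatten.length + j]? = some l[i][j] := by
  conv_lhs => rw [← List.take_append_drop i l, List.flatten_append, List.drop_eq_getElem_cons hi,
    List.flatten_cons]
  rw [List.getElem?_append_right (by simp), List.take_append_of_le_length (by simp; omega)]
  simp only [List.take_take, min_self, Nat.add_sub_cancel_left]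
  rw [List.getElem?_append_left hj, List.getElem?_eq_getElem hj]

/-- The offsets of the adjacency lists. -/
def offset (L : Fin n → List (Fin n)) (i : ℕ) : ℕ :=
  if i ≤ n then ((List.ofFn L).take i).flatten.length else 0

theorem offset_succ {u : ℕ} (hu : u < n) : offset L (u + 1) = offset L u + (L ⟨u, hu⟩).length := by
  unfold offset
  rw [if_pos (show u + 1 ≤ n from hu), if_pos hu.le, List.take_add_one, List.flatten_append, List.length_append]
  simp [hu]

theorem offset_eq_sum {i : ℕ} (hi : i ≤ n) :
    offset L i = ∑ u ∈ Finset.range i, (offset L (u + 1) - offset L u) := by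
  induction i with
  | zero => simp [offset]
  | succ i ih =>
    rw [Finset.sum_range_succ, ← ih (by omega)]
    have := offset_succ (L := L) (u := i) hi
    omega

theorem length_eq_degree [DecidableRel G.Adj] (hL : IsAdjacencyLists G L) (v : Fin n) :
    (L v).length = G.degree v := by
  rw [← List.toFinset_card_of_nodup (hL v).1, ← SimpleGraph.card_neighborFinset_eq_degree]
  congr 1
  ext w
  simp [(hL v).2 w]

/-- The handshake lemma: list lengths are degrees. -/
theorem offset_last (hL : IsAdjacencyLists G L) : offset L n = 2 * G.edgeSet.ncard := by
  classical
  have h : ∀ u : Fin n, offset L (u + 1) - offset L u = G.degree u := fun u => by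
    rw [offset_succ u.2, Nat.add_sub_cancel_left, length_eq_degree hL]
  rw [offset_eq_sum le_rfl, Finset.sum_range, Finset.sum_congr rfl fun u _ => h u,
    G.sum_degrees_eq_twice_card_edges, Set.ncard_eq_toFinset_card']
  rfl

theorem offset_le {i : ℕ} (hi : i ≤ n) : offset L i ≤ offset L n := by
  rw [offset_eq_sum hi, offset_eq_sum le_rfl]
  exact Finset.sum_le_sum_of_subset (Finset.range_subset_range.2 hi)

/-- The adjacency relation on numbers. -/
def natAdj (G : SimpleGraph (Fin n)) (a b : ℕ) : Prop :=
  ∃ (ha : a < n) (hb : b < n), G.Adj ⟨a, ha⟩ ⟨b, hb⟩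

/-- The neighbours in the order of the adjacency lists. -/
def neighbour (L : Fin n → List (Fin n)) (i : ℕ) : ℕ :=
  ((List.ofFn L).flatten.map Fin.val).getD i 0

theorem neighbour_offset {u j : ℕ} (hu : u < n) (hj : j < (L ⟨u, hu⟩).length) :
    neighbour L (offset L u + j) = ((L ⟨u, hu⟩)[j] : ℕ) := by
  have := getElem?_flatten (List.ofFn L) u j (by simpa using hu) (by simpa using hj)
  unfold neighbour offset
  rw [if_pos hu.le, List.getD_eq_getElem?_getD, List.getElem?_map, this]
  simp

theorem natAdj_iff (hL : IsAdjacencyLists G L) {u : ℕ} (hu : u < n) (w : ℕ) :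
    natAdj G u w ↔ ∃ e, offset L u ≤ e ∧ e < offset L (u + 1) ∧ neighbour L e = w := by
  rw [offset_succ hu]
  constructor
  · rintro ⟨_, hw, hadj⟩
    obtain ⟨j, hj, he⟩ := List.getElem_of_mem (((hL ⟨u, hu⟩).2 ⟨w, hw⟩).2 hadj)
    exact ⟨offset L u + j, by omega, by omega, by rw [neighbour_offset hu hj, he]⟩
  · rintro ⟨e, h1, h2, rfl⟩
    obtain ⟨j, rfl⟩ := Nat.exists_eq_add_of_le h1
    have hj : j < (L ⟨u, hu⟩).length := by omega
    rw [neighbour_offset hu hj]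
    exact ⟨hu, Fin.is_lt _, ((hL ⟨u, hu⟩).2 _).1 (List.getElem_mem hj)⟩

/-- With `N = n + m + k + 2 ≥ 2`, the fifth power is at least `16 * N`, which dominates the linear
quantities, and at least `N ^ 2`, which covers the matrix indices. -/
theorem lt_word (n m k : ℕ) : 2 * m < (n + m + k + 2) ^ 5 ∧ n * n < (n + m + k + 2) ^ 5 ∧
    n + 10 < (n + m + k + 2) ^ 5 ∧ 4 * k + 10 < (n + m + k + 2) ^ 5 := by
  obtain ⟨N, hN⟩ : ∃ N, n + m + k + 2 = N := ⟨_, rfl⟩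
  rw [hN]
  have h1 : 2 ^ 4 * N ≤ N ^ 5 := by
    rw [pow_succ N 4]
    exact Nat.mul_le_mul_right _ (Nat.pow_le_pow_left (by omega) 4)
  have h2 : n * n < N ^ 5 := by
    calc n * n < N * N := Nat.mul_self_lt_mul_self (by omega)
      _ = N ^ 2 := by ring
      _ ≤ N ^ 5 := Nat.pow_le_pow_right (by omega) (by omega)
  omega

/-- The instance given by the adjacency lists of a graph. -/
noncomputable def toInst (k : ℕ) (hL : IsAdjacencyLists G L) : Inst where
  n := n
  k := k
  W := (n + G.edgeSet.ncard + k + 2) ^ 5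
  off := offset L
  nbr := neighbour L
  E := natAdj G
  symm := fun ⟨ha, hb, h⟩ => ⟨hb, ha, h.symm⟩
  irrefl := fun _ ⟨_, _, h⟩ => G.loopless.irrefl _ h
  lt := fun ⟨ha, _, _⟩ => ha
  off_le u hu := by rw [offset_succ hu]; omega
  mem _ hu w := natAdj_iff hL hu w
  off_lt u hu := by
    have h1 := offset_le (L := L) hu
    rw [offset_last hL] at h1
    have := (lt_word n G.edgeSet.ncard k).1
    omega
  sq_lt := (lt_word n G.edgeSet.ncard k).2.1
  n_lt := (lt_word n G.edgeSet.ncard k).2.2.1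
  k_lt := (lt_word n G.edgeSet.ncard k).2.2.2

theorem init_inputState (k : ℕ) (hL : IsAdjacencyLists G L) :
    Init (toInst k hL) (inputState L k) where
  n := rfl
  k := rfl
  off := rfl
  nbr := rfl
  zero a ha i := by
    simp only [inputState]
    rw [if_neg (by omega), if_neg (by omega)]

theorem deg_lt (k : ℕ) (hL : IsAdjacencyLists G L) (u : ℕ) (hu : u < n) :
    (toInst k hL).deg u < n := by
  classical
  have h1 : (toInst k hL).deg u = G.degree ⟨u, hu⟩ := by
    rw [← length_eq_degree hL]
    change offset L (u + 1) - offset L u = _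
    rw [offset_succ hu, Nat.add_sub_cancel_left]
  rw [h1]
  simpa using G.degree_lt_card_verts ⟨u, hu⟩

/-! ### Solutions and monopolar partitions -/

/-- The components of `G[A]` are numbered, and a vertex of `A` gets `2` plus the number of its
component. In a cluster graph, reachable and adjacent are the same for distinct vertices, which is
the condition on labels. -/
theorem exists_isSol {k : ℕ} (hL : IsAdjacencyLists G L) {A B : Set (Fin n)}
    (h : IsMonopolarPartition G k A B) :
    ∃ f, IsSol (toInst k hL) f ∧ ∀ u, f u ≠ 0 ↔ u < n := by
  classical
  have hcard : Nat.card (G.induce A).ConnectedComponent ≤ k := by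
    have := h.card_clusters_le
    rw [ENat.card_eq_coe_natCard] at this
    exact_mod_cast this
  let ι := Finite.equivFin (G.induce A).ConnectedComponent
  let f : ℕ → ℕ := fun u => if hu : u < n then
    if hA : (⟨u, hu⟩ : Fin n) ∈ A then
      2 + (ι ((G.induce A).connectedComponentMk ⟨⟨u, hu⟩, hA⟩) : ℕ) else 1 else 0
  have hfA : ∀ u (hu : u < n) (hA : (⟨u, hu⟩ : Fin n) ∈ A),
      f u = 2 + (ι ((G.induce A).connectedComponentMk ⟨⟨u, hu⟩, hA⟩) : ℕ) := fun u hu hA => by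
    simp only [f, dif_pos hu, dif_pos hA]
  have hfB : ∀ u (hu : u < n), (⟨u, hu⟩ : Fin n) ∉ A → f u = 1 := fun u hu hA => by
    simp only [f, dif_pos hu, dif_neg hA]
  have hf0 : ∀ u, ¬ u < n → f u = 0 := fun u hu => by simp only [f, dif_neg hu]
  have hlt : ∀ u, f u ≠ 0 → u < n := fun u hu => by
    by_contra hcon
    exact hu (hf0 u hcon)
  have hmemA : ∀ u (hu : u < n), 1 < f u → (⟨u, hu⟩ : Fin n) ∈ A := fun u hu h1 => by
    by_contra hA
    rw [hfB u hu hA] at h1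
    omega
  have hmemB : ∀ u (hu : u < n), f u = 1 → (⟨u, hu⟩ : Fin n) ∈ B := fun u hu h1 => by
    have hun : (⟨u, hu⟩ : Fin n) ∈ A ∪ B := h.union_eq ▸ Set.mem_univ _
    refine hun.resolve_left fun hA => ?_
    rw [hfA u hu hA] at h1
    omega
  refine ⟨f, ⟨fun u => ?_, fun a b ha hb hab => ⟨fun h1 h2 => ?_, fun h1 h2 => ?_⟩⟩, fun u =>
    ⟨hlt u, fun hu => ?_⟩⟩
  · change f u ≤ k + 1
    by_cases hu : u < n
    · by_cases hA : (⟨u, hu⟩ : Fin n) ∈ A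
      · rw [hfA u hu hA]
        have := (ι ((G.induce A).connectedComponentMk ⟨⟨u, hu⟩, hA⟩)).2
        omega
      · rw [hfB u hu hA]; omega
    · rw [hf0 u hu]; omega
  · rintro ⟨ha', hb', hadj⟩
    have : (G.induce B).Adj ⟨_, hmemB a ha' h1⟩ ⟨_, hmemB b hb' h2⟩ := hadj
    rw [h.edgeless] at this
    exact this
  · have ha' := hlt a ha
    have hb' := hlt b hb
    have hA := hmemA a ha' h1
    have hB := hmemA b hb' h2
    rw [hfA a ha' hA, hfA b hb' hB, Nat.add_left_cancel_iff, Fin.val_inj, ι.injective.eq_iff,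
      SimpleGraph.ConnectedComponent.eq]
    constructor
    · rintro ⟨_, _, hadj⟩
      exact SimpleGraph.Adj.reachable (G := G.induce A) (u := ⟨_, hA⟩) (v := ⟨_, hB⟩) hadj
    · intro hr
      exact ⟨ha', hb', h.cluster _ _ hr (by simpa using hab)⟩
  · by_cases hA : (⟨u, hu⟩ : Fin n) ∈ A
    · rw [hfA u hu hA]; omega
    · rw [hfB u hu hA]; omega

theorem exists_isMonopolarPartition {k : ℕ} (hL : IsAdjacencyLists G L) {f : ℕ → ℕ}
    (hf : IsSol (toInst k hL) f) (hs : ∀ u, f u ≠ 0 ↔ u < n) :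
    ∃ A B : Set (Fin n), IsMonopolarPartition G k A B := by
  classical
  have hpos : ∀ u : Fin n, f u ≠ 0 := fun u => (hs u).2 u.2
  have hok : ∀ a b : Fin n, a ≠ b → Ok (natAdj G) f a b := fun a b hab =>
    hf.ok a b (hpos a) (hpos b) fun h => hab (Fin.ext h)
  have hadj : ∀ {a b : Fin n}, natAdj G a b ↔ G.Adj a b := fun {a b} =>
    ⟨fun ⟨_, _, h⟩ => h, fun h => ⟨a.2, b.2, h⟩⟩
  let A : Set (Fin n) := {u | 1 < f u}
  -- Labels are constant along walks in `G[A]`; with adjacency inside label classes, the components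
  -- are the classes.
  have hreach : ∀ u v : A, (G.induce A).Reachable u v → f u.1 = f v.1 := by
    rintro u v ⟨p⟩
    induction p with
    | nil => rfl
    | @cons u v w h _ ih =>
      rw [← ih]
      exact ((hok _ _ (SimpleGraph.Adj.ne (G := G) h)).2 (show 1 < f u.1 from u.2)
        (show 1 < f v.1 from v.2)).1
        (hadj.2 h)
  refine ⟨A, {u | f u = 1}, ?_, ?_, ?_, ?_, ?_⟩
  · ext u
    have := hpos u
    simp only [A, Set.mem_union, Set.mem_ofPred_eq, Set.mem_univ, iff_true]
    omega
  · rw [Set.disjoint_left]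
    intro u (h1 : 1 < f u) (h2 : f u = 1)
    omega
  · intro u v hr huv
    exact hadj.1 (((hok _ _ fun h => huv (Subtype.ext h)).2 u.2 v.2).2 (hreach u v hr))
  · rw [ENat.card_eq_coe_natCard]
    have key : Nat.card (G.induce A).ConnectedComponent ≤ Nat.card (Fin k) := by
      -- A component is sent to the label of a chosen vertex, shifted to start at `0`. Equal labels
      -- make the chosen vertices equal or adjacent, so the components coincide.
      refine Nat.card_le_card_of_injective
        (fun c => ⟨f c.out.1 - 2, ?_⟩) fun c c' hcc => ?_
      · have h1 : 1 < f c.out.1 := c.out.2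
        have h2 : f c.out.1 ≤ k + 1 := hf.le _
        omega
      · have h1 : 1 < f c.out.1 := c.out.2
        have h2 : 1 < f c'.out.1 := c'.out.2
        have h3 : f c.out.1 - 2 = f c'.out.1 - 2 := by simpa using hcc
        rw [← c.out_eq, ← c'.out_eq]
        by_cases h : c.out = c'.out
        · rw [h]
        · apply Quot.sound
          refine SimpleGraph.Adj.reachable (G := G.induce A) ?_
          exact hadj.1 (((hok _ _ fun h' => h (Subtype.ext h')).2 h1 h2).2 (by omega))
    rw [Nat.card_fin] at key
    exact_mod_cast key
  · ext u v
    simp only [SimpleGraph.comap_adj, SimpleGraph.bot_adj, iff_false]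
    intro h
    exact (hok u v (SimpleGraph.Adj.ne (G := G) h)).1 u.2 v.2 (hadj.2 h)

/-! ### The running time -/

/-- The product `(4 * k + 6) * (50 * k + 450)` is only quadratic, at most `10 * K * (500 * K)` with
`K = max k 1`. The constant is `4 * 5000`, with `4` from `2 ^ (k + 2)`, plus `230` for the
lower-order terms. -/
theorem extendTime_le (k d : ℕ) :
    extendTime k d + 20 ≤ 20230 * (2 ^ k * max k 1 ^ 3) * (d + 1) := by
  obtain ⟨K, hK⟩ : ∃ K, max k 1 = K := ⟨_, rfl⟩
  have hk : k ≤ K := by omega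
  have hK1 : 1 ≤ K := by omega
  rw [hK]
  have h1 : (4 * k + 6) * (50 * k + 450) ≤ 5000 * K ^ 3 :=
    calc (4 * k + 6) * (50 * k + 450) ≤ (10 * K) * (500 * K) :=
          Nat.mul_le_mul (by omega) (by omega)
      _ = 5000 * K ^ 2 := by ring
      _ ≤ 5000 * K ^ 3 := Nat.mul_le_mul_left _ (Nat.pow_le_pow_right hK1 (by omega))
  have h2 : 60 * k + 170 ≤ 230 * (2 ^ k * K ^ 3) * (d + 1) :=
    calc 60 * k + 170 ≤ 230 * K ^ 1 := by rw [pow_one]; omega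
      _ ≤ 230 * K ^ 3 := Nat.mul_le_mul_left _ (Nat.pow_le_pow_right hK1 (by omega))
      _ ≤ 230 * (2 ^ k * K ^ 3) :=
        Nat.mul_le_mul_left _ (Nat.le_mul_of_pos_left _ (by positivity))
      _ ≤ 230 * (2 ^ k * K ^ 3) * (d + 1) := Nat.le_mul_of_pos_right _ (by omega)
  have h3 : 2 ^ (k + 2) * guessTime k d ≤ 20000 * (2 ^ k * K ^ 3) * (d + 1) :=
    calc 2 ^ (k + 2) * guessTime k d
        = 4 * 2 ^ k * (d + 1) * ((4 * k + 6) * (50 * k + 450)) := by unfold guessTime; ring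
      _ ≤ 4 * 2 ^ k * (d + 1) * (5000 * K ^ 3) := Nat.mul_le_mul_left _ h1
      _ = 20000 * (2 ^ k * K ^ 3) * (d + 1) := by ring
  unfold extendTime
  calc _ ≤ 20000 * (2 ^ k * K ^ 3) * (d + 1) + 230 * (2 ^ k * K ^ 3) * (d + 1) := by omega
    _ = _ := by ring

/-- The costs are proportional to `deg u + 1`, and the degrees add up to `2 * m`. -/
theorem insertTime_le (k : ℕ) (hL : IsAdjacencyLists G L) :
    insertTime (toInst k hL) 0 ≤
      20230 * (2 ^ k * max k 1 ^ 3) * (2 * G.edgeSet.ncard + n) := by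
  have h : ∑ u ∈ Finset.range n, ((toInst k hL).deg u + 1) = 2 * G.edgeSet.ncard + n := by
    rw [Finset.sum_add_distrib, ← offset_last hL, offset_eq_sum le_rfl]
    simp [Inst.deg, toInst]
  rw [← h, Finset.mul_sum]
  unfold insertTime
  rw [Finset.filter_true_of_mem fun _ _ => Nat.zero_le _]
  exact Finset.sum_le_sum fun u _ => extendTime_le k _

end Monopolar

open Monopolar in
/-- There are one program and absolute constants `c` and `C` such that, for every graph `G` on
`n` vertices with `m` edges, given by adjacency lists, and every `k`, the program, run with
words of `c * log (n + m + k + 2)` bits, halts within `C * 2 ^ k * k ^ 3 * (n + m)` time units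
(factors `k` and `n + m` that vanish are read as `1`), and answers (`1` for yes and `0` for no,
in variable `2`) whether `G` has a monopolar partition with at most `k` clusters. -/
theorem theorem1 :
    ∃ (P : RAM.Prog) (c C : ℕ), ∀ (n k : ℕ) (G : SimpleGraph (Fin n))
      (L : Fin n → List (Fin n)), IsAdjacencyLists G L →
      ∃ (s : RAM.State) (t : ℕ),
        RAM.Exec ((n + G.edgeSet.ncard + k + 2) ^ c) P (inputState L k) s t ∧
        t ≤ C * (2 ^ k * (max k 1) ^ 3 * max (n + G.edgeSet.ncard) 1) ∧
        ((∃ A B : Set (Fin n), IsMonopolarPartition G k A B) → s.var 2 = 1) ∧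
        ((¬ ∃ A B : Set (Fin n), IsMonopolarPartition G k A B) → s.var 2 = 0) := by
  -- The exponent is that of `lt_word`. Since `2 * m + n` is at most twice `max (n + m) 1`, the
  -- insertions cost at most `40460` units of the bound, and the set-up with the loop overhead at
  -- most `100` more.
  refine ⟨decideMonopolar, 5, 50000, fun n k G L hL => ?_⟩
  obtain ⟨s, t, hexec, ht, hres⟩ := run_decideMonopolar (init_inputState k hL) (deg_lt k hL)
  refine ⟨s, t, hexec, ?_, ?_, ?_⟩
  · refine ht.trans ?_
    have h1 := insertTime_le k hL
    have h2 : (toInst k hL).off (toInst k hL).n - (toInst k hL).off 0 ≤ 2 * G.edgeSet.ncard := by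
      rw [← offset_last hL]
      exact Nat.sub_le _ _
    have h3 : (toInst k hL).n = n := rfl
    obtain ⟨M, hM⟩ : ∃ M, max (n + G.edgeSet.ncard) 1 = M := ⟨_, rfl⟩
    obtain ⟨X, hX⟩ : ∃ X, 2 ^ k * max k 1 ^ 3 = X := ⟨_, rfl⟩
    have hX1 : 1 ≤ X := by rw [← hX]; exact Nat.mul_pos (by positivity) (by positivity)
    rw [hX] at h1 ⊢
    rw [hM]
    have h4 : 20230 * X * (2 * G.edgeSet.ncard + n) ≤ 20230 * X * (2 * M) :=
      Nat.mul_le_mul_left _ (by omega)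
    have h5 : M ≤ X * M := Nat.le_mul_of_pos_left _ hX1
    have h6 : 20230 * X * (2 * M) = 40460 * (X * M) := by ring
    omega
  · rintro ⟨A, B, h⟩
    rcases hres.result with h' | h'
    · exact h'.1
    · obtain ⟨f, hf, hs⟩ := exists_isSol hL h
      exact absurd hs (h'.2 f hf)
  · intro h
    rcases hres.result with ⟨-, f, -, hf, hs⟩ | h'
    · exact absurd (exists_isMonopolarPartition hL hf hs) h
    · exact h'.1
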